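/- **Theorem (resources of the monitoring procedure).** *Formulas.* $\mathsf{MTL}[\mathfrak U,\mathfrak S]$ formulas over a set $\mathbf P$ of propositions are generated by $\varphi ::= \mathbf{true}\mid P\mid \varphi\wedge\varphi\mid\neg\varphi\mid \varphi\,\mathcal U_I\,\varphi\mid\varphi\,\mathcal S_I\,\varphi\mid\varphi\,\mathfrak U^c_I\,\varphi\mid\varphi\,\mathfrak S^c_I\,\varphi$, where $I\subseteq(0,\infty)$ is a non-empty interval with endpoints in $\mathbb Q\cup\{\infty\}$ and $c\in\mathbb Q$, $0\le c\le\inf I$; such a formula is *bounded* if all its intervals are bounded. $\mathsf{LTL}$ formulas have only the operators $\mathcal U,\mathcal S$, i.e. $\mathcal U_{(0,\infty)},\mathcal S_{(0,\infty)}$. $|\varphi|$ is the number of (distinct) subformulas of $\varphi$. Let $\hat\varphi=\Phi(\psi_1,\dots,\psi_m)$ be obtained from an $\mathsf{LTL}$ formula $\Phi$ over $\mathbf Q=\{Q_1,\dots,Q_m\}$ by substituting bounded $\mathsf{MTL}[\mathfrak U,\mathfrak S]$ formulas $\psi_i$ over $\mathbf P$ for the $Q_i$, and let $c_{\mathrm{sum}}$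 be the sum of the finite constants (interval endpoints and superscripts $c$) in $\hat\varphi$, taken over its distinct subformulas. *Semantics.* A trace is a sequence $\rho=(\sigma,\tau)$ of events $(\sigma_i,\tau_i)$ with $\sigma_i\subseteq\mathbf P$, $\tau_i\in\mathbb Q$, $\tau_0=0$, $\tau_i<\tau_{i+1}$, and $\tau$ unbounded if $\rho$ is infinite; it has variability $k_{\mathrm{var}}$ if every open interval $(t,t+1)$, $t\ge0$, contains at most $k_{\mathrm{var}}$ events. On an infinite trace, $\rho,i\models\varphi_1\mathcal U_I\varphi_2$ iff there is $j>i$ with $\rho,j\models\varphi_2$, $\tau_j-\tau_i\in I$, and $\rho,k\models\varphi_1$ for all $i<k<j$; for $\mathfrak U^c_I$ the last condition is required only for those $k$ with $\tau_k-\tau_i>c$ and $\tau_j-\tau_k>\inf I-c$; $\mathcal S_I$ and $\mathfrak S^c_I$ are the mirror images. On a non-empty finite trace $\rho$, strong satisfaction $\models^+_f$ and weak satisfaction $\models^-_f$ are given by the same clauses with positions restricted to $\rho$, except that $\rho,i\models_f^{\pm}\neg\varphi$ iff $\rho,i\not\models_f^{\mp}\varphi$, and that $\rho,i\models^-_f\varphi_1\mathcal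 U_I\varphi_2$ also holds if $\tau_{|\rho|-1}-\tau_i<\sup I$ and $\rho,k\models_f^-\varphi_1$ for all $i<k<|\rho|$ (for $\mathfrak U^c_I$: for those $k$ with $\tau_k-\tau_i>c$ and $\tau_{|\rho|-1}-\tau_k\ge\inf I-c$). $\rho$ is an *informative good* (*bad*) prefix for $\varphi$ if $\rho,0\models^+_f\varphi$ ($\rho,0\not\models^-_f\varphi$); for $\mathsf{LTL}$ the same definitions are used on non-empty finite words without timestamps. *Procedure.* The procedure consists of two DFAs $\mathcal D_{\mathrm{good}},\mathcal D_{\mathrm{bad}}$ over $2^{\mathbf Q}$ and of a program that is run once on each event. The program works on a two-dimensional array with a fixed number of columns, one row of timestamps and further rows of truth values, and on pointers to columns, which move cyclically. In unit time it can store the current timestamp, test a proposition of the current event, read or write a truth value, compare the difference of two stored timestamps with a constant, move, copy or compare pointers for equality, or emit a letter of $2^{\mathbf Q}$ read from one column and move both DFAs along it; it has sequencing, conditionals and loops. Nothing except the array, the pointers and the states of the two DFAs is kept from one event to the next. *Claim.* There is an absolute constant $C$ such that for every $\Phi$ there are DFAs $\mathcal D_{\mathrm{good}}$ and $\mathcal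 D_{\mathrm{bad}}$, each with at most $2^{2^{C|\Phi|}}$ states, which accept exactly the informative good, respectively bad, prefixes for $\Phi$; and for all bounded $\psi_1,\dots,\psi_m$ and every $k_{\mathrm{var}}\ge1$ there is a program as above, with at most $C|\hat\varphi|$ instructions and pointers and with an array of at most $C\,k_{\mathrm{var}}(c_{\mathrm{sum}}+1)|\hat\varphi|$ entries (so that the space does not depend on the length of the trace), such that on every infinite trace $\rho$ of variability $k_{\mathrm{var}}$: 1. the program terminates on each event, and for every $n$ the total time spent on the first $n$ events is at most $C|\hat\varphi|\,n$, i.e. the amortised time per event is $O(|\hat\varphi|)$; 2. the emitted word is infinite, and for each $Q_i$ that occurs in $\Phi$ its $j$-th letter contains $Q_i$ iff $\rho,j\models\psi_i$; 3. $\mathcal D_{\mathrm{good}}$ ($\mathcal D_{\mathrm{bad}}$) at some moment reaches an accepting state if and only if some finite prefix of $\rho$ is an informative good (bad) prefix for $\hat\varphi$. -/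

import Mathlib

universe u

/-! ### Intervals, timed words -/

/-- A non-empty interval contained in `(0, ∞)`, with endpoints in `ℚ ∪ {∞}`. -/
structure TInterval where
  lo : ℚ
  hi : WithTop ℚ
  loClosed : Bool
  hiClosed : Bool
  lo_nonneg : 0 ≤ lo
  pos_of_closed : loClosed = true → 0 < lo
  nonempty : (lo : WithTop ℚ) < hi ∨
    ((lo : WithTop ℚ) = hi ∧ loClosed = true ∧ hiClosed = true)

namespace TInterval

/-- Membership of a time distance in the interval. -/
def Mem (I : TInterval) (x : ℚ) : Prop :=
  (if I.loClosed = true then I.lo ≤ x else I.lo < x) ∧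
  (if I.hiClosed = true then (x : WithTop ℚ) ≤ I.hi else (x : WithTop ℚ) < I.hi)

/-- The interval `(0, ∞)`. -/
def unbounded : TInterval where
  lo := 0
  hi := ⊤
  loClosed := false
  hiClosed := false
  lo_nonneg := le_refl 0
  pos_of_closed := fun h => by simp at h
  nonempty := Or.inl (WithTop.coe_lt_top _)

/-- The interval has a finite right endpoint. -/
def IsBounded (I : TInterval) : Prop := I.hi ≠ ⊤

/-- The sum of the finite endpoints of the interval. -/
def constSum (I : TInterval) : ℚ := I.lo + I.hi.untopD 0

end TInterval

/-- An infinite timed word over `2^P` with rational timestamps: the timestamps start at `0`,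
increase strictly, and are unbounded. -/
structure TimedWord (P : Type u) where
  label : ℕ → Set P
  time : ℕ → ℚ
  time_zero : time 0 = 0
  strictMono : StrictMono time
  unbounded : ∀ B : ℚ, ∃ i, B < time i

/-- At most `k` events occur in any open unit interval `(t, t + 1)` of the time domain. -/
def TimedWord.HasVariability {P : Type u} (ρ : TimedWord P) (k : ℕ) : Prop :=
  ∀ t : ℚ, 0 ≤ t → {i : ℕ | t < ρ.time i ∧ ρ.time i < t + 1}.encard ≤ k

/-! ### Metric temporal logic with generalised `Until` and `Since` -/

/-- Formulas with `Until`, `Since`, and the generalised `Until` and `Since` with superscript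
`c`, where `0 ≤ c ≤ inf I`. -/
inductive MTL (P : Type u) : Type u
  | tru : MTL P
  | atom (p : P) : MTL P
  | conj (φ₁ φ₂ : MTL P) : MTL P
  | neg (φ : MTL P) : MTL P
  | untl (I : TInterval) (φ₁ φ₂ : MTL P) : MTL P
  | snce (I : TInterval) (φ₁ φ₂ : MTL P) : MTL P
  | guntl (I : TInterval) (c : ℚ) (hc : 0 ≤ c) (hcI : c ≤ I.lo) (φ₁ φ₂ : MTL P) : MTL P
  | gsnce (I : TInterval) (c : ℚ) (hc : 0 ≤ c) (hcI : c ≤ I.lo) (φ₁ φ₂ : MTL P) : MTL P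

/-- The strong and the weak view on satisfaction over finite words. -/
inductive View
  | strong
  | weak

/-- The dual view. -/
def View.flip : View → View
  | .strong => .weak
  | .weak => .strong

namespace MTL

variable {P : Type u}

/-- All intervals occurring in the formula are bounded. -/
def Bounded : MTL P → Prop
  | tru => True
  | atom _ => True
  | conj φ₁ φ₂ => φ₁.Bounded ∧ φ₂.Bounded
  | neg φ => φ.Bounded
  | untl I φ₁ φ₂ => I.IsBounded ∧ φ₁.Bounded ∧ φ₂.Bounded
  | snce I φ₁ φ₂ => I.IsBounded ∧ φ₁.Bounded ∧ φ₂.Bounded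
  | guntl I _ _ _ φ₁ φ₂ => I.IsBounded ∧ φ₁.Bounded ∧ φ₂.Bounded
  | gsnce I _ _ _ φ₁ φ₂ => I.IsBounded ∧ φ₁.Bounded ∧ φ₂.Bounded

open Classical in
/-- The set of subformulas of a formula (including the formula itself). -/
noncomputable def subformulas : MTL P → Finset (MTL P)
  | tru => {tru}
  | atom p => {atom p}
  | conj φ₁ φ₂ => insert (conj φ₁ φ₂) (φ₁.subformulas ∪ φ₂.subformulas)
  | neg φ => insert (neg φ) φ.subformulas
  | untl I φ₁ φ₂ => insert (untl I φ₁ φ₂) (φ₁.subformulas ∪ φ₂.subformulas)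
  | snce I φ₁ φ₂ => insert (snce I φ₁ φ₂) (φ₁.subformulas ∪ φ₂.subformulas)
  | guntl I c h h' φ₁ φ₂ => insert (guntl I c h h' φ₁ φ₂) (φ₁.subformulas ∪ φ₂.subformulas)
  | gsnce I c h h' φ₁ φ₂ => insert (gsnce I c h h' φ₁ φ₂) (φ₁.subformulas ∪ φ₂.subformulas)

/-- `|φ|`: the number of subformulas. -/
noncomputable def size (φ : MTL P) : ℕ := φ.subformulas.card

/-- The sum of the constants attached to the outermost operator. -/
def topConst : MTL P → ℚ
  | tru => 0
  | atom _ => 0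
  | conj _ _ => 0
  | neg _ => 0
  | untl I _ _ => I.constSum
  | snce I _ _ => I.constSum
  | guntl I c _ _ _ _ => I.constSum + c
  | gsnce I c _ _ _ _ => I.constSum + c

/-- The sum of the (finite) constants in the formula, subformula by subformula. -/
noncomputable def cSum (φ : MTL P) : ℚ := ∑ χ ∈ φ.subformulas, χ.topConst

/-- Satisfaction `ρ, i ⊨ φ` over an infinite timed word. -/
def Sat (ρ : TimedWord P) : ℕ → MTL P → Prop
  | _, tru => True
  | i, atom p => p ∈ ρ.label i
  | i, conj φ₁ φ₂ => Sat ρ i φ₁ ∧ Sat ρ i φ₂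
  | i, neg φ => ¬ Sat ρ i φ
  | i, untl I φ₁ φ₂ => ∃ j, i < j ∧ Sat ρ j φ₂ ∧ I.Mem (ρ.time j - ρ.time i) ∧
      ∀ k, i < k → k < j → Sat ρ k φ₁
  | i, snce I φ₁ φ₂ => ∃ j, j < i ∧ Sat ρ j φ₂ ∧ I.Mem (ρ.time i - ρ.time j) ∧
      ∀ k, j < k → k < i → Sat ρ k φ₁
  | i, guntl I c _ _ φ₁ φ₂ => ∃ j, i < j ∧ Sat ρ j φ₂ ∧ I.Mem (ρ.time j - ρ.time i) ∧
      ∀ k, i < k → k < j → c < ρ.time k - ρ.time i → I.lo - c < ρ.time j - ρ.time k →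
        Sat ρ k φ₁
  | i, gsnce I c _ _ φ₁ φ₂ => ∃ j, j < i ∧ Sat ρ j φ₂ ∧ I.Mem (ρ.time i - ρ.time j) ∧
      ∀ k, j < k → k < i → c < ρ.time i - ρ.time k → I.lo - c < ρ.time k - ρ.time j →
        Sat ρ k φ₁

/-- Truncated satisfaction (strong or weak view) at position `i` of the finite timed word that
consists of the first `n` events of `ρ`. -/
def TSat (ρ : TimedWord P) (n : ℕ) : View → ℕ → MTL P → Prop
  | _, _, tru => True
  | _, i, atom p => p ∈ ρ.label i
  | v, i, conj φ₁ φ₂ => TSat ρ n v i φ₁ ∧ TSat ρ n v i φ₂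
  | v, i, neg φ => ¬ TSat ρ n v.flip i φ
  | v, i, untl I φ₁ φ₂ =>
      (∃ j, i < j ∧ j < n ∧ TSat ρ n v j φ₂ ∧ I.Mem (ρ.time j - ρ.time i) ∧
        ∀ k, i < k → k < j → TSat ρ n v k φ₁) ∨
      (v = .weak ∧ ((ρ.time (n - 1) - ρ.time i : ℚ) : WithTop ℚ) < I.hi ∧
        ∀ k, i < k → k < n → TSat ρ n v k φ₁)
  | v, i, snce I φ₁ φ₂ => ∃ j, j < i ∧ TSat ρ n v j φ₂ ∧ I.Mem (ρ.time i - ρ.time j) ∧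
      ∀ k, j < k → k < i → TSat ρ n v k φ₁
  | v, i, guntl I c _ _ φ₁ φ₂ =>
      (∃ j, i < j ∧ j < n ∧ TSat ρ n v j φ₂ ∧ I.Mem (ρ.time j - ρ.time i) ∧
        ∀ k, i < k → k < j → c < ρ.time k - ρ.time i → I.lo - c < ρ.time j - ρ.time k →
          TSat ρ n v k φ₁) ∨
      (v = .weak ∧ ((ρ.time (n - 1) - ρ.time i : ℚ) : WithTop ℚ) < I.hi ∧
        ∀ k, i < k → k < n → c < ρ.time k - ρ.time i →
          I.lo - c ≤ ρ.time (n - 1) - ρ.time k → TSat ρ n v k φ₁)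
  | v, i, gsnce I c _ _ φ₁ φ₂ => ∃ j, j < i ∧ TSat ρ n v j φ₂ ∧ I.Mem (ρ.time i - ρ.time j) ∧
      ∀ k, j < k → k < i → c < ρ.time i - ρ.time k → I.lo - c < ρ.time k - ρ.time j →
        TSat ρ n v k φ₁

/-- The first `n` events of `ρ` form an informative good prefix for `φ`. -/
def InformativeGood (ρ : TimedWord P) (n : ℕ) (φ : MTL P) : Prop :=
  0 < n ∧ TSat ρ n .strong 0 φ

/-- The first `n` events of `ρ` form an informative bad prefix for `φ`. -/
def InformativeBad (ρ : TimedWord P) (n : ℕ) (φ : MTL P) : Prop :=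
  0 < n ∧ ¬ TSat ρ n .weak 0 φ

end MTL

/-! ### Linear temporal logic with past -/

/-- Untimed formulas, with the strict `Until` and `Since`. -/
inductive LTL (α : Type) : Type
  | tru : LTL α
  | atom (q : α) : LTL α
  | conj (φ₁ φ₂ : LTL α) : LTL α
  | neg (φ : LTL α) : LTL α
  | untl (φ₁ φ₂ : LTL α) : LTL α
  | snce (φ₁ φ₂ : LTL α) : LTL α

namespace LTL

variable {α : Type}

/-- The propositions that occur in the formula. -/
def atoms : LTL α → Set α
  | tru => ∅
  | atom q => {q}
  | conj φ₁ φ₂ => φ₁.atoms ∪ φ₂.atoms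
  | neg φ => φ.atoms
  | untl φ₁ φ₂ => φ₁.atoms ∪ φ₂.atoms
  | snce φ₁ φ₂ => φ₁.atoms ∪ φ₂.atoms

open Classical in
/-- The set of subformulas of a formula (including the formula itself). -/
noncomputable def subformulas : LTL α → Finset (LTL α)
  | tru => {tru}
  | atom q => {atom q}
  | conj φ₁ φ₂ => insert (conj φ₁ φ₂) (φ₁.subformulas ∪ φ₂.subformulas)
  | neg φ => insert (neg φ) φ.subformulas
  | untl φ₁ φ₂ => insert (untl φ₁ φ₂) (φ₁.subformulas ∪ φ₂.subformulas)
  | snce φ₁ φ₂ => insert (snce φ₁ φ₂) (φ₁.subformulas ∪ φ₂.subformulas)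

/-- `|Φ|`: the number of subformulas. -/
noncomputable def size (φ : LTL α) : ℕ := φ.subformulas.card

/-- `Φ(ψ₁, …, ψₘ)`: the propositions are replaced by metric formulas, and the untimed operators
are read as the ones with interval `(0, ∞)`. -/
def subst {P : Type u} (ψ : α → MTL P) : LTL α → MTL P
  | tru => .tru
  | atom q => ψ q
  | conj φ₁ φ₂ => .conj (φ₁.subst ψ) (φ₂.subst ψ)
  | neg φ => .neg (φ.subst ψ)
  | untl φ₁ φ₂ => .untl .unbounded (φ₁.subst ψ) (φ₂.subst ψ)
  | snce φ₁ φ₂ => .snce .unbounded (φ₁.subst ψ) (φ₂.subst ψ)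

/-- Truncated satisfaction (strong or weak view) at position `i` of a finite word `w`. -/
def TSat (w : List (α → Bool)) : View → ℕ → LTL α → Prop
  | _, _, tru => True
  | _, i, atom q => ∃ a, w[i]? = some a ∧ a q = true
  | v, i, conj φ₁ φ₂ => TSat w v i φ₁ ∧ TSat w v i φ₂
  | v, i, neg φ => ¬ TSat w v.flip i φ
  | v, i, untl φ₁ φ₂ =>
      (∃ j, i < j ∧ j < w.length ∧ TSat w v j φ₂ ∧ ∀ k, i < k → k < j → TSat w v k φ₁) ∨
      (v = .weak ∧ ∀ k, i < k → k < w.length → TSat w v k φ₁)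
  | v, i, snce φ₁ φ₂ => ∃ j, j < i ∧ TSat w v j φ₂ ∧ ∀ k, j < k → k < i → TSat w v k φ₁

/-- `w` is a non-empty word that strongly satisfies `φ`. -/
def InformativeGood (w : List (α → Bool)) (φ : LTL α) : Prop :=
  w ≠ [] ∧ TSat w .strong 0 φ

/-- `w` is a non-empty word that does not weakly satisfy `φ`. -/
def InformativeBad (w : List (α → Bool)) (φ : LTL α) : Prop :=
  w ≠ [] ∧ ¬ TSat w .weak 0 φ

end LTL

/-! ### The online procedure

The procedure works on a two-dimensional array with a fixed number of columns; one row holds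
timestamps, the other rows hold truth values.  Besides the array it has pointers to columns, which
move cyclically.  Timestamps can only be stored and compared, so no information other than the
array and the pointers is carried from one event to the next.  The body of the procedure is run
once on every event of the trace. -/

/-- Tests that the procedure can make.  `timeLt x y q` asks whether the timestamp in the column of
pointer `x` minus the one in the column of pointer `y` is less than the constant `q`. -/
inductive Test (P : Type u) (rows ptrs : ℕ) : Type u
  | current (p : P)
  | cell (r : Fin rows) (x : Fin ptrs)
  | same (x y : Fin ptrs)
  | timeLt (x y : Fin ptrs) (q : ℚ)
  | timeLe (x y : Fin ptrs) (q : ℚ)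
  | no (t : Test P rows ptrs)
  | both (t₁ t₂ : Test P rows ptrs)

/-- Commands of the procedure. -/
inductive Cmd (P : Type u) (rows ptrs : ℕ) : Type u
  | skip
  | store (x : Fin ptrs)
  | write (r : Fin rows) (x : Fin ptrs) (b : Bool)
  | next (x : Fin ptrs)
  | prev (x : Fin ptrs)
  | copy (x y : Fin ptrs)
  | emit (x : Fin ptrs)
  | seq (c₁ c₂ : Cmd P rows ptrs)
  | cond (t : Test P rows ptrs) (c₁ c₂ : Cmd P rows ptrs)
  | loop (t : Test P rows ptrs) (c : Cmd P rows ptrs)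

/-- The contents of the timestamp row, of the truth value rows, and of the pointers. -/
structure Mem (cols rows ptrs : ℕ) where
  time : Fin cols → ℚ
  table : Fin rows → Fin cols → Bool
  ptr : Fin ptrs → Fin cols

/-- All timestamps `0`, all truth values false, all pointers at column `0`. -/
def Mem.init (cols rows ptrs : ℕ) [NeZero cols] : Mem cols rows ptrs where
  time := fun _ => 0
  table := fun _ _ => false
  ptr := fun _ => 0

namespace Test

variable {P : Type u} {cols rows ptrs : ℕ}

/-- The number of elementary tests and connectives: also the time to evaluate the test. -/
def size : Test P rows ptrs → ℕ
  | current _ => 1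
  | cell _ _ => 1
  | same _ _ => 1
  | timeLt _ _ _ => 1
  | timeLe _ _ _ => 1
  | no t => t.size + 1
  | both t₁ t₂ => t₁.size + t₂.size + 1

/-- The test succeeds, where `a` is the label of the current event. -/
def Holds (a : Set P) (s : Mem cols rows ptrs) : Test P rows ptrs → Prop
  | current p => p ∈ a
  | cell r x => s.table r (s.ptr x) = true
  | same x y => s.ptr x = s.ptr y
  | timeLt x y q => s.time (s.ptr x) - s.time (s.ptr y) < q
  | timeLe x y q => s.time (s.ptr x) - s.time (s.ptr y) ≤ q
  | no t => ¬ Holds a s t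
  | both t₁ t₂ => Holds a s t₁ ∧ Holds a s t₂

end Test

/-- The length of the program text. -/
def Cmd.size {P : Type u} {rows ptrs : ℕ} : Cmd P rows ptrs → ℕ
  | .skip => 1
  | .store _ => 1
  | .write _ _ _ => 1
  | .next _ => 1
  | .prev _ => 1
  | .copy _ _ => 1
  | .emit _ => 1
  | .seq c₁ c₂ => c₁.size + c₂.size + 1
  | .cond t c₁ c₂ => t.size + c₁.size + c₂.size + 1
  | .loop t c => t.size + c.size + 1

/-- The part of the monitor that evaluates the propositions `Q₁, …, Qₘ`.  The truth value of `Qᵢ`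
is taken from row `row i`. -/
structure Monitor (P : Type u) (m : ℕ) where
  cols : ℕ
  rows : ℕ
  ptrs : ℕ
  [cols_ne : NeZero cols]
  body : Cmd P rows ptrs
  row : Fin m → Fin rows

attribute [instance] Monitor.cols_ne

namespace Monitor

variable {P : Type u} {m : ℕ}

/-- The number of entries of the two-dimensional array: the truth value rows and the row of
timestamps. -/
def arraySize (M : Monitor P m) : ℕ := (M.rows + 1) * M.cols

/-- `M.Exec a τ c s t o s'`: on the current event with label `a` and timestamp `τ`, command `c`
takes memory `s` to memory `s'` in time `t`, emitting the letters `o`, each of which is read from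
one column and handed to the automata in one step. -/
inductive Exec (M : Monitor P m) (a : Set P) (τ : ℚ) :
    Cmd P M.rows M.ptrs → Mem M.cols M.rows M.ptrs → ℕ → List (Fin m → Bool) →
      Mem M.cols M.rows M.ptrs → Prop
  | skip (s) : Exec M a τ .skip s 1 [] s
  | store (s x) : Exec M a τ (.store x) s 1 []
      { s with time := Function.update s.time (s.ptr x) τ }
  | write (s r x b) : Exec M a τ (.write r x b) s 1 []
      { s with table := Function.update s.table r (Function.update (s.table r) (s.ptr x) b) }
  | next (s x) : Exec M a τ (.next x) s 1 []
      { s with ptr := Function.update s.ptr x (s.ptr x + 1) }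
  | prev (s x) : Exec M a τ (.prev x) s 1 []
      { s with ptr := Function.update s.ptr x (s.ptr x - 1) }
  | copy (s x y) : Exec M a τ (.copy x y) s 1 []
      { s with ptr := Function.update s.ptr x (s.ptr y) }
  | emit (s x) : Exec M a τ (.emit x) s 1 [fun i => s.table (M.row i) (s.ptr x)] s
  | seq {c₁ c₂ s s₁ s₂ t₁ t₂ o₁ o₂} (h₁ : Exec M a τ c₁ s t₁ o₁ s₁)
      (h₂ : Exec M a τ c₂ s₁ t₂ o₂ s₂) : Exec M a τ (.seq c₁ c₂) s (t₁ + t₂) (o₁ ++ o₂) s₂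
  | condTrue {b c₁ c₂ s s' t o} (hb : b.Holds a s) (h : Exec M a τ c₁ s t o s') :
      Exec M a τ (.cond b c₁ c₂) s (b.size + t) o s'
  | condFalse {b c₁ c₂ s s' t o} (hb : ¬ b.Holds a s) (h : Exec M a τ c₂ s t o s') :
      Exec M a τ (.cond b c₁ c₂) s (b.size + t) o s'
  | loopFalse {b c s} (hb : ¬ b.Holds a s) : Exec M a τ (.loop b c) s b.size [] s
  | loopTrue {b c s s₁ s₂ t₁ t₂ o₁ o₂} (hb : b.Holds a s) (h₁ : Exec M a τ c s t₁ o₁ s₁)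
      (h₂ : Exec M a τ (.loop b c) s₁ t₂ o₂ s₂) :
      Exec M a τ (.loop b c) s (b.size + t₁ + t₂) (o₁ ++ o₂) s₂

/-- The run of the monitor on an infinite trace: on each event the body terminates. -/
structure Run (M : Monitor P m) (ρ : TimedWord P) where
  mem : ℕ → Mem M.cols M.rows M.ptrs
  cost : ℕ → ℕ
  out : ℕ → List (Fin m → Bool)
  mem_zero : mem 0 = Mem.init M.cols M.rows M.ptrs
  step : ∀ n, M.Exec (ρ.label n) (ρ.time n) M.body (mem n) (cost n) (out n) (mem (n + 1))

variable {M : Monitor P m} {ρ : TimedWord P}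

/-- The word emitted while the first `n` events are processed. -/
def Run.word (r : M.Run ρ) (n : ℕ) : List (Fin m → Bool) := (List.range n).flatMap r.out

/-- The total time spent on the first `n` events. -/
def Run.totalCost (r : M.Run ρ) (n : ℕ) : ℕ := ∑ i ∈ Finset.range n, r.cost i

/-- At some moment of the run the token on the automaton `D` is on an accepting state. -/
def Run.Reaches {σ : Type} (r : M.Run ρ) (D : DFA (Fin m → Bool) σ) : Prop :=
  ∃ n w, w <+: r.word n ∧ D.eval w ∈ D.accept

end Monitor

/-!
The automata and the program are independent of each other, and a third argument, about truncated
satisfaction, connects them.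

*Automata.*  A nondeterministic automaton reads a finite word and guesses at each position which
subformulas of `Φ` hold there in the strong and in the weak view (`LTL.goodNFA`).  The truth values
of `Until` and `Since` at neighbouring positions are related by local laws, and at the last position
an `Until` holds exactly in the weak view; so the consistent guesses are the true ones
(`LTL.has_iff_tSat`).  The subset construction makes this automaton deterministic, with doubly
exponentially many states.  Informative bad prefixes of `Φ` are informative good ones of `¬Φ`.

*Program.* Let `H` be the sum of the constants; it bounds the horizon of every bounded subformula
(`MTL.horizon_le_cSum`).  The trace is cut into blocks of events: a new block starts with each event
that comes more than `H` after the start of the current block.  The array stores the last three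
blocks, which by bounded variability have `O(k (H + 1))` events.  When a new block is about to
start, all subformulas are evaluated from scratch on the stored window.  The values in its middle
block are correct, since this block is more than `H` away from both ends of the window (or preceded
by nothing); they are emitted, and the oldest block is dropped.  Each event takes part in at most
three evaluations besides the one that it triggers.  Hence the amortised time per event is linear in
the number of subformulas if each of them is evaluated on a window in linear time
(`Monitor.runs_temporal`).  This is possible because the four temporal operators have a common form
(`OpHolds`), up to the direction of time: the nearest position that satisfies the second argument
and respects the lower bound is the best witness, the nearest violation of the first argument is the
most harmful one, and both move monotonically with the position at which the formula is evaluated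
(`Monitor.runs_sweep`).

*Connection.* Strong truncated satisfaction implies satisfaction, which implies weak truncated
satisfaction, and for bounded formulas the three agree once the truncation is long enough.  By
induction on `Φ`, an informative prefix of the trace gives an informative prefix of the same length
of the word of exact truth values, and an informative prefix of this word gives a (possibly longer)
informative prefix of the trace (`LTL.exists_informativeGood_iff`).
-/

/-! ### Automata for informative prefixes of untimed formulas -/

namespace LTL

variable {α : Type}

theorem self_mem_subformulas (φ : LTL α) : φ ∈ φ.subformulas := by
  cases φ <;> simp [subformulas]

open Classical in
theorem subformulas_trans {φ χ : LTL α} (h : χ ∈ φ.subformulas) :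
    χ.subformulas ⊆ φ.subformulas := by
  induction φ with
  | tru | atom => simp only [subformulas, Finset.mem_singleton] at h; subst h; simp [subformulas]
  | neg φ ih =>
    simp only [subformulas, Finset.mem_insert] at h
    rcases h with rfl | h
    · exact subset_rfl
    · exact (ih h).trans (Finset.subset_insert _ _)
  | conj φ₁ φ₂ ih₁ ih₂ | untl φ₁ φ₂ ih₁ ih₂ | snce φ₁ φ₂ ih₁ ih₂ =>
    simp only [subformulas, Finset.mem_insert, Finset.mem_union] at h
    rcases h with rfl | h | h
    · exact subset_rfl
    · exact (ih₁ h).trans (Finset.subset_union_left.trans (Finset.subset_insert _ _))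
    · exact (ih₂ h).trans (Finset.subset_union_right.trans (Finset.subset_insert _ _))

theorem size_pos (φ : LTL α) : 0 < φ.size := Finset.card_pos.2 ⟨φ, self_mem_subformulas φ⟩

/-- The unfolding law of `Until` at a position of a finite word. -/
theorem tSat_untl_iff (w : List (α → Bool)) (v : View) (i : ℕ) (φ₁ φ₂ : LTL α) :
    TSat w v i (untl φ₁ φ₂) ↔ if i + 1 < w.length then
      TSat w v (i + 1) φ₂ ∨ (TSat w v (i + 1) φ₁ ∧ TSat w v (i + 1) (untl φ₁ φ₂))
      else v = .weak := by
  split_ifs with hi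
  · constructor
    · rintro (⟨j, hij, hj, h₂, h₁⟩ | ⟨hv, h₁⟩)
      · rcases (show i + 1 ≤ j from hij).eq_or_lt with rfl | hlt
        · exact Or.inl h₂
        · exact Or.inr ⟨h₁ _ (by omega) hlt, Or.inl ⟨j, hlt, hj, h₂, fun k hk => h₁ k (by omega)⟩⟩
      · exact Or.inr ⟨h₁ _ (by omega) hi, Or.inr ⟨hv, fun k hk => h₁ k (by omega)⟩⟩
    · rintro (h₂ | ⟨h, ⟨j, hij, hj, h₂, h₁⟩ | ⟨hv, h₁⟩⟩)
      · exact Or.inl ⟨i + 1, by omega, hi, h₂, fun k _ _ => by omega⟩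
      · refine Or.inl ⟨j, by omega, hj, h₂, fun k hk hkj => ?_⟩
        rcases (show i + 1 ≤ k from hk).eq_or_lt with rfl | hlt
        · exact h
        · exact h₁ k hlt hkj
      · refine Or.inr ⟨hv, fun k hk hkj => ?_⟩
        rcases (show i + 1 ≤ k from hk).eq_or_lt with rfl | hlt
        · exact h
        · exact h₁ k hlt hkj
  · constructor
    · rintro (⟨j, hij, hj, -⟩ | ⟨hv, -⟩)
      · omega
      · exact hv
    · exact fun hv => Or.inr ⟨hv, fun k _ _ => by omega⟩

theorem not_tSat_snce_zero (w : List (α → Bool)) (v : View) (φ₁ φ₂ : LTL α) :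
    ¬ TSat w v 0 (snce φ₁ φ₂) := by
  rintro ⟨j, hj, -⟩; omega

/-- The unfolding law of `Since`. -/
theorem tSat_snce_succ (w : List (α → Bool)) (v : View) (i : ℕ) (φ₁ φ₂ : LTL α) :
    TSat w v (i + 1) (snce φ₁ φ₂) ↔
      TSat w v i φ₂ ∨ (TSat w v i φ₁ ∧ TSat w v i (snce φ₁ φ₂)) := by
  constructor
  · rintro ⟨j, hj, h₂, h₁⟩
    rcases (show j ≤ i by omega).eq_or_lt with rfl | hlt
    · exact Or.inl h₂
    · exact Or.inr ⟨h₁ i hlt (by omega), j, hlt, h₂, fun k hk hki => h₁ k hk (by omega)⟩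
  · rintro (h₂ | ⟨h, j, hj, h₂, h₁⟩)
    · exact ⟨i, by omega, h₂, fun k _ _ => by omega⟩
    · refine ⟨j, by omega, h₂, fun k hk hki => ?_⟩
      rcases (show k ≤ i by omega).eq_or_lt with rfl | hlt
      · exact h
      · exact h₁ k hk hlt

/-- A type for `Φ`: a guess, for both views, of the subformulas of `Φ` that hold at a position. -/
abbrev Ty (Φ : LTL α) : Type := Set (View × {χ // χ ∈ Φ.subformulas})

/-- The subformula `χ` belongs to the type, in view `v`. -/
def Ty.Has {Φ : LTL α} (X : Ty Φ) (v : View) (χ : LTL α) : Prop :=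
  ∃ h : χ ∈ Φ.subformulas, (v, ⟨χ, h⟩) ∈ X

/-- What a type `X` at a position with letter `a` has to say about a formula, where `Y` is the type
at the preceding position (if there is one).  An `Until` is not constrained by the past. -/
def Ty.Local {Φ : LTL α} (Y : Option (Ty Φ)) (a : α → Bool) (X : Ty Φ) (v : View) : LTL α → Prop
  | tru => True
  | atom q => a q = true
  | conj φ₁ φ₂ => X.Has v φ₁ ∧ X.Has v φ₂
  | neg φ => ¬ X.Has v.flip φ
  | untl φ₁ φ₂ => X.Has v (untl φ₁ φ₂)
  | snce φ₁ φ₂ => ∃ Z ∈ Y, Z.Has v φ₂ ∨ (Z.Has v φ₁ ∧ Z.Has v (snce φ₁ φ₂))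

/-- The type `X` may follow `Y` at a position with letter `a`. -/
def Ty.Follows {Φ : LTL α} (Y : Option (Ty Φ)) (a : α → Bool) (X : Ty Φ) : Prop :=
  (∀ v, ∀ χ ∈ Φ.subformulas, X.Has v χ ↔ X.Local Y a v χ) ∧
  ∀ Z ∈ Y, ∀ v φ₁ φ₂, untl φ₁ φ₂ ∈ Φ.subformulas →
    (Z.Has v (untl φ₁ φ₂) ↔ X.Has v φ₂ ∨ (X.Has v φ₁ ∧ X.Has v (untl φ₁ φ₂)))

/-- The automaton that guesses the type of each position of the word.  The state `none` is the one
before the first letter. -/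
def goodNFA (Φ : LTL α) : NFA (α → Bool) (Option (Ty Φ)) where
  step Y a := {Z | ∃ X : Ty Φ, Z = some X ∧ X.Follows Y a ∧ (Y = none → X.Has .strong Φ)}
  start := {none}
  accept := {Z | ∃ X : Ty Φ, Z = some X ∧
    ∀ v φ₁ φ₂, untl φ₁ φ₂ ∈ Φ.subformulas → (X.Has v (untl φ₁ φ₂) ↔ v = .weak)}

/-- The type before position `i` of a sequence of types. -/
def Ty.before {Φ : LTL α} (X : ℕ → Ty Φ) : ℕ → Option (Ty Φ)
  | 0 => none
  | i + 1 => some (X i)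

/-- The runs of the automaton are the sequences of types in which each follows the one before. -/
theorem mem_eval_goodNFA (Φ : LTL α) (w : List (α → Bool)) (Z : Option (Ty Φ)) :
    Z ∈ (goodNFA Φ).eval w ↔ ∃ X : ℕ → Ty Φ, Z = Ty.before X w.length ∧
      (∀ i a, w[i]? = some a → (X i).Follows (Ty.before X i) a) ∧
      (w ≠ [] → (X 0).Has .strong Φ) := by
  induction w using List.reverseRecOn generalizing Z with
  | nil => simp [goodNFA, Ty.before]
  | append_singleton w a ih =>
    rw [NFA.eval_append_singleton, NFA.mem_stepSet]
    constructor
    · rintro ⟨Y, hY, X', rfl, hf, h0⟩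
      obtain ⟨X, rfl, hX, hX0⟩ := (ih Y).1 hY
      have hb : ∀ i ≤ w.length, Ty.before (Function.update X w.length X') i = Ty.before X i := by
        intro i hi
        cases i with
        | zero => rfl
        | succ i => simp [Ty.before, Function.update_of_ne (show i ≠ w.length by omega)]
      refine ⟨Function.update X w.length X', ?_, ?_, fun _ => ?_⟩
      · simp [Ty.before]
      · intro i b hib
        rcases lt_trichotomy i w.length with h | h | h
        · rw [List.getElem?_append_left h] at hib
          rw [hb i h.le, Function.update_of_ne h.ne]
          exact hX i b hib
        · subst h
          simp only [List.getElem?_concat_length, Option.some.injEq] at hib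
          subst hib
          rw [hb _ le_rfl, Function.update_self]
          exact hf
        · rw [List.getElem?_eq_none (by simp; omega)] at hib
          simp at hib
      · by_cases hw : w = []
        · subst hw
          exact h0 rfl
        · rw [Function.update_of_ne (fun h => hw (List.length_eq_zero_iff.1 h.symm))]
          exact hX0 hw
    · rintro ⟨X, rfl, hX, hX0⟩
      refine ⟨Ty.before X w.length, (ih _).2 ⟨X, rfl, fun i b hib => hX i b ?_, fun _ => hX0 (by simp)⟩,
        X w.length, by simp [Ty.before], hX _ _ (by simp), ?_⟩
      · rw [List.getElem?_append_left]
        · exact hib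
        · exact (List.getElem?_eq_some_iff.1 hib).1
      · intro h
        have : w.length = 0 := by
          rcases h' : w.length with _ | k
          · rfl
          · rw [h'] at h; simp [Ty.before] at h
        rw [this]
        exact hX0 (by simp)

/-- A consistent sequence of types records the truncated satisfaction of the subformulas. -/
theorem has_iff_tSat {Φ : LTL α} {w : List (α → Bool)} {X : ℕ → Ty Φ}
    (hX : ∀ i a, w[i]? = some a → (X i).Follows (Ty.before X i) a)
    (hlast : ∀ i, i + 1 = w.length → ∀ v φ₁ φ₂, untl φ₁ φ₂ ∈ Φ.subformulas →
      ((X i).Has v (untl φ₁ φ₂) ↔ v = .weak))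
    (χ : LTL α) (hχ : χ ∈ Φ.subformulas) (i : ℕ) (hi : i < w.length) (v : View) :
    (X i).Has v χ ↔ TSat w v i χ := by
  have hloc : ∀ i (hi : i < w.length) v, ∀ χ ∈ Φ.subformulas,
      ((X i).Has v χ ↔ (X i).Local (Ty.before X i) w[i] v χ) := fun i hi v χ hχ =>
    (hX i _ (List.getElem?_eq_getElem hi)).1 v χ hχ
  induction χ generalizing i v with
  | tru => rw [hloc i hi v _ hχ]; simp [Ty.Local, TSat]
  | atom q => rw [hloc i hi v _ hχ]; simp [Ty.Local, TSat, List.getElem?_eq_getElem hi]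
  | conj φ₁ φ₂ ih₁ ih₂ =>
    have hs := subformulas_trans hχ
    have h₁ := ih₁ (hs (by simp [subformulas, self_mem_subformulas])) i hi v
    have h₂ := ih₂ (hs (by simp [subformulas, self_mem_subformulas])) i hi v
    rw [hloc i hi v _ hχ, Ty.Local, TSat]
    exact and_congr h₁ h₂
  | neg φ ih =>
    have hs := subformulas_trans hχ
    have h := ih (hs (by simp [subformulas, self_mem_subformulas])) i hi v.flip
    rw [hloc i hi v _ hχ, Ty.Local, TSat]
    exact not_congr h
  | untl φ₁ φ₂ ih₁ ih₂ =>
    have hs := subformulas_trans hχ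
    replace ih₁ := ih₁ (hs (by simp [subformulas, self_mem_subformulas]))
    replace ih₂ := ih₂ (hs (by simp [subformulas, self_mem_subformulas]))
    obtain ⟨d, hd⟩ : ∃ d, i + 1 + d = w.length := ⟨_, Nat.add_sub_cancel' hi⟩
    induction d generalizing i with
    | zero => rw [hlast i hd v _ _ hχ, tSat_untl_iff, if_neg (by omega)]
    | succ d ihd =>
      have hi' : i + 1 < w.length := by omega
      have := (hX (i + 1) _ (List.getElem?_eq_getElem hi')).2 (X i) rfl v _ _ hχ
      have h₁ := ih₁ _ hi' v
      have h₂ := ih₂ _ hi' v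
      have h₃ := ihd (i + 1) hi' (by omega)
      rw [this, tSat_untl_iff, if_pos hi']
      exact or_congr h₂ (and_congr h₁ h₃)
  | snce φ₁ φ₂ ih₁ ih₂ =>
    have hs := subformulas_trans hχ
    replace ih₁ := ih₁ (hs (by simp [subformulas, self_mem_subformulas]))
    replace ih₂ := ih₂ (hs (by simp [subformulas, self_mem_subformulas]))
    induction i with
    | zero =>
      rw [hloc 0 hi v _ hχ]
      simp [Ty.Local, Ty.before, not_tSat_snce_zero]
    | succ i ihi =>
      rw [hloc _ hi v _ hχ, tSat_snce_succ]
      simp only [Ty.Local, Ty.before, Option.mem_some_iff, exists_eq_left']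
      have h₁ := ih₁ i (by omega) v
      have h₂ := ih₂ i (by omega) v
      have h₃ := ihi (by omega)
      exact or_congr h₂ (and_congr h₁ h₃)

theorem mem_accepts_goodNFA (Φ : LTL α) (w : List (α → Bool)) :
    w ∈ (goodNFA Φ).accepts ↔ InformativeGood w Φ := by
  rw [NFA.mem_accepts]
  constructor
  · rintro ⟨Z, ⟨X', rfl, hlast⟩, hZ⟩
    obtain ⟨X, hX', hX, h0⟩ := (mem_eval_goodNFA Φ w _).1 hZ
    have hw : w ≠ [] := by rintro rfl; simp [Ty.before] at hX'
    refine ⟨hw, (has_iff_tSat hX ?_ Φ (self_mem_subformulas Φ) 0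
      (List.length_pos_of_ne_nil hw) .strong).1 (h0 hw)⟩
    intro i hi
    rw [← hi, Ty.before, Option.some.injEq] at hX'
    rw [← hX']
    exact hlast
  · rintro ⟨hw, hsat⟩
    let X : ℕ → Ty Φ := fun i => {x | TSat w x.1 i x.2.1}
    have hX : ∀ i v, ∀ χ ∈ Φ.subformulas, ((X i).Has v χ ↔ TSat w v i χ) := fun i v χ h =>
      ⟨fun ⟨_, h⟩ => h, fun h' => ⟨h, h'⟩⟩
    obtain ⟨n, hn⟩ : ∃ n, w.length = n + 1 :=
      ⟨w.length - 1, (Nat.succ_pred_eq_of_pos (List.length_pos_of_ne_nil hw)).symm⟩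
    refine ⟨some (X n), ⟨X n, rfl, fun v φ₁ φ₂ h => ?_⟩, (mem_eval_goodNFA Φ w _).2
      ⟨X, by rw [hn]; rfl, fun i a hia => ⟨fun v χ hχ => ?_, fun Z hZ v φ₁ φ₂ h => ?_⟩,
        fun _ => (hX 0 _ Φ (self_mem_subformulas Φ)).2 hsat⟩⟩
    · rw [hX _ _ _ h, tSat_untl_iff, if_neg (by omega)]
    · have hs := subformulas_trans hχ
      rw [hX _ _ _ hχ]
      cases χ with
      | tru => simp [TSat, Ty.Local]
      | atom q => simp [TSat, Ty.Local, hia]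
      | conj φ₁ φ₂ =>
        rw [TSat, Ty.Local, hX _ _ _ (hs (by simp [subformulas, self_mem_subformulas])),
          hX _ _ _ (hs (by simp [subformulas, self_mem_subformulas]))]
      | neg φ => rw [TSat, Ty.Local, hX _ _ _ (hs (by simp [subformulas, self_mem_subformulas]))]
      | untl φ₁ φ₂ => rw [Ty.Local, hX _ _ _ hχ]
      | snce φ₁ φ₂ =>
        cases i with
        | zero => simp [Ty.Local, Ty.before, not_tSat_snce_zero]
        | succ i =>
          simp only [Ty.Local, Ty.before, Option.mem_some_iff, exists_eq_left']
          rw [tSat_snce_succ, hX _ _ _ hχ,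
            hX _ _ _ (hs (by simp [subformulas, self_mem_subformulas])),
            hX _ _ _ (hs (by simp [subformulas, self_mem_subformulas]))]
    · have hs := subformulas_trans h
      cases i with
      | zero => simp [Ty.before] at hZ
      | succ i =>
        simp only [Ty.before, Option.mem_some_iff] at hZ
        subst hZ
        rw [hX _ _ _ h, hX _ _ _ h, hX _ _ _ (hs (by simp [subformulas, self_mem_subformulas])),
            hX _ _ _ (hs (by simp [subformulas, self_mem_subformulas])), tSat_untl_iff,
            if_pos (List.getElem?_eq_some_iff.1 hia).1]

/-- The two views, as Boolean values. -/
def viewEquiv : View ≃ Bool where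
  toFun | .strong => true | .weak => false
  invFun | true => .strong | false => .weak
  left_inv v := by cases v <;> rfl
  right_inv b := by cases b <;> rfl

/-- There is a deterministic automaton of doubly exponential size for the informative good
prefixes: the subset construction applied to the automaton that guesses types. -/
theorem exists_goodDFA (Φ : LTL α) : ∃ (s : ℕ) (D : DFA (α → Bool) (Fin s)),
    s ≤ 2 ^ 2 ^ (3 * Φ.size) ∧ ∀ w, w ∈ D.accepts ↔ InformativeGood w Φ := by
  classical
  let _ : Fintype View := Fintype.ofEquiv Bool viewEquiv.symm
  let e := Fintype.equivFin (Set (Option (Ty Φ)))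
  refine ⟨_, DFA.reindex e (goodNFA Φ).toDFA, ?_, fun w => ?_⟩
  · have hV : Fintype.card View = 2 := by
      rw [Fintype.card_congr viewEquiv]; rfl
    have hN := Φ.size_pos
    have hc : Fintype.card {χ // χ ∈ Φ.subformulas} = Φ.size := by
      rw [Fintype.card_coe, size]
    rw [Fintype.card_set, Fintype.card_option, Fintype.card_set, Fintype.card_prod, hV, hc]
    refine Nat.pow_le_pow_right (by norm_num) ?_
    have h1 : 1 ≤ 2 ^ (2 * Φ.size) := Nat.one_le_two_pow
    calc 2 ^ (2 * Φ.size) + 1 ≤ 2 ^ (2 * Φ.size + 1) := by rw [pow_succ]; omega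
      _ ≤ _ := Nat.pow_le_pow_right (by norm_num) (by omega)
  · rw [DFA.accepts_reindex, NFA.toDFA_correct, mem_accepts_goodNFA]

/-- The informative bad prefixes of a formula are the informative good ones of its negation. -/
theorem exists_badDFA (Φ : LTL α) : ∃ (s : ℕ) (D : DFA (α → Bool) (Fin s)),
    s ≤ 2 ^ 2 ^ (6 * Φ.size) ∧ ∀ w, w ∈ D.accepts ↔ InformativeBad w Φ := by
  obtain ⟨s, D, hs, hD⟩ := exists_goodDFA (neg Φ)
  refine ⟨s, D, hs.trans ?_, fun w => (hD w).trans Iff.rfl⟩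
  refine Nat.pow_le_pow_right (by norm_num) (Nat.pow_le_pow_right (by norm_num) ?_)
  have h : (neg Φ).size ≤ Φ.size + 1 := by
    classical
    simp only [size, subformulas]
    exact Finset.card_insert_le _ _
  have := Φ.size_pos
  omega

end LTL

/-! ### Metric temporal logic: uniform operators, horizons, truncation -/

namespace TInterval

/-- The lower bound of the interval is respected. -/
def LoOk (I : TInterval) (x : ℚ) : Prop := if I.loClosed = true then I.lo ≤ x else I.lo < x

/-- The right endpoint, with junk value `0` if the interval is unbounded. -/
def hiQ (I : TInterval) : ℚ := I.hi.untopD 0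

/-- The upper bound of the (bounded) interval is respected. -/
def HiOk (I : TInterval) (x : ℚ) : Prop := if I.hiClosed = true then x ≤ I.hiQ else x < I.hiQ

variable {I : TInterval} {x y : ℚ}

theorem IsBounded.coe_hiQ (h : I.IsBounded) : (I.hiQ : WithTop ℚ) = I.hi := by
  unfold hiQ IsBounded at *
  cases hh : I.hi with
  | top => exact absurd hh h
  | coe a => simp

theorem IsBounded.mem_iff (h : I.IsBounded) : I.Mem x ↔ I.LoOk x ∧ I.HiOk x := by
  unfold Mem LoOk HiOk
  rw [← h.coe_hiQ]
  simp only [WithTop.coe_le_coe, WithTop.coe_lt_coe]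

theorem LoOk.pos (h : I.LoOk x) : 0 < x := by
  unfold LoOk at h
  split_ifs at h with hc
  · exact (I.pos_of_closed hc).trans_le h
  · exact I.lo_nonneg.trans_lt h

theorem LoOk.mono (h : I.LoOk x) (hxy : x ≤ y) : I.LoOk y := by
  unfold LoOk at *
  split_ifs at * <;> linarith

theorem HiOk.le (h : I.HiOk x) : x ≤ I.hiQ := by
  unfold HiOk at h
  split_ifs at h <;> linarith

theorem HiOk.mono (h : I.HiOk y) (hxy : x ≤ y) : I.HiOk x := by
  unfold HiOk at *
  split_ifs at * <;> linarith

theorem Mem.lt_hi (h : I.Mem x) (hyx : y < x) : (y : WithTop ℚ) < I.hi := by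
  have h2 := h.2
  split_ifs at h2
  · exact (WithTop.coe_lt_coe.2 hyx).trans_le h2
  · exact (WithTop.coe_lt_coe.2 hyx).trans h2

theorem hiQ_nonneg (I : TInterval) : 0 ≤ I.hiQ := by
  unfold hiQ
  cases hh : I.hi with
  | top => simp
  | coe a =>
    have h0 := I.lo_nonneg
    rcases I.nonempty with h | h
    · rw [hh, WithTop.coe_lt_coe] at h
      simp only [WithTop.untopD_coe]; linarith
    · rw [hh, WithTop.coe_eq_coe] at h
      simp only [WithTop.untopD_coe]; linarith [h.1]

theorem constSum_eq (I : TInterval) : I.constSum = I.lo + I.hiQ := rfl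

@[simp] theorem mem_unbounded : unbounded.Mem x ↔ 0 < x := by
  simp [Mem, unbounded]

end TInterval

/-- The time from position `i` to position `j`, counted forwards or backwards. -/
def TimedWord.dist {P : Type u} (ρ : TimedWord P) (fwd : Bool) (i j : ℕ) : ℚ :=
  if fwd = true then ρ.time j - ρ.time i else ρ.time i - ρ.time j

/-- The common form of the four temporal operators.  The witness `j` satisfies `B` and lies at an
admissible distance, and `A` holds at all positions at distance more than `c` from `i` and more than
`d` from `j`.  All positions range over `D`. -/
def OpHolds (δ : ℕ → ℕ → ℚ) (I : TInterval) (c d : ℚ) (D A B : ℕ → Prop) (i : ℕ) : Prop :=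
  ∃ j, D j ∧ B j ∧ I.LoOk (δ i j) ∧ I.HiOk (δ i j) ∧
    ∀ k, D k → c < δ i k → d < δ k j → A k

namespace MTL

variable {P : Type u}

section
variable (ρ : TimedWord P) (i : ℕ) {I : TInterval} (hI : I.IsBounded) (φ₁ φ₂ : MTL P)
include hI

-- Positions at distance more than `c ≥ 0` from `i` and more than `d ≥ 0` from the witness lie
-- between the two, and a distance in `I` is positive; so the order of the positions need not be
-- mentioned.
theorem sat_guntl_iff {c : ℚ} (hc : 0 ≤ c) (hcI : c ≤ I.lo) :
    Sat ρ i (guntl I c hc hcI φ₁ φ₂) ↔ OpHolds (ρ.dist true) I c (I.lo - c) (fun _ => True)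
      (fun k => Sat ρ k φ₁) (fun k => Sat ρ k φ₂) i := by
  simp only [Sat, OpHolds, TimedWord.dist, if_true, hI.mem_iff]
  constructor
  · rintro ⟨j, hij, h₂, ⟨hlo, hhi⟩, h₁⟩
    refine ⟨j, trivial, h₂, hlo, hhi, fun k _ hk hkj => h₁ k ?_ ?_ hk hkj⟩
    · exact ρ.strictMono.lt_iff_lt.1 (by linarith)
    · exact ρ.strictMono.lt_iff_lt.1 (by linarith)
  · rintro ⟨j, -, h₂, hlo, hhi, h₁⟩
    exact ⟨j, ρ.strictMono.lt_iff_lt.1 (by linarith [hlo.pos]), h₂, ⟨hlo, hhi⟩,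
      fun k _ _ hk hkj => h₁ k trivial hk hkj⟩

theorem sat_gsnce_iff {c : ℚ} (hc : 0 ≤ c) (hcI : c ≤ I.lo) :
    Sat ρ i (gsnce I c hc hcI φ₁ φ₂) ↔ OpHolds (ρ.dist false) I c (I.lo - c) (fun _ => True)
      (fun k => Sat ρ k φ₁) (fun k => Sat ρ k φ₂) i := by
  simp only [Sat, OpHolds, TimedWord.dist, Bool.false_eq_true, if_false, hI.mem_iff]
  constructor
  · rintro ⟨j, hij, h₂, ⟨hlo, hhi⟩, h₁⟩
    refine ⟨j, trivial, h₂, hlo, hhi, fun k _ hk hkj => h₁ k ?_ ?_ hk hkj⟩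
    · exact ρ.strictMono.lt_iff_lt.1 (by linarith)
    · exact ρ.strictMono.lt_iff_lt.1 (by linarith)
  · rintro ⟨j, -, h₂, hlo, hhi, h₁⟩
    exact ⟨j, ρ.strictMono.lt_iff_lt.1 (by linarith [hlo.pos]), h₂, ⟨hlo, hhi⟩,
      fun k _ _ hk hkj => h₁ k trivial hk hkj⟩

theorem sat_untl_iff :
    Sat ρ i (untl I φ₁ φ₂) ↔ OpHolds (ρ.dist true) I 0 0 (fun _ => True)
      (fun k => Sat ρ k φ₁) (fun k => Sat ρ k φ₂) i := by
  simp only [Sat, OpHolds, TimedWord.dist, if_true, hI.mem_iff]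
  constructor
  · rintro ⟨j, hij, h₂, ⟨hlo, hhi⟩, h₁⟩
    refine ⟨j, trivial, h₂, hlo, hhi, fun k _ hk hkj => h₁ k ?_ ?_⟩
    · exact ρ.strictMono.lt_iff_lt.1 (by linarith)
    · exact ρ.strictMono.lt_iff_lt.1 (by linarith)
  · rintro ⟨j, -, h₂, hlo, hhi, h₁⟩
    exact ⟨j, ρ.strictMono.lt_iff_lt.1 (by linarith [hlo.pos]), h₂, ⟨hlo, hhi⟩,
      fun k hk hkj => h₁ k trivial (sub_pos.2 (ρ.strictMono hk)) (sub_pos.2 (ρ.strictMono hkj))⟩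

theorem sat_snce_iff :
    Sat ρ i (snce I φ₁ φ₂) ↔ OpHolds (ρ.dist false) I 0 0 (fun _ => True)
      (fun k => Sat ρ k φ₁) (fun k => Sat ρ k φ₂) i := by
  simp only [Sat, OpHolds, TimedWord.dist, Bool.false_eq_true, if_false, hI.mem_iff]
  constructor
  · rintro ⟨j, hij, h₂, ⟨hlo, hhi⟩, h₁⟩
    refine ⟨j, trivial, h₂, hlo, hhi, fun k _ hk hkj => h₁ k ?_ ?_⟩
    · exact ρ.strictMono.lt_iff_lt.1 (by linarith)
    · exact ρ.strictMono.lt_iff_lt.1 (by linarith)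
  · rintro ⟨j, -, h₂, hlo, hhi, h₁⟩
    exact ⟨j, ρ.strictMono.lt_iff_lt.1 (by linarith [hlo.pos]), h₂, ⟨hlo, hhi⟩,
      fun k hk hkj => h₁ k trivial (sub_pos.2 (ρ.strictMono hkj)) (sub_pos.2 (ρ.strictMono hk))⟩

end

/-- The horizon of a formula: its truth value at a position depends only on the events within this
distance (in the past and in the future). -/
def horizon : MTL P → ℚ
  | tru => 0
  | atom _ => 0
  | conj φ₁ φ₂ => max φ₁.horizon φ₂.horizon
  | neg φ => φ.horizon
  | untl I φ₁ φ₂ => I.hiQ + max φ₁.horizon φ₂.horizon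
  | snce I φ₁ φ₂ => I.hiQ + max φ₁.horizon φ₂.horizon
  | guntl I _ _ _ φ₁ φ₂ => I.hiQ + max φ₁.horizon φ₂.horizon
  | gsnce I _ _ _ φ₁ φ₂ => I.hiQ + max φ₁.horizon φ₂.horizon

theorem horizon_nonneg (φ : MTL P) : 0 ≤ φ.horizon := by
  induction φ with
  | tru | atom => exact le_rfl
  | conj φ₁ φ₂ ih₁ ih₂ => exact le_max_of_le_left ih₁
  | neg φ ih => exact ih
  | untl I φ₁ φ₂ ih₁ ih₂ | snce I φ₁ φ₂ ih₁ ih₂ | guntl I c h h' φ₁ φ₂ ih₁ ih₂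
  | gsnce I c h h' φ₁ φ₂ ih₁ ih₂ => exact add_nonneg I.hiQ_nonneg (le_max_of_le_left ih₁)

theorem self_mem_subformulas (φ : MTL P) : φ ∈ φ.subformulas := by
  cases φ <;> simp [subformulas]

theorem size_pos (φ : MTL P) : 0 < φ.size := Finset.card_pos.2 ⟨φ, self_mem_subformulas φ⟩

open Classical in
theorem subformulas_trans {φ χ : MTL P} (h : χ ∈ φ.subformulas) :
    χ.subformulas ⊆ φ.subformulas := by
  induction φ with
  | tru | atom => simp only [subformulas, Finset.mem_singleton] at h; subst h; simp [subformulas]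
  | neg φ ih =>
    simp only [subformulas, Finset.mem_insert] at h
    rcases h with rfl | h
    · exact subset_rfl
    · exact (ih h).trans (Finset.subset_insert _ _)
  | conj φ₁ φ₂ ih₁ ih₂ | untl _ φ₁ φ₂ ih₁ ih₂ | snce _ φ₁ φ₂ ih₁ ih₂
  | guntl _ _ _ _ φ₁ φ₂ ih₁ ih₂ | gsnce _ _ _ _ φ₁ φ₂ ih₁ ih₂ =>
    simp only [subformulas, Finset.mem_insert, Finset.mem_union] at h
    rcases h with rfl | h | h
    · exact subset_rfl
    · exact (ih₁ h).trans (Finset.subset_union_left.trans (Finset.subset_insert _ _))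
    · exact (ih₂ h).trans (Finset.subset_union_right.trans (Finset.subset_insert _ _))

/-- The nesting depth of a formula. -/
def depth : MTL P → ℕ
  | tru => 0
  | atom _ => 0
  | conj φ₁ φ₂ => max φ₁.depth φ₂.depth + 1
  | neg φ => φ.depth + 1
  | untl _ φ₁ φ₂ => max φ₁.depth φ₂.depth + 1
  | snce _ φ₁ φ₂ => max φ₁.depth φ₂.depth + 1
  | guntl _ _ _ _ φ₁ φ₂ => max φ₁.depth φ₂.depth + 1
  | gsnce _ _ _ _ φ₁ φ₂ => max φ₁.depth φ₂.depth + 1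

theorem depth_le_of_mem_subformulas {φ χ : MTL P} (h : χ ∈ φ.subformulas) :
    χ.depth ≤ φ.depth := by
  induction φ with
  | tru | atom => simp only [subformulas, Finset.mem_singleton] at h; subst h; simp
  | neg φ ih =>
    simp only [subformulas, Finset.mem_insert] at h
    rcases h with rfl | h
    · exact le_rfl
    · exact (ih h).trans (Nat.le_succ _)
  | conj φ₁ φ₂ ih₁ ih₂ | untl _ φ₁ φ₂ ih₁ ih₂ | snce _ φ₁ φ₂ ih₁ ih₂
  | guntl _ _ _ _ φ₁ φ₂ ih₁ ih₂ | gsnce _ _ _ _ φ₁ φ₂ ih₁ ih₂ =>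
    simp only [subformulas, Finset.mem_insert, Finset.mem_union] at h
    simp only [depth]
    rcases h with rfl | h | h
    · exact le_rfl
    · have := ih₁ h; omega
    · have := ih₂ h; omega

theorem topConst_nonneg (φ : MTL P) : 0 ≤ φ.topConst := by
  cases φ with
  | tru | atom | conj | neg => exact le_rfl
  | untl I | snce I => exact add_nonneg I.lo_nonneg I.hiQ_nonneg
  | guntl I c hc | gsnce I c hc =>
    exact add_nonneg (add_nonneg I.lo_nonneg I.hiQ_nonneg) hc

theorem cSum_mono {φ χ : MTL P} (h : χ ∈ φ.subformulas) : χ.cSum ≤ φ.cSum :=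
  Finset.sum_le_sum_of_subset_of_nonneg (subformulas_trans h) fun _ _ _ => topConst_nonneg _

theorem cSum_nonneg (φ : MTL P) : 0 ≤ φ.cSum := Finset.sum_nonneg fun _ _ => topConst_nonneg _

open Classical in
/-- A formula is not among the subformulas of its arguments, so its constants are counted in
addition to theirs. -/
theorem add_max_cSum_le {φ φ₁ φ₂ : MTL P}
    (hs : φ.subformulas = insert φ (φ₁.subformulas ∪ φ₂.subformulas))
    (hd : φ.depth = max φ₁.depth φ₂.depth + 1) :
    φ.topConst + max φ₁.cSum φ₂.cSum ≤ φ.cSum := by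
  have hn : φ ∉ φ₁.subformulas ∪ φ₂.subformulas := by
    intro h
    rcases Finset.mem_union.1 h with h | h
    · have := depth_le_of_mem_subformulas h; omega
    · have := depth_le_of_mem_subformulas h; omega
  rw [show φ.cSum = ∑ χ ∈ φ.subformulas, χ.topConst from rfl, hs, Finset.sum_insert hn]
  refine add_le_add_right (max_le ?_ ?_) _
  · exact Finset.sum_le_sum_of_subset_of_nonneg Finset.subset_union_left
      fun _ _ _ => topConst_nonneg _
  · exact Finset.sum_le_sum_of_subset_of_nonneg Finset.subset_union_right
      fun _ _ _ => topConst_nonneg _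

theorem horizon_le_cSum (φ : MTL P) : φ.horizon ≤ φ.cSum := by
  induction φ with
  | tru | atom => exact cSum_nonneg _
  | neg φ ih => exact ih.trans (cSum_mono (by simp [subformulas, self_mem_subformulas]))
  | conj φ₁ φ₂ ih₁ ih₂ =>
    exact max_le (ih₁.trans (cSum_mono (by simp [subformulas, self_mem_subformulas])))
      (ih₂.trans (cSum_mono (by simp [subformulas, self_mem_subformulas])))
  | untl I φ₁ φ₂ ih₁ ih₂ | snce I φ₁ φ₂ ih₁ ih₂ | guntl I c h h' φ₁ φ₂ ih₁ ih₂
  | gsnce I c h h' φ₁ φ₂ ih₁ ih₂ =>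
    refine le_trans ?_ (add_max_cSum_le rfl rfl)
    refine add_le_add ?_ (max_le_max ih₁ ih₂)
    simp only [topConst, TInterval.constSum_eq]
    linarith [I.lo_nonneg]

end MTL

/-- The position `x` has distance at least `h` from both ends of the window `[b, n]`; the start of
the trace does not count as an end. -/
def TimedWord.Margin {P : Type u} (ρ : TimedWord P) (b n : ℕ) (h : ℚ) (x : ℕ) : Prop :=
  (b = 0 ∨ ρ.time b + h ≤ ρ.time x) ∧ ρ.time x + h ≤ ρ.time n

namespace TimedWord

variable {P : Type u} {ρ : TimedWord P} {b n : ℕ} {h h' : ℚ} {x : ℕ}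

theorem Margin.mono (hx : ρ.Margin b n h x) (hh : h' ≤ h) : ρ.Margin b n h' x :=
  ⟨hx.1.imp id fun _ => by linarith, by linarith [hx.2]⟩

/-- A position at distance at most `r` from `i` has a margin that is smaller by at most `r`. -/
theorem Margin.of_dist {fwd : Bool} {i : ℕ} {r : ℚ} (hbi : b ≤ i) (hin : i ≤ n)
    (hi : ρ.Margin b n (r + h) i) (hh : 0 ≤ h) (h0 : 0 < ρ.dist fwd i x) (h1 : ρ.dist fwd i x ≤ r) :
    (b ≤ x ∧ x ≤ n) ∧ ρ.Margin b n h x := by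
  cases fwd with
  | true =>
    simp only [dist, if_true] at h0 h1
    have hix : i < x := ρ.strictMono.lt_iff_lt.1 (by linarith)
    refine ⟨⟨hbi.trans hix.le, ρ.strictMono.le_iff_le.1 (by linarith [hi.2])⟩, hi.1.imp id ?_, ?_⟩
    · intro _; linarith
    · linarith [hi.2]
  | false =>
    simp only [dist, Bool.false_eq_true, if_false] at h0 h1
    have hix : x < i := ρ.strictMono.lt_iff_lt.1 (by linarith)
    refine ⟨⟨?_, hix.le.trans hin⟩, hi.1.imp id ?_, ?_⟩
    · rcases hi.1 with rfl | hb
      · exact Nat.zero_le _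
      · exact ρ.strictMono.le_iff_le.1 (by linarith)
    · intro _; linarith
    · linarith [hi.2]

/-- Well inside a window, a bounded operator can be evaluated within the window, from values of its
arguments that need to be right only inside the window. -/
theorem opHolds_window_iff {fwd : Bool} {I : TInterval} {c d : ℚ}
    (hc : 0 ≤ c) (hd : 0 ≤ d) {A A' B B' : ℕ → Prop} (hh : 0 ≤ h)
    (hA : ∀ x, b ≤ x → x ≤ n → ρ.Margin b n h x → (A' x ↔ A x))
    (hB : ∀ x, b ≤ x → x ≤ n → ρ.Margin b n h x → (B' x ↔ B x))
    {i : ℕ} (hbi : b ≤ i) (hin : i ≤ n) (hi : ρ.Margin b n (I.hiQ + h) i) :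
    OpHolds (ρ.dist fwd) I c d (fun x => b ≤ x ∧ x ≤ n) A' B' i ↔
      OpHolds (ρ.dist fwd) I c d (fun _ => True) A B i := by
  have hadd : ∀ k j, ρ.dist fwd i j = ρ.dist fwd i k + ρ.dist fwd k j := by
    intro k j; cases fwd <;> simp [dist]
  have key : ∀ x, 0 < ρ.dist fwd i x → ρ.dist fwd i x ≤ I.hiQ →
      (b ≤ x ∧ x ≤ n) ∧ ρ.Margin b n h x := fun x h0 h1 => Margin.of_dist hbi hin hi hh h0 h1
  constructor
  · rintro ⟨j, hj, hBj, hlo, hhi, hk⟩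
    obtain ⟨hj', hm⟩ := key j hlo.pos hhi.le
    refine ⟨j, trivial, (hB j hj'.1 hj'.2 hm).1 hBj, hlo, hhi, fun k _ h1 h2 => ?_⟩
    obtain ⟨hk', hm⟩ := key k (by linarith) (by linarith [hadd k j, hhi.le])
    exact (hA k hk'.1 hk'.2 hm).1 (hk k hk' h1 h2)
  · rintro ⟨j, hj, hBj, hlo, hhi, hk⟩
    obtain ⟨hj', hm⟩ := key j hlo.pos hhi.le
    refine ⟨j, hj', (hB j hj'.1 hj'.2 hm).2 hBj, hlo, hhi, fun k hkD h1 h2 => ?_⟩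
    obtain ⟨hk', hm⟩ := key k (by linarith) (by linarith [hadd k j, hhi.le])
    exact (hA k hk'.1 hk'.2 hm).2 (hk k trivial h1 h2)

/-- Bounded variability bounds the number of positions in a time interval of length `l / 2`. -/
theorem HasVariability.sub_le {k : ℕ} (hρ : ρ.HasVariability k) {p q l : ℕ}
    (hpq : ρ.time q ≤ ρ.time p + l / 2) : q - p ≤ k * l := by
  have h0 : 0 ≤ ρ.time p := by
    rw [← ρ.time_zero]; exact ρ.strictMono.monotone (Nat.zero_le p)
  have key : ∀ l : ℕ, {i : ℕ | ρ.time p < ρ.time i ∧ ρ.time i ≤ ρ.time p + l / 2}.encard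
      ≤ (k * l : ℕ) := by
    intro l
    induction l with
    | zero =>
      rw [Set.encard_eq_zero.2]
      · simp
      · ext i
        simp only [Nat.cast_zero, zero_div, add_zero, Set.mem_ofPred_eq, Set.mem_empty_iff_false,
          iff_false, not_and, not_le, imp_self]
    | succ l ih =>
      refine le_trans (Set.encard_le_encard (t := _ ∪ _) ?_)
        ((Set.encard_union_le _ _).trans (add_le_add ih (hρ (ρ.time p + l / 2) ?_))) |>.trans ?_
      · intro i hi
        simp only [Set.mem_ofPred_eq, Nat.cast_add, Nat.cast_one, Set.mem_union] at hi ⊢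
        by_cases h : ρ.time i ≤ ρ.time p + l / 2
        · exact Or.inl ⟨hi.1, h⟩
        · exact Or.inr ⟨not_le.1 h, by linarith [hi.2]⟩
      · positivity
      · rw [mul_add, mul_one]; push_cast; rfl
  have hsub : ((Finset.Ioc p q : Finset ℕ) : Set ℕ) ⊆
      {i : ℕ | ρ.time p < ρ.time i ∧ ρ.time i ≤ ρ.time p + l / 2} := by
    intro i hi
    simp only [Finset.coe_Ioc, Set.mem_Ioc] at hi
    exact ⟨ρ.strictMono hi.1, (ρ.strictMono.monotone hi.2).trans hpq⟩
  have := (Set.encard_le_encard hsub).trans (key l)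
  rw [Set.encard_coe_eq_coe_finsetCard, Nat.card_Ioc] at this
  exact_mod_cast this

end TimedWord

namespace MTL

variable {P : Type u} {ρ : TimedWord P}

/-- Strong truncated satisfaction implies satisfaction, which implies weak truncated
satisfaction. -/
theorem tSat_strong_imp_sat_imp_weak {n : ℕ} (χ : MTL P) {i : ℕ} (hi : i < n) :
    (TSat ρ n .strong i χ → Sat ρ i χ) ∧ (Sat ρ i χ → TSat ρ n .weak i χ) := by
  induction χ generalizing i with
  | tru | atom => exact ⟨id, id⟩
  | conj φ₁ φ₂ ih₁ ih₂ =>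
    exact ⟨fun h => ⟨(ih₁ hi).1 h.1, (ih₂ hi).1 h.2⟩, fun h => ⟨(ih₁ hi).2 h.1, (ih₂ hi).2 h.2⟩⟩
  | neg φ ih => exact ⟨fun h h' => h ((ih hi).2 h'), fun h h' => h ((ih hi).1 h')⟩
  | untl I φ₁ φ₂ ih₁ ih₂ =>
    constructor
    · rintro (⟨j, hij, hj, h₂, hI, h₁⟩ | ⟨h, -⟩)
      · exact ⟨j, hij, (ih₂ hj).1 h₂, hI, fun k hk hkj => (ih₁ (hkj.trans hj)).1 (h₁ k hk hkj)⟩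
      · cases h
    · rintro ⟨j, hij, h₂, hI, h₁⟩
      by_cases hj : j < n
      · exact Or.inl ⟨j, hij, hj, (ih₂ hj).2 h₂, hI, fun k hk hkj =>
          (ih₁ (hkj.trans hj)).2 (h₁ k hk hkj)⟩
      · have := ρ.strictMono (show n - 1 < j by omega)
        exact Or.inr ⟨rfl, hI.lt_hi (by linarith), fun k hk hkn => (ih₁ hkn).2 (h₁ k hk (by omega))⟩
  | snce I φ₁ φ₂ ih₁ ih₂ =>
    constructor
    · rintro ⟨j, hij, h₂, hI, h₁⟩
      exact ⟨j, hij, (ih₂ (hij.trans hi)).1 h₂, hI, fun k hk hki =>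
        (ih₁ (hki.trans hi)).1 (h₁ k hk hki)⟩
    · rintro ⟨j, hij, h₂, hI, h₁⟩
      exact ⟨j, hij, (ih₂ (hij.trans hi)).2 h₂, hI, fun k hk hki =>
        (ih₁ (hki.trans hi)).2 (h₁ k hk hki)⟩
  | guntl I c hc hcI φ₁ φ₂ ih₁ ih₂ =>
    constructor
    · rintro (⟨j, hij, hj, h₂, hI, h₁⟩ | ⟨h, -⟩)
      · exact ⟨j, hij, (ih₂ hj).1 h₂, hI, fun k hk hkj ha hb =>
          (ih₁ (hkj.trans hj)).1 (h₁ k hk hkj ha hb)⟩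
      · cases h
    · rintro ⟨j, hij, h₂, hI, h₁⟩
      by_cases hj : j < n
      · exact Or.inl ⟨j, hij, hj, (ih₂ hj).2 h₂, hI, fun k hk hkj ha hb =>
          (ih₁ (hkj.trans hj)).2 (h₁ k hk hkj ha hb)⟩
      · have := ρ.strictMono (show n - 1 < j by omega)
        exact Or.inr ⟨rfl, hI.lt_hi (by linarith), fun k hk hkn ha hb =>
          (ih₁ hkn).2 (h₁ k hk (by omega) ha (by linarith))⟩
  | gsnce I c hc hcI φ₁ φ₂ ih₁ ih₂ =>
    constructor
    · rintro ⟨j, hij, h₂, hI, h₁⟩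
      exact ⟨j, hij, (ih₂ (hij.trans hi)).1 h₂, hI, fun k hk hki ha hb =>
        (ih₁ (hki.trans hi)).1 (h₁ k hk hki ha hb)⟩
    · rintro ⟨j, hij, h₂, hI, h₁⟩
      exact ⟨j, hij, (ih₂ (hij.trans hi)).2 h₂, hI, fun k hk hki ha hb =>
        (ih₁ (hki.trans hi)).2 (h₁ k hk hki ha hb)⟩

/-- If the last event of the finite word is beyond the horizon, then truncation does not matter. -/
theorem tSat_iff_sat {n : ℕ} (hn : 0 < n) (χ : MTL P) (hχ : χ.Bounded) {i : ℕ}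
    (hi : ρ.time i + χ.horizon ≤ ρ.time (n - 1)) (v : View) : TSat ρ n v i χ ↔ Sat ρ i χ := by
  induction χ generalizing i v with
  | tru | atom => exact Iff.rfl
  | conj φ₁ φ₂ ih₁ ih₂ =>
    simp only [horizon] at hi
    exact and_congr (ih₁ hχ.1 (by linarith [le_max_left φ₁.horizon φ₂.horizon]) v)
      (ih₂ hχ.2 (by linarith [le_max_right φ₁.horizon φ₂.horizon]) v)
  | neg φ ih => exact not_congr (ih hχ hi v.flip)
  | untl I φ₁ φ₂ ih₁ ih₂ | guntl I c hc hcI φ₁ φ₂ ih₁ ih₂ =>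
    obtain ⟨hI, hφ₁, hφ₂⟩ := hχ
    simp only [horizon] at hi
    have hm₁ := le_max_left φ₁.horizon φ₂.horizon
    have hm₂ := le_max_right φ₁.horizon φ₂.horizon
    have h₀ := φ₂.horizon_nonneg
    have hle : ∀ {x}, I.Mem x → x ≤ I.hiQ := fun h => (hI.mem_iff.1 h).2.le
    have hnot : ¬ ((ρ.time (n - 1) - ρ.time i : ℚ) : WithTop ℚ) < I.hi := by
      rw [← hI.coe_hiQ, WithTop.coe_lt_coe]; linarith
    simp only [TSat, Sat, hnot, false_and, and_false, or_false]
    refine exists_congr fun j => and_congr_right fun hij => ?_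
    constructor
    · rintro ⟨hj, h₂, hm, h₁⟩
      have := hle hm
      refine ⟨(ih₂ hφ₂ (by linarith) v).1 h₂, hm, fun k hk hkj => ?_⟩
      have := ρ.strictMono hkj
      have e := ih₁ hφ₁ (i := k) (by linarith) v
      first
        | exact e.1 (h₁ k hk hkj)
        | exact fun ha hb => e.1 (h₁ k hk hkj ha hb)
    · rintro ⟨h₂, hm, h₁⟩
      have := hle hm
      have hj : j ≤ n - 1 := ρ.strictMono.le_iff_le.1 (by linarith)
      refine ⟨by omega, (ih₂ hφ₂ (by linarith) v).2 h₂, hm, fun k hk hkj => ?_⟩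
      have := ρ.strictMono hkj
      have e := ih₁ hφ₁ (i := k) (by linarith) v
      first
        | exact e.2 (h₁ k hk hkj)
        | exact fun ha hb => e.2 (h₁ k hk hkj ha hb)
  | snce I φ₁ φ₂ ih₁ ih₂ | gsnce I c hc hcI φ₁ φ₂ ih₁ ih₂ =>
    obtain ⟨hI, hφ₁, hφ₂⟩ := hχ
    simp only [horizon] at hi
    have hm₁ := le_max_left φ₁.horizon φ₂.horizon
    have hm₂ := le_max_right φ₁.horizon φ₂.horizon
    have h₀ := I.hiQ_nonneg
    simp only [TSat, Sat]
    refine exists_congr fun j => and_congr_right fun hij => ?_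
    have := ρ.strictMono hij
    refine and_congr (ih₂ hφ₂ (by linarith) v) (and_congr_right fun _ => forall_congr' fun k =>
      forall_congr' fun _ => forall_congr' fun hki => ?_)
    have := ρ.strictMono hki
    have e := ih₁ hφ₁ (i := k) (by linarith) v
    first
      | exact e
      | exact forall_congr' fun _ => forall_congr' fun _ => e

end MTL

namespace LTL

variable {P : Type u} {α : Type} {ρ : TimedWord P} {ψ : α → MTL P} {w : List (α → Bool)}

/-- The letters of `w` give the truth values of the metric formulas at the first positions. -/
def Records (ρ : TimedWord P) (ψ : α → MTL P) (Q : Set α) (w : List (α → Bool)) : Prop :=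
  ∀ j a, w[j]? = some a → ∀ q ∈ Q, (a q = true ↔ MTL.Sat ρ j (ψ q))

theorem Records.mono {Q Q' : Set α} (h : Records ρ ψ Q w) (hQ : Q' ⊆ Q) : Records ρ ψ Q' w :=
  fun j a ha q hq => h j a ha q (hQ hq)

theorem Records.tSat_atom_iff {q : α} (h : Records ρ ψ {q} w) {i : ℕ} (hi : i < w.length)
    (v : View) : TSat w v i (atom q) ↔ MTL.Sat ρ i (ψ q) := by
  rw [← h i _ (List.getElem?_eq_getElem hi) q rfl]
  simp [TSat, List.getElem?_eq_getElem hi]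

/-- The exact truth values of the metric formulas tell at least as much about `Φ` as the truncated
trace does. -/
theorem Records.of_tSat_subst (Φ : LTL α) (h : Records ρ ψ Φ.atoms w) {i : ℕ}
    (hi : i < w.length) :
    (MTL.TSat ρ w.length .strong i (Φ.subst ψ) → TSat w .strong i Φ) ∧
      (TSat w .weak i Φ → MTL.TSat ρ w.length .weak i (Φ.subst ψ)) := by
  induction Φ generalizing i with
  | tru => exact ⟨id, id⟩
  | atom q =>
    rw [h.tSat_atom_iff hi, h.tSat_atom_iff hi]
    exact MTL.tSat_strong_imp_sat_imp_weak _ hi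
  | conj φ₁ φ₂ ih₁ ih₂ =>
    replace ih₁ := @ih₁ (h.mono Set.subset_union_left)
    replace ih₂ := @ih₂ (h.mono Set.subset_union_right)
    exact ⟨fun h => ⟨(ih₁ hi).1 h.1, (ih₂ hi).1 h.2⟩, fun h => ⟨(ih₁ hi).2 h.1, (ih₂ hi).2 h.2⟩⟩
  | neg φ ih => exact ⟨fun h' h'' => h' ((ih h hi).2 h''), fun h' h'' => h' ((ih h hi).1 h'')⟩
  | untl φ₁ φ₂ ih₁ ih₂ =>
    replace ih₁ := @ih₁ (h.mono Set.subset_union_left)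
    replace ih₂ := @ih₂ (h.mono Set.subset_union_right)
    constructor
    · rintro (⟨j, hij, hj, h₂, -, h₁⟩ | ⟨h, -⟩)
      · exact Or.inl ⟨j, hij, hj, (ih₂ hj).1 h₂, fun k hk hkj =>
          (ih₁ (hkj.trans hj)).1 (h₁ k hk hkj)⟩
      · cases h
    · rintro (⟨j, hij, hj, h₂, h₁⟩ | ⟨-, h⟩)
      · exact Or.inl ⟨j, hij, hj, (ih₂ hj).2 h₂,
          TInterval.mem_unbounded.2 (sub_pos.2 (ρ.strictMono hij)), fun k hk hkj =>
          (ih₁ (hkj.trans hj)).2 (h₁ k hk hkj)⟩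
      · exact Or.inr ⟨rfl, WithTop.coe_lt_top _, fun k hk hkn => (ih₁ hkn).2 (h k hk hkn)⟩
  | snce φ₁ φ₂ ih₁ ih₂ =>
    replace ih₁ := @ih₁ (h.mono Set.subset_union_left)
    replace ih₂ := @ih₂ (h.mono Set.subset_union_right)
    constructor
    · rintro ⟨j, hij, h₂, -, h₁⟩
      exact ⟨j, hij, (ih₂ (hij.trans hi)).1 h₂, fun k hk hkj =>
          (ih₁ (hkj.trans hi)).1 (h₁ k hk hkj)⟩
    · rintro ⟨j, hij, h₂, h₁⟩
      exact ⟨j, hij, (ih₂ (hij.trans hi)).2 h₂,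
          TInterval.mem_unbounded.2 (sub_pos.2 (ρ.strictMono hij)), fun k hk hkj =>
          (ih₁ (hkj.trans hi)).2 (h₁ k hk hkj)⟩

/-- If the truncated trace is so long that it determines the recorded truth values, then it tells
at least as much about `Φ` as these values do. -/
theorem Records.tSat_subst (Φ : LTL α) (h : Records ρ ψ Φ.atoms w) {n : ℕ} (hwn : w.length ≤ n)
    (hn : ∀ q ∈ Φ.atoms, ∀ i < w.length, ∀ v, MTL.TSat ρ n v i (ψ q) ↔ MTL.Sat ρ i (ψ q))
    {i : ℕ} (hi : i < w.length) :
    (TSat w .strong i Φ → MTL.TSat ρ n .strong i (Φ.subst ψ)) ∧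
      (MTL.TSat ρ n .weak i (Φ.subst ψ) → TSat w .weak i Φ) := by
  induction Φ generalizing i with
  | tru => exact ⟨id, id⟩
  | atom q =>
    rw [h.tSat_atom_iff hi, h.tSat_atom_iff hi, subst, hn q rfl i hi, hn q rfl i hi]
    exact ⟨id, id⟩
  | conj φ₁ φ₂ ih₁ ih₂ =>
    replace ih₁ := @ih₁ (h.mono Set.subset_union_left) fun q hq => hn q (Or.inl hq)
    replace ih₂ := @ih₂ (h.mono Set.subset_union_right) fun q hq => hn q (Or.inr hq)
    exact ⟨fun h => ⟨(ih₁ hi).1 h.1, (ih₂ hi).1 h.2⟩, fun h => ⟨(ih₁ hi).2 h.1, (ih₂ hi).2 h.2⟩⟩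
  | neg φ ih => exact ⟨fun h' h'' => h' ((ih h hn hi).2 h''), fun h' h'' => h' ((ih h hn hi).1 h'')⟩
  | untl φ₁ φ₂ ih₁ ih₂ =>
    replace ih₁ := @ih₁ (h.mono Set.subset_union_left) fun q hq => hn q (Or.inl hq)
    replace ih₂ := @ih₂ (h.mono Set.subset_union_right) fun q hq => hn q (Or.inr hq)
    constructor
    · rintro (⟨j, hij, hj, h₂, h₁⟩ | ⟨h, -⟩)
      · exact Or.inl ⟨j, hij, hj.trans_le hwn, (ih₂ hj).1 h₂,
          TInterval.mem_unbounded.2 (sub_pos.2 (ρ.strictMono hij)), fun k hk hkj =>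
          (ih₁ (hkj.trans hj)).1 (h₁ k hk hkj)⟩
      · cases h
    · rintro (⟨j, hij, hj, h₂, -, h₁⟩ | ⟨-, -, h⟩)
      · by_cases hj' : j < w.length
        · exact Or.inl ⟨j, hij, hj', (ih₂ hj').2 h₂, fun k hk hkj =>
            (ih₁ (hkj.trans hj')).2 (h₁ k hk hkj)⟩
        · exact Or.inr ⟨rfl, fun k hk hkn => (ih₁ hkn).2 (h₁ k hk (by omega))⟩
      · exact Or.inr ⟨rfl, fun k hk hkn => (ih₁ hkn).2 (h k hk (by omega))⟩
  | snce φ₁ φ₂ ih₁ ih₂ =>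
    replace ih₁ := @ih₁ (h.mono Set.subset_union_left) fun q hq => hn q (Or.inl hq)
    replace ih₂ := @ih₂ (h.mono Set.subset_union_right) fun q hq => hn q (Or.inr hq)
    constructor
    · rintro ⟨j, hij, h₂, h₁⟩
      exact ⟨j, hij, (ih₂ (hij.trans hi)).1 h₂,
          TInterval.mem_unbounded.2 (sub_pos.2 (ρ.strictMono hij)), fun k hk hkj =>
          (ih₁ (hkj.trans hi)).1 (h₁ k hk hkj)⟩
    · rintro ⟨j, hij, h₂, -, h₁⟩
      exact ⟨j, hij, (ih₂ (hij.trans hi)).2 h₂, fun k hk hkj =>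
          (ih₁ (hkj.trans hi)).2 (h₁ k hk hkj)⟩

theorem subformulas_subst (ψ : α → MTL P) {Φ : LTL α} {q : α} (hq : q ∈ Φ.atoms) :
    ψ q ∈ (Φ.subst ψ).subformulas := by
  induction Φ with
  | tru => exact absurd hq (Set.notMem_empty q)
  | atom q' => rw [show q = q' from hq]; exact MTL.self_mem_subformulas _
  | neg φ ih => simp [subst, MTL.subformulas, ih hq]
  | conj φ₁ φ₂ ih₁ ih₂ | untl φ₁ φ₂ ih₁ ih₂ | snce φ₁ φ₂ ih₁ ih₂ =>
    rcases hq with hq | hq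
    · simp [subst, MTL.subformulas, ih₁ hq]
    · simp [subst, MTL.subformulas, ih₂ hq]

theorem Records.of_isPrefix {Q : Set α} {w' : List (α → Bool)} (h : Records ρ ψ Q w)
    (hw : w' <+: w) : Records ρ ψ Q w' := by
  obtain ⟨u, rfl⟩ := hw
  intro j a ha
  refine h j a ?_
  rw [List.getElem?_append_left (List.getElem?_eq_some_iff.1 ha).1]
  exact ha

/-- A truncation of the trace that determines the first `l` truth values of the formulas `ψ q` with
`q ∈ Q`, whose horizons are at most `h`. -/
theorem exists_tSat_iff_sat (ρ : TimedWord P) {Q : Set α} (hψ : ∀ q, (ψ q).Bounded) {h : ℚ}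
    (hQ : ∀ q ∈ Q, (ψ q).horizon ≤ h) (hh : 0 ≤ h) (l : ℕ) :
    ∃ n, 0 < n ∧ l ≤ n ∧ ∀ q ∈ Q, ∀ i < l, ∀ v, MTL.TSat ρ n v i (ψ q) ↔ MTL.Sat ρ i (ψ q) := by
  obtain ⟨N, hN⟩ := ρ.unbounded (ρ.time l + h)
  have hl : l < N := ρ.strictMono.lt_iff_lt.1 (by linarith)
  refine ⟨N + 1, by omega, by omega, fun q hq i hi v => ?_⟩
  refine MTL.tSat_iff_sat (by omega) _ (hψ q) ?_ v
  have := ρ.strictMono hi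
  rw [Nat.add_sub_cancel]
  linarith [hQ q hq]

section

variable {Φ : LTL α} {W : ℕ → List (α → Bool)} (hψ : ∀ q, (ψ q).Bounded)
  (hW : ∀ n, Records ρ ψ Φ.atoms (W n)) (hlen : ∀ j, ∃ n, j < (W n).length)
include hψ hW hlen

/-- Some word that records the truth values is an informative good prefix for `Φ` if and only if
the trace has an informative good prefix. -/
theorem exists_informativeGood_iff :
    (∃ n w, w <+: W n ∧ InformativeGood w Φ) ↔ ∃ n, MTL.InformativeGood ρ n (Φ.subst ψ) := by
  constructor
  · rintro ⟨n, w, hw, hne, hs⟩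
    obtain ⟨N, hN, hlN, h⟩ := exists_tSat_iff_sat ρ (Q := Φ.atoms) hψ (fun q hq =>
      (ψ q).horizon_le_cSum.trans (MTL.cSum_mono (subformulas_subst ψ hq)))
      (MTL.cSum_nonneg _) w.length
    exact ⟨N, hN, (((hW n).of_isPrefix hw).tSat_subst Φ hlN h
      (List.length_pos_of_ne_nil hne)).1 hs⟩
  · rintro ⟨n, hn, hs⟩
    obtain ⟨N, hN⟩ := hlen n
    have hl : ((W N).take n).length = n := by rw [List.length_take]; omega
    refine ⟨N, _, List.take_prefix n _, List.ne_nil_of_length_pos (by omega), ?_⟩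
    refine (((hW N).of_isPrefix (List.take_prefix n _)).of_tSat_subst Φ (by omega)).1 ?_
    rwa [hl]

theorem exists_informativeBad_iff :
    (∃ n w, w <+: W n ∧ InformativeBad w Φ) ↔ ∃ n, MTL.InformativeBad ρ n (Φ.subst ψ) :=
  exists_informativeGood_iff (Φ := neg Φ) hψ hW hlen

end

end LTL

/-! ### Sweeps over a window of columns -/

namespace Monitor

variable {P : Type u} {m : ℕ} {M : Monitor P m} {a : Set P} {τ : ℚ}

/-- The command takes memory `s` to memory `s'` in time at most `T`, emitting `o`. -/
def Runs (M : Monitor P m) (a : Set P) (τ : ℚ) (c : Cmd P M.rows M.ptrs)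
    (s : Mem M.cols M.rows M.ptrs) (T : ℕ) (o : List (Fin m → Bool))
    (s' : Mem M.cols M.rows M.ptrs) : Prop :=
  ∃ t ≤ T, M.Exec a τ c s t o s'

variable {c c₁ c₂ : Cmd P M.rows M.ptrs} {s s₁ s₂ s' : Mem M.cols M.rows M.ptrs} {T T₁ T₂ : ℕ}
  {o o₁ o₂ : List (Fin m → Bool)} {b : Test P M.rows M.ptrs}

theorem Exec.runs {t : ℕ} (h : M.Exec a τ c s t o s') : M.Runs a τ c s t o s' := ⟨t, le_rfl, h⟩

theorem Runs.mono (h : M.Runs a τ c s T o s') (hT : T ≤ T₁) : M.Runs a τ c s T₁ o s' :=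
  let ⟨t, ht, h⟩ := h; ⟨t, ht.trans hT, h⟩

theorem Runs.seq (h₁ : M.Runs a τ c₁ s T₁ o₁ s₁) (h₂ : M.Runs a τ c₂ s₁ T₂ o₂ s₂) :
    M.Runs a τ (.seq c₁ c₂) s (T₁ + T₂) (o₁ ++ o₂) s₂ :=
  let ⟨_, ht₁, h₁⟩ := h₁
  let ⟨_, ht₂, h₂⟩ := h₂
  ⟨_, add_le_add ht₁ ht₂, .seq h₁ h₂⟩

theorem Runs.condTrue (hb : b.Holds a s) (h : M.Runs a τ c₁ s T o s') :
    M.Runs a τ (.cond b c₁ c₂) s (b.size + T) o s' :=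
  let ⟨_, ht, h⟩ := h
  ⟨_, Nat.add_le_add_left ht _, .condTrue hb h⟩

theorem Runs.condFalse (hb : ¬ b.Holds a s) (h : M.Runs a τ c₂ s T o s') :
    M.Runs a τ (.cond b c₁ c₂) s (b.size + T) o s' :=
  let ⟨_, ht, h⟩ := h
  ⟨_, Nat.add_le_add_left ht _, .condFalse hb h⟩

theorem Runs.loopTrue (hb : b.Holds a s) (h₁ : M.Runs a τ c s T₁ o₁ s₁)
    (h₂ : M.Runs a τ (.loop b c) s₁ T₂ o₂ s₂) :
    M.Runs a τ (.loop b c) s (b.size + T₁ + T₂) (o₁ ++ o₂) s₂ :=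
  let ⟨_, ht₁, h₁⟩ := h₁
  let ⟨_, ht₂, h₂⟩ := h₂
  ⟨_, add_le_add (Nat.add_le_add_left ht₁ _) ht₂, .loopTrue hb h₁ h₂⟩

end Monitor

section Commands

variable {P : Type u} {cols rows ptrs : ℕ}

/-- Move a pointer by one column in the direction of the sweep. -/
def Cmd.move (fwd : Bool) (x : Fin ptrs) : Cmd P rows ptrs :=
  if fwd = true then .next x else .prev x

/-- The neighbouring column in the direction of the sweep. -/
def stepCol [NeZero cols] (fwd : Bool) (p : Fin cols) : Fin cols :=
  if fwd = true then p + 1 else p - 1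

/-- The time from the column of `y` to the column of `x`, in the direction of the sweep, is less
than `q`. -/
def Test.gapLt (fwd : Bool) (x y : Fin ptrs) (q : ℚ) : Test P rows ptrs :=
  if fwd = true then .timeLt x y q else .timeLt y x q

/-- The time from the column of `y` to the column of `x`, in the direction of the sweep, is at most
`q`. -/
def Test.gapLe (fwd : Bool) (x y : Fin ptrs) (q : ℚ) : Test P rows ptrs :=
  if fwd = true then .timeLe x y q else .timeLe y x q

/-- The time from `p` to `q` in the direction of the sweep. -/
def gap (fwd : Bool) (p q : ℚ) : ℚ := if fwd = true then q - p else p - q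

theorem Test.holds_gapLt {fwd : Bool} {x y : Fin ptrs} {q : ℚ} {a : Set P} {s : Mem cols rows ptrs} :
    (Test.gapLt fwd x y q : Test P rows ptrs).Holds a s ↔
      gap fwd (s.time (s.ptr y)) (s.time (s.ptr x)) < q := by
  cases fwd <;> exact Iff.rfl

theorem Test.holds_gapLe {fwd : Bool} {x y : Fin ptrs} {q : ℚ} {a : Set P} {s : Mem cols rows ptrs} :
    (Test.gapLe fwd x y q : Test P rows ptrs).Holds a s ↔
      gap fwd (s.time (s.ptr y)) (s.time (s.ptr x)) ≤ q := by
  cases fwd <;> exact Iff.rfl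

theorem Test.size_gapLt {fwd : Bool} {x y : Fin ptrs} {q : ℚ} :
    (Test.gapLt fwd x y q : Test P rows ptrs).size = 1 := by
  cases fwd <;> rfl

theorem Test.size_gapLe {fwd : Bool} {x y : Fin ptrs} {q : ℚ} :
    (Test.gapLe fwd x y q : Test P rows ptrs).size = 1 := by
  cases fwd <;> rfl

theorem Cmd.size_move {fwd : Bool} {x : Fin ptrs} :
    (Cmd.move fwd x : Cmd P rows ptrs).size = 1 := by
  cases fwd <;> rfl

/-- Move pointer `x` until the test succeeds or the column of pointer `en` is reached. -/
def Cmd.chase (fwd : Bool) (en x : Fin ptrs) (t : Test P rows ptrs) : Cmd P rows ptrs :=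
  .loop (.both (.no (.same x en)) (.no t)) (.move fwd x)

/-- The body of a sweep: pointers `F` and `R` advance to the first columns that pass the tests `tF`
and `tR`, and the result of the test `tW` is written to row `r` in the column of `I`. -/
def Cmd.sweepStep (fwd : Bool) (en I F R : Fin ptrs) (r : Fin rows) (tF tR tW : Test P rows ptrs) :
    Cmd P rows ptrs :=
  .seq (.chase fwd en F tF) (.seq (.chase fwd en R tR)
    (.seq (.cond tW (.write r I true) (.write r I false)) (.move fwd I)))

/-- Pointer `I` runs through the columns from the one of `st` to the one before `en`, with the two
auxiliary pointers `F` and `R` running ahead of it, or along with it. -/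
def Cmd.sweep (fwd : Bool) (st en I F R : Fin ptrs) (r : Fin rows) (tF tR tW : Test P rows ptrs) :
    Cmd P rows ptrs :=
  .seq (.copy I st) (.seq (.copy F st) (.seq (.copy R st)
    (.loop (.no (.same I en)) (.sweepStep fwd en I F R r tF tR tW))))

theorem Cmd.size_sweep {fwd : Bool} {st en I F R : Fin ptrs} {r : Fin rows}
    {tF tR tW : Test P rows ptrs} :
    (Cmd.sweep fwd st en I F R r tF tR tW).size = tF.size + tR.size + tW.size + 28 := by
  simp only [sweep, sweepStep, chase, size, size_move, Test.size]
  omega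

/-- The memory `s` after row `r` and the pointers `I`, `F`, `R` have been overwritten. -/
def Mem.upd (s : Mem cols rows ptrs) (I F R : Fin ptrs) (r : Fin rows) (g : Fin cols → Bool)
    (x y z : Fin cols) : Mem cols rows ptrs where
  time := s.time
  table := Function.update s.table r g
  ptr := Function.update (Function.update (Function.update s.ptr I x) F y) R z

theorem Mem.upd_setF {s : Mem cols rows ptrs} {I F R : Fin ptrs} {r : Fin rows}
    {g : Fin cols → Bool} {x y z y' : Fin cols} (hFR : F ≠ R) :
    ({ s.upd I F R r g x y z with ptr := Function.update (s.upd I F R r g x y z).ptr F y' } :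
      Mem cols rows ptrs) = s.upd I F R r g x y' z := by
  simp only [Mem.upd, Mem.mk.injEq, true_and]
  rw [Function.update_comm hFR.symm, Function.update_idem]

theorem Mem.upd_setI {s : Mem cols rows ptrs} {I F R : Fin ptrs} {r : Fin rows}
    {g : Fin cols → Bool} {x y z x' : Fin cols} (hIF : I ≠ F) (hIR : I ≠ R) :
    ({ s.upd I F R r g x y z with ptr := Function.update (s.upd I F R r g x y z).ptr I x' } :
      Mem cols rows ptrs) = s.upd I F R r g x' y z := by
  simp only [Mem.upd, Mem.mk.injEq, true_and]
  rw [Function.update_comm hIR.symm, Function.update_comm hIF.symm, Function.update_idem]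

end Commands

namespace Monitor

variable {P : Type u} {m : ℕ} {M : Monitor P m} {a : Set P} {τ : ℚ}

theorem runs_move {fwd : Bool} {x : Fin M.ptrs} {s : Mem M.cols M.rows M.ptrs} :
    M.Runs a τ (.move fwd x) s 1 []
      { s with ptr := Function.update s.ptr x (stepCol fwd (s.ptr x)) } := by
  cases fwd
  · exact (Exec.prev s x).runs
  · exact (Exec.next s x).runs

/-- The search that starts at position `u` stops at the first position `u' ≥ u` that satisfies
`q`. -/
theorem runs_chase {fwd : Bool} {en x : Fin M.ptrs} {t : Test P M.rows M.ptrs}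
    {col : ℕ → Fin M.cols} {W : ℕ} (hstep : ∀ u < W, stepCol fwd (col u) = col (u + 1))
    (hinj : ∀ u < W, col u ≠ col W) (hx : x ≠ en) {s : Mem M.cols M.rows M.ptrs}
    (hen : s.ptr en = col W) {q : ℕ → Prop}
    (ht : ∀ u < W, t.Holds a { s with ptr := Function.update s.ptr x (col u) } ↔ q u)
    {u : ℕ} (hu : u ≤ W) :
    ∃ u', u ≤ u' ∧ u' ≤ W ∧ (∀ y, u ≤ y → y < u' → ¬ q y) ∧ (u' < W → q u') ∧
      M.Runs a τ (.chase fwd en x t) { s with ptr := Function.update s.ptr x (col u) }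
        ((t.size + 5) * (u' - u) + (t.size + 4)) []
        { s with ptr := Function.update s.ptr x (col u') } := by
  have hsz : (Test.both (.no (.same x en)) (.no t)).size = t.size + 4 := by
    simp only [Test.size]; omega
  have hb : ∀ u ≤ W, (Test.Holds a { s with ptr := Function.update s.ptr x (col u) }
      (.both (.no (.same x en)) (.no t)) ↔ u < W ∧ ¬ q u) := by
    intro u hu
    simp only [Test.Holds, Function.update_self, Function.update_of_ne hx.symm, hen]
    rcases hu.lt_or_eq with h | rfl
    · simp [hinj u h, h, ht u h]
    · simp
  obtain ⟨d, hd⟩ : ∃ d, u + d = W := ⟨_, Nat.add_sub_cancel' hu⟩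
  induction d generalizing u with
  | zero =>
    refine ⟨u, le_rfl, hu, fun y h h' => by omega, fun h => by omega, ?_⟩
    rw [Nat.sub_self, Nat.mul_zero, Nat.zero_add, ← hsz]
    exact (Exec.loopFalse (by rw [hb u hu]; omega)).runs
  | succ d ih =>
    by_cases hq : q u
    · refine ⟨u, le_rfl, hu, fun y h h' => by omega, fun _ => hq, ?_⟩
      rw [Nat.sub_self, Nat.mul_zero, Nat.zero_add, ← hsz]
      exact (Exec.loopFalse (by rw [hb u hu]; tauto)).runs
    · obtain ⟨u', h1, h2, h3, h4, h5⟩ := ih (u := u + 1) (by omega) (by omega)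
      refine ⟨u', by omega, h2, fun y hy hy' => ?_, h4, ?_⟩
      · rcases hy.eq_or_lt with rfl | hy
        · exact hq
        · exact h3 y hy hy'
      · have hmv := runs_move (M := M) (a := a) (τ := τ) (fwd := fwd) (x := x)
          (s := { s with ptr := Function.update s.ptr x (col u) })
        simp only [Function.update_self, Function.update_idem, hstep u (by omega)] at hmv
        refine (Runs.loopTrue ((hb u hu).2 ⟨by omega, hq⟩) hmv h5).mono ?_
        rw [hsz]
        obtain ⟨e, rfl⟩ : ∃ e, u' = u + 1 + e := ⟨_, (Nat.add_sub_cancel' h1).symm⟩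
        rw [show u + 1 + e - u = e + 1 by omega, show u + 1 + e - (u + 1) = e by omega, mul_add]
        omega

section Sweep

variable {fwd : Bool} {st en I F R : Fin M.ptrs} {r : Fin M.rows} {tF tR tW : Test P M.rows M.ptrs}
  {col : ℕ → Fin M.cols} {W : ℕ} {s : Mem M.cols M.rows M.ptrs} {qF qR : ℕ → ℕ → Prop}
  {w : ℕ → ℕ → ℕ → Prop} {val : ℕ → Prop}

/-- Position `u` is the first one that satisfies `q t`; it is `W` if there is none below `W`. -/
def IsFirst (W : ℕ) (q : ℕ → ℕ → Prop) (t u : ℕ) : Prop :=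
  u ≤ W ∧ (∀ y < u, ¬ q t y) ∧ (u < W → q t u)

/-- Specification of a sweep.  The searches of the auxiliary pointers resume where they stopped,
which is justified by the monotonicity of `qF` and `qR`; so the time is linear in the length of the
window. -/
theorem runs_sweep (hstep : ∀ u < W, stepCol fwd (col u) = col (u + 1))
    (hinj : ∀ u ≤ W, ∀ v ≤ W, col u = col v → u = v)
    (hIF : I ≠ F) (hIR : I ≠ R) (hFR : F ≠ R) (hIe : I ≠ en) (hFe : F ≠ en) (hRe : R ≠ en)
    (hFs : I ≠ st) (hRs : F ≠ st) (hst : s.ptr st = col 0) (hen : s.ptr en = col W)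
    (htF : ∀ g, ∀ t < W, ∀ u < W, ∀ z,
      (tF.Holds a (s.upd I F R r g (col t) (col u) z) ↔ qF t u))
    (htR : ∀ g, ∀ t < W, ∀ y, ∀ v < W,
      (tR.Holds a (s.upd I F R r g (col t) y (col v)) ↔ qR t v))
    (htW : ∀ g, ∀ t < W, ∀ u ≤ W, ∀ v ≤ W,
      (tW.Holds a (s.upd I F R r g (col t) (col u) (col v)) ↔ w t u v))
    (hqF : ∀ t u, t + 1 < W → u < W → qF (t + 1) u → qF t u)
    (hqR : ∀ t u, t + 1 < W → u < W → qR (t + 1) u → qR t u)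
    (hval : ∀ t < W, ∀ u v, IsFirst W qF t u → IsFirst W qR t v → (w t u v ↔ val t)) :
    ∃ g x y z, M.Runs a τ (.sweep fwd st en I F R r tF tR tW) s
        ((tF.size + tR.size + tW.size + 12) * (3 * W) + 5) [] (s.upd I F R r g x y z) ∧
      ∀ t < W, (g (col t) = true ↔ val t) := by
  classical
  set K := tF.size + tR.size + tW.size + 12 with hK
  have hne : ∀ u < W, col u ≠ col W := fun u hu h => by
    have := hinj u hu.le W le_rfl h; omega
  have hloop : ∀ d t u v g, t + d = W → u ≤ W → v ≤ W → (∀ y < u, t < W → ¬ qF t y) →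
      (∀ y < v, t < W → ¬ qR t y) → (∀ t' < t, (g (col t') = true ↔ val t')) →
      ∃ g' x y z, M.Runs a τ (.loop (.no (.same I en)) (.sweepStep fwd en I F R r tF tR tW))
        (s.upd I F R r g (col t) (col u) (col v)) (K * ((W - t) + (W - u) + (W - v)) + 2) []
        (s.upd I F R r g' x y z) ∧ ∀ t < W, (g' (col t) = true ↔ val t) := by
    intro d
    induction d with
    | zero =>
      intro t u v g ht hu hv hF hR hg
      obtain rfl : t = W := by omega
      refine ⟨g, _, _, _, ((Exec.loopFalse ?_).runs).mono (T := 2) (by omega), hg⟩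
      simp [Test.Holds, Mem.upd, hIF, hIR, hIe.symm, hFe.symm, hRe.symm, hen]
    | succ d ih =>
      intro t u v g ht hu hv hF hR hg
      have htW' : t < W := by omega
      have hb : (Test.no (.same I en)).Holds a (s.upd I F R r g (col t) (col u) (col v)) := by
        simp [Test.Holds, Mem.upd, hIF, hIR, hIe.symm, hFe.symm, hRe.symm, hen, hne t htW']
      -- the search of `F`
      have eF : ∀ u', ({ s.upd I F R r g (col t) (col u) (col v) with
          ptr := Function.update (s.upd I F R r g (col t) (col u) (col v)).ptr F (col u') } :
          Mem M.cols M.rows M.ptrs) = s.upd I F R r g (col t) (col u') (col v) :=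
        fun u' => Mem.upd_setF hFR
      obtain ⟨u', hu1, hu2, hu3, hu4, hu5⟩ := runs_chase (M := M) (a := a) (τ := τ) (en := en) (x := F)
        (t := tF) (s := s.upd I F R r g (col t) (col u) (col v)) (q := qF t) hstep hne hFe
        (by simp [Mem.upd, hIe.symm, hFe.symm, hRe.symm, hen])
        (fun u' hu' => by rw [eF]; exact htF g t htW' u' hu' _) hu
      rw [eF, eF] at hu5
      -- the search of `R`
      have eR : ∀ v', ({ s.upd I F R r g (col t) (col u') (col v) with
          ptr := Function.update (s.upd I F R r g (col t) (col u') (col v)).ptr R (col v') } :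
          Mem M.cols M.rows M.ptrs) = s.upd I F R r g (col t) (col u') (col v') := by
        intro v'
        simp only [Mem.upd, Function.update_idem]
      obtain ⟨v', hv1, hv2, hv3, hv4, hv5⟩ := runs_chase (M := M) (a := a) (τ := τ) (en := en) (x := R)
        (t := tR) (s := s.upd I F R r g (col t) (col u') (col v)) (q := qR t) hstep hne hRe
        (by simp [Mem.upd, hIe.symm, hFe.symm, hRe.symm, hen])
        (fun v' hv' => by rw [eR]; exact htR g t htW' _ v' hv') hv
      rw [eR, eR] at hv5
      have hfF : IsFirst W qF t u' := ⟨hu2, fun y hy => by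
        by_cases h : y < u
        · exact hF y h htW'
        · exact hu3 y (not_lt.1 h) hy, hu4⟩
      have hfR : IsFirst W qR t v' := ⟨hv2, fun y hy => by
        by_cases h : y < v
        · exact hR y h htW'
        · exact hv3 y (not_lt.1 h) hy, hv4⟩
      have hw := hval t htW' u' v' hfF hfR
      -- the result is written
      have hwr : ∀ β : Bool, M.Runs a τ (.write r I β) (s.upd I F R r g (col t) (col u') (col v')) 1 []
          (s.upd I F R r (Function.update g (col t) β) (col t) (col u') (col v')) := by
        intro β
        have := (Exec.write (M := M) (a := a) (τ := τ)
          (s.upd I F R r g (col t) (col u') (col v')) r I β).runs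
        simpa [Mem.upd, hIF, hIR] using this
      have hcond : M.Runs a τ (.cond tW (.write r I true) (.write r I false))
          (s.upd I F R r g (col t) (col u') (col v')) (tW.size + 1) []
          (s.upd I F R r (Function.update g (col t) (decide (val t))) (col t) (col u') (col v')) := by
        by_cases h : val t
        · rw [decide_eq_true h]
          exact Runs.condTrue ((htW g t htW' u' hu2 v' hv2).2 (hw.2 h)) (hwr true)
        · rw [decide_eq_false h]
          exact Runs.condFalse (fun h' => h (hw.1 ((htW g t htW' u' hu2 v' hv2).1 h'))) (hwr false)
      have hmv : M.Runs a τ (.move fwd I)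
          (s.upd I F R r (Function.update g (col t) (decide (val t))) (col t) (col u') (col v')) 1 []
          (s.upd I F R r (Function.update g (col t) (decide (val t))) (col (t + 1)) (col u')
            (col v')) := by
        have h := runs_move (M := M) (a := a) (τ := τ) (fwd := fwd) (x := I) (s := s.upd I F R r
          (Function.update g (col t) (decide (val t))) (col t) (col u') (col v'))
        have e : (s.upd I F R r (Function.update g (col t) (decide (val t))) (col t) (col u')
            (col v')).ptr I = col t := by
          simp [Mem.upd, hIF, hIR]
        rw [e, hstep t htW'] at h
        rwa [Mem.upd_setI hIF hIR] at h
      obtain ⟨g', x, y, z, hrun, hg'⟩ := ih (t + 1) u' v' (Function.update g (col t) (decide (val t)))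
        (by omega) hu2 hv2 (fun y hy h hq => hfF.2.1 y hy (hqF t y h (by omega) hq))
        (fun y hy h hq => hfR.2.1 y hy (hqR t y h (by omega) hq)) (fun t' ht' => by
          rcases (show t' ≤ t by omega).eq_or_lt with rfl | hlt
          · simp
          · rw [Function.update_of_ne]
            · exact hg t' hlt
            · intro h
              have := hinj t' (by omega) t htW'.le h
              omega)
      refine ⟨g', x, y, z, (Runs.loopTrue hb (hu5.seq (hv5.seq (hcond.seq hmv))) hrun).mono ?_, hg'⟩
      obtain ⟨p, rfl⟩ : ∃ p, u' = u + p := ⟨_, (Nat.add_sub_cancel' hu1).symm⟩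
      obtain ⟨q, rfl⟩ : ∃ q, v' = v + q := ⟨_, (Nat.add_sub_cancel' hv1).symm⟩
      have e1 : (W - t) + (W - u) + (W - v) =
          1 + p + q + ((W - (t + 1)) + (W - (u + p)) + (W - (v + q))) := by omega
      generalize (W - (t + 1)) + (W - (u + p)) + (W - (v + q)) = S at e1 ⊢
      rw [e1, show K * (1 + p + q + S) = K + K * p + K * q + K * S by ring,
        Nat.add_sub_cancel_left, Nat.add_sub_cancel_left]
      have h1 : (tF.size + 5) * p ≤ K * p := Nat.mul_le_mul_right _ (by omega)
      have h2 : (tR.size + 5) * q ≤ K * q := Nat.mul_le_mul_right _ (by omega)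
      simp only [Test.size]
      omega
  obtain ⟨g, x, y, z, hrun, hg⟩ := hloop W 0 0 0 (s.table r) (by omega) (by omega) (by omega)
    (fun y hy => by omega) (fun y hy => by omega) (fun y hy => by omega)
  refine ⟨g, x, y, z, ?_, hg⟩
  have h1 := (Exec.copy (M := M) (a := a) (τ := τ) s I st).runs
  have h2 := (Exec.copy (M := M) (a := a) (τ := τ)
    { s with ptr := Function.update s.ptr I (s.ptr st) } F st).runs
  have h3 := (Exec.copy (M := M) (a := a) (τ := τ)
    { s with ptr := Function.update (Function.update s.ptr I (s.ptr st)) F (s.ptr st) } R st).runs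
  have e0 : s.upd I F R r (s.table r) (col 0) (col 0) (col 0) =
      { s with ptr := Function.update (Function.update (Function.update s.ptr I (s.ptr st)) F
        (s.ptr st)) R (s.ptr st) } := by
    simp [Mem.upd, hst]
  rw [e0] at hrun
  simp only [Function.update_of_ne hFs.symm, Function.update_of_ne hRs.symm] at h2 h3
  refine (h1.seq (h2.seq (h3.seq hrun))).mono ?_
  have : W - 0 + (W - 0) + (W - 0) = 3 * W := by omega
  rw [this]
  omega

end Sweep

end Monitor

/-! ### Evaluation of an operator on a window -/

section Columns

/-- The position that is visited at step `t` of a sweep over the window `[b, n]`. -/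
def posOf (fwd : Bool) (b n t : ℕ) : ℕ := if fwd = true then b + t else n - t

/-- The column that is visited at step `t` of a sweep over the window `[b, n]`; for `t = n + 1 - b`
it is the one next to the window. -/
def colOf (cols : ℕ) [NeZero cols] (fwd : Bool) (b n t : ℕ) : Fin cols :=
  if fwd = true then Fin.ofNat cols (b + t) else Fin.ofNat cols n - Fin.ofNat cols t

variable {cols : ℕ} [NeZero cols] {fwd : Bool} {b n : ℕ}

theorem finOfNat_add (x y : ℕ) : Fin.ofNat cols (x + y) = Fin.ofNat cols x + Fin.ofNat cols y := by
  ext; simp [Fin.val_add]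

theorem finOfNat_succ (x : ℕ) : Fin.ofNat cols (x + 1) = Fin.ofNat cols x + 1 := finOfNat_add x 1

theorem eq_of_finOfNat_eq {x y : ℕ} (h : Fin.ofNat cols x = Fin.ofNat cols y)
    (hxy : x < y + cols) (hyx : y < x + cols) : x = y := by
  have h : x % cols = y % cols := by simpa [Fin.ext_iff] using h
  have hm : x ≡ y [MOD cols] := h
  rcases le_total x y with hle | hle
  · obtain ⟨d, rfl⟩ := Nat.exists_eq_add_of_le hle
    have h0 := (Nat.modEq_iff_dvd' hle).1 hm
    rw [Nat.add_sub_cancel_left] at h0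
    have := Nat.eq_zero_of_dvd_of_lt h0 (by omega)
    omega
  · obtain ⟨d, rfl⟩ := Nat.exists_eq_add_of_le hle
    have h0 := (Nat.modEq_iff_dvd' hle).1 hm.symm
    rw [Nat.add_sub_cancel_left] at h0
    have := Nat.eq_zero_of_dvd_of_lt h0 (by omega)
    omega

theorem stepCol_colOf (t : ℕ) : stepCol fwd (colOf cols fwd b n t) = colOf cols fwd b n (t + 1) := by
  cases fwd
  · simp only [stepCol, colOf, Bool.false_eq_true, if_false, finOfNat_succ]
    abel
  · simp only [stepCol, colOf, if_true]
    rw [← add_assoc b, finOfNat_succ]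

theorem colOf_injOn (hn : n + 1 - b < cols) :
    ∀ u ≤ n + 1 - b, ∀ v ≤ n + 1 - b, colOf cols fwd b n u = colOf cols fwd b n v → u = v := by
  intro u hu v hv h
  cases fwd
  · simp only [colOf, Bool.false_eq_true, if_false, sub_right_inj] at h
    exact eq_of_finOfNat_eq h (by omega) (by omega)
  · simp only [colOf, if_true] at h
    have := eq_of_finOfNat_eq h (by omega) (by omega)
    omega

theorem colOf_eq {t : ℕ} (ht : t < n + 1 - b) :
    colOf cols fwd b n t = Fin.ofNat cols (posOf fwd b n t) := by
  cases fwd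
  · simp only [posOf, colOf, Bool.false_eq_true, if_false]
    obtain ⟨e, rfl⟩ : ∃ e, n = e + t := ⟨n - t, by omega⟩
    rw [Nat.add_sub_cancel, finOfNat_add, add_sub_cancel_right]
  · rfl

theorem posOf_mem {t : ℕ} (ht : t < n + 1 - b) : b ≤ posOf fwd b n t ∧ posOf fwd b n t ≤ n := by
  cases fwd
  · simp only [posOf, Bool.false_eq_true, if_false]; omega
  · simp only [posOf, if_true]; omega

theorem exists_posOf (fwd : Bool) {x : ℕ} (h₁ : b ≤ x) (h₂ : x ≤ n) :
    ∃ t < n + 1 - b, posOf fwd b n t = x := by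
  cases fwd
  · exact ⟨n - x, by omega, by simp only [posOf, Bool.false_eq_true, if_false]; omega⟩
  · exact ⟨x - b, by omega, by simp only [posOf, if_true]; omega⟩

theorem TimedWord.dist_posOf_le {P : Type u} (ρ : TimedWord P) {t u v : ℕ} (huv : u ≤ v) :
    ρ.dist fwd (posOf fwd b n t) (posOf fwd b n u) ≤ ρ.dist fwd (posOf fwd b n t) (posOf fwd b n v)
    ∧ ρ.dist fwd (posOf fwd b n v) (posOf fwd b n t) ≤
      ρ.dist fwd (posOf fwd b n u) (posOf fwd b n t) := by
  cases fwd
  · simp only [posOf, TimedWord.dist, Bool.false_eq_true, if_false]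
    have := ρ.strictMono.monotone (show n - v ≤ n - u by omega)
    exact ⟨by linarith, by linarith⟩
  · simp only [posOf, TimedWord.dist, if_true]
    have := ρ.strictMono.monotone (show b + u ≤ b + v by omega)
    exact ⟨by linarith, by linarith⟩

end Columns

section Tests

variable {P : Type u} {cols rows ptrs : ℕ}

/-- The lower bound of `I` is respected by the time from `y` to `x`. -/
def Test.lo (fwd : Bool) (I : TInterval) (x y : Fin ptrs) : Test P rows ptrs :=
  .no (if I.loClosed = true then .gapLt fwd x y I.lo else .gapLe fwd x y I.lo)

/-- The upper bound of `I` is respected by the time from `y` to `x`. -/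
def Test.hi (fwd : Bool) (I : TInterval) (x y : Fin ptrs) : Test P rows ptrs :=
  if I.hiClosed = true then .gapLe fwd x y I.hiQ else .gapLt fwd x y I.hiQ

variable {fwd : Bool} {I : TInterval} {x y : Fin ptrs} {a : Set P} {s : Mem cols rows ptrs}

theorem Test.holds_lo : (Test.lo fwd I x y : Test P rows ptrs).Holds a s ↔
    I.LoOk (gap fwd (s.time (s.ptr y)) (s.time (s.ptr x))) := by
  unfold Test.lo TInterval.LoOk
  split_ifs <;> simp only [Test.Holds, holds_gapLt, holds_gapLe, not_lt, not_le]

theorem Test.holds_hi : (Test.hi fwd I x y : Test P rows ptrs).Holds a s ↔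
    I.HiOk (gap fwd (s.time (s.ptr y)) (s.time (s.ptr x))) := by
  unfold Test.hi TInterval.HiOk
  split_ifs <;> simp only [holds_gapLt, holds_gapLe]

theorem Test.size_lo : (Test.lo fwd I x y : Test P rows ptrs).size = 2 := by
  unfold Test.lo
  split_ifs <;> simp [Test.size, size_gapLt, size_gapLe]

theorem Test.size_hi : (Test.hi fwd I x y : Test P rows ptrs).size = 1 := by
  unfold Test.hi
  split_ifs <;> simp [size_gapLt, size_gapLe]

/-- The sweep that evaluates a temporal operator, from the rows `r₁`, `r₂` of its arguments.
Pointer `F` is at the first candidate for the witness that is far enough from `A`, pointer `R` at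
the first column at distance more than `c` from `A` where the first argument fails.  The nearest
witness is the best one, so it suffices to check that it is not too far from `A`, and at most `d`
beyond `R`. -/
def Cmd.temporal (fwd : Bool) (st en A F R : Fin ptrs) (r r₁ r₂ : Fin rows) (I : TInterval)
    (c d : ℚ) : Cmd P rows ptrs :=
  .sweep fwd st en A F R r (.both (.lo fwd I F A) (.cell r₂ F))
    (.both (.no (.gapLe fwd R A c)) (.no (.cell r₁ R)))
    (.both (.no (.same F en)) (.both (.hi fwd I F A)
      (.no (.both (.no (.same R en)) (.no (.gapLe fwd F R d))))))

theorem Cmd.size_temporal {st en A F R : Fin ptrs} {r r₁ r₂ : Fin rows} {c d : ℚ} :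
    (Cmd.temporal fwd st en A F R r r₁ r₂ I c d : Cmd P rows ptrs).size = 48 := by
  simp only [temporal, size_sweep, Test.size, Test.size_lo, Test.size_hi, Test.size_gapLe]

/-- The sweep that evaluates a test in each column of the window. -/
def Cmd.pointwise (st en A F R : Fin ptrs) (r : Fin rows) (t : Test P rows ptrs) :
    Cmd P rows ptrs :=
  .sweep true st en A F R r (.same A A) (.same A A) t

theorem Cmd.size_pointwise {st en A F R : Fin ptrs} {r : Fin rows} {t : Test P rows ptrs} :
    (Cmd.pointwise st en A F R r t).size = t.size + 30 := by
  simp only [pointwise, size_sweep, Test.size]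
  omega

end Tests

namespace Monitor

variable {P : Type u} {m : ℕ} {M : Monitor P m} {a : Set P} {τ : ℚ} {fwd : Bool}
  {st en A F R : Fin M.ptrs} {r r₁ r₂ : Fin M.rows} {s : Mem M.cols M.rows M.ptrs} {b n : ℕ}

theorem runs_temporal (ρ : TimedWord P) (hcols : n + 1 - b < M.cols)
    (hAF : A ≠ F) (hAR : A ≠ R) (hFR : F ≠ R) (hAe : A ≠ en) (hFe : F ≠ en) (hRe : R ≠ en)
    (hAs : A ≠ st) (hFs : F ≠ st) (hst : s.ptr st = colOf M.cols fwd b n 0)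
    (hen : s.ptr en = colOf M.cols fwd b n (n + 1 - b))
    (htime : ∀ x, b ≤ x → x ≤ n → s.time (Fin.ofNat M.cols x) = ρ.time x)
    (hr₁ : r₁ ≠ r) (hr₂ : r₂ ≠ r) (I : TInterval) (c d : ℚ) :
    ∃ g x y z, M.Runs a τ (.temporal fwd st en A F R r r₁ r₂ I c d) s (96 * (n + 1 - b) + 5) []
        (s.upd A F R r g x y z) ∧
      ∀ x, b ≤ x → x ≤ n → (g (Fin.ofNat M.cols x) = true ↔
        OpHolds (ρ.dist fwd) I c d (fun x => b ≤ x ∧ x ≤ n)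
          (fun x => s.table r₁ (Fin.ofNat M.cols x) = true)
          (fun x => s.table r₂ (Fin.ofNat M.cols x) = true) x) := by
  set W := n + 1 - b with hW
  set pos := posOf fwd b n with hpos
  set col := colOf M.cols fwd b n with hcol
  have hinj := colOf_injOn (fwd := fwd) hcols
  have hgap : ∀ t < W, ∀ u < W, gap fwd (s.time (col t)) (s.time (col u)) =
      ρ.dist fwd (pos t) (pos u) := by
    intro t ht u hu
    rw [hcol, colOf_eq ht, colOf_eq hu, htime _ (posOf_mem ht).1 (posOf_mem ht).2,
      htime _ (posOf_mem hu).1 (posOf_mem hu).2]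
    rfl
  have hlt : ∀ u ≤ W, (col u ≠ col W ↔ u < W) := by
    intro u hu
    refine ⟨fun h => lt_of_le_of_ne hu fun h' => h (by rw [h']), fun h h' => ?_⟩
    have := hinj u hu W le_rfl h'
    omega
  have hcp : ∀ t < W, col t = Fin.ofNat M.cols (pos t) := fun t ht => colOf_eq ht
  obtain ⟨g, x, y, z, hrun, hg⟩ := runs_sweep (M := M) (a := a) (τ := τ) (fwd := fwd) (st := st)
    (en := en) (I := A) (F := F) (R := R) (r := r) (col := col) (W := W) (s := s)
    (tF := .both (.lo fwd I F A) (.cell r₂ F))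
    (tR := .both (.no (.gapLe fwd R A c)) (.no (.cell r₁ R)))
    (tW := .both (.no (.same F en)) (.both (.hi fwd I F A)
      (.no (.both (.no (.same R en)) (.no (.gapLe fwd F R d))))))
    (qF := fun t u => I.LoOk (ρ.dist fwd (pos t) (pos u)) ∧
      s.table r₂ (Fin.ofNat M.cols (pos u)) = true)
    (qR := fun t u => c < ρ.dist fwd (pos t) (pos u) ∧
      ¬ s.table r₁ (Fin.ofNat M.cols (pos u)) = true)
    (w := fun t u v => u < W ∧ I.HiOk (ρ.dist fwd (pos t) (pos u)) ∧
      ¬ (v < W ∧ d < ρ.dist fwd (pos v) (pos u)))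
    (val := fun t => OpHolds (ρ.dist fwd) I c d (fun x => b ≤ x ∧ x ≤ n)
          (fun x => s.table r₁ (Fin.ofNat M.cols x) = true)
          (fun x => s.table r₂ (Fin.ofNat M.cols x) = true) (pos t))
    (fun u _ => stepCol_colOf u) hinj hAF hAR hFR hAe hFe hRe hAs hFs hst hen
    (by
      intro g t ht u hu z
      rw [← hgap t ht u hu, ← hcp u hu]
      simp [Test.Holds, Test.holds_lo, Mem.upd, hAF, hAR, hFR, hr₂])
    (by
      intro g t ht y v hv
      rw [← hgap t ht v hv, ← hcp v hv]
      simp [Test.Holds, Test.holds_gapLe, Mem.upd, hAF, hAR, hr₁])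
    (by
      intro g t ht u hu v hv
      simp only [Test.Holds, Test.holds_gapLe, Test.holds_hi, Mem.upd, Function.update_self,
        Function.update_of_ne hFR, Function.update_of_ne hAF, Function.update_of_ne hAR,
        Function.update_of_ne hAe.symm, Function.update_of_ne hFe.symm,
        Function.update_of_ne hRe.symm, hen]
      rw [← ne_eq, ← ne_eq, hlt u hu, hlt v hv]
      refine and_congr_right fun hu' => ?_
      rw [hgap t ht u hu', not_le]
      refine and_congr_right fun _ => not_congr (and_congr_right fun hv' => ?_)
      rw [hgap v hv' u hu'])
    (fun t u ht hu h => ⟨h.1.mono (ρ.dist_posOf_le (Nat.le_succ t)).2, h.2⟩)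
    (fun t u ht hu h => ⟨h.1.trans_le (ρ.dist_posOf_le (Nat.le_succ t)).2, h.2⟩)
    (by
      rintro t ht u v ⟨hu, hu1, hu2⟩ ⟨hv, hv1, hv2⟩
      constructor
      · rintro ⟨huW, hhi, hR⟩
        refine ⟨pos u, posOf_mem huW, (hu2 huW).2, (hu2 huW).1, hhi, fun k hk hck hdk => ?_⟩
        obtain ⟨k, hkW, rfl⟩ := exists_posOf fwd hk.1 hk.2
        by_contra hA
        have hvk : v ≤ k := by
          by_contra h
          exact hv1 k (not_le.1 h) ⟨hck, hA⟩
        exact hR ⟨hvk.trans_lt hkW, hdk.trans_le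
          (ρ.dist_posOf_le hvk).2⟩
      · rintro ⟨j, hj, hB, hlo, hhi, hA⟩
        obtain ⟨j, hjW, rfl⟩ := exists_posOf fwd hj.1 hj.2
        have huj : u ≤ j := by
          by_contra h
          exact hu1 j (not_le.1 h) ⟨hlo, hB⟩
        have huW := huj.trans_lt hjW
        refine ⟨huW, hhi.mono (ρ.dist_posOf_le huj).1, fun ⟨hvW, hd⟩ => ?_⟩
        exact (hv2 hvW).2 (hA _ (posOf_mem hvW) (hv2 hvW).1
          (hd.trans_le (ρ.dist_posOf_le huj).1)))
  refine ⟨g, x, y, z, hrun.mono ?_, fun x h₁ h₂ => ?_⟩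
  · simp only [Test.size, Test.size_lo, Test.size_hi, Test.size_gapLe]
    omega
  · obtain ⟨t, ht, rfl⟩ := exists_posOf fwd h₁ h₂
    rw [← colOf_eq ht]
    exact hg t ht

theorem runs_pointwise (hcols : n + 1 - b < M.cols)
    (hAF : A ≠ F) (hAR : A ≠ R) (hFR : F ≠ R) (hAe : A ≠ en) (hFe : F ≠ en) (hRe : R ≠ en)
    (hAs : A ≠ st) (hFs : F ≠ st) (hst : s.ptr st = colOf M.cols true b n 0)
    (hen : s.ptr en = colOf M.cols true b n (n + 1 - b)) {t : Test P M.rows M.ptrs}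
    {val : ℕ → Prop} (hval : ∀ g x y z, b ≤ x → x ≤ n →
      (t.Holds a (s.upd A F R r g (Fin.ofNat M.cols x) y z) ↔ val x)) :
    ∃ g x y z, M.Runs a τ (.pointwise st en A F R r t) s
        ((t.size + 14) * (3 * (n + 1 - b)) + 5) [] (s.upd A F R r g x y z) ∧
      ∀ x, b ≤ x → x ≤ n → (g (Fin.ofNat M.cols x) = true ↔ val x) := by
  obtain ⟨g, x, y, z, hrun, hg⟩ := runs_sweep (M := M) (a := a) (τ := τ) (fwd := true) (st := st)
    (en := en) (I := A) (F := F) (R := R) (r := r) (col := colOf M.cols true b n)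
    (W := n + 1 - b) (s := s) (tF := .same A A) (tR := .same A A) (tW := t)
    (qF := fun _ _ => True) (qR := fun _ _ => True) (w := fun t _ _ => val (posOf true b n t))
    (val := fun t => val (posOf true b n t))
    (fun u _ => stepCol_colOf u) (colOf_injOn hcols) hAF hAR hFR hAe hFe hRe hAs hFs hst hen
    (fun g t ht u hu z => by simp [Test.Holds]) (fun g t ht u hu z => by simp [Test.Holds])
    (fun g t ht u hu v hv => by
      rw [colOf_eq ht]; exact hval g _ _ _ (posOf_mem ht).1 (posOf_mem ht).2)
    (fun _ _ _ _ h => h) (fun _ _ _ _ h => h) (fun _ _ _ _ _ _ => Iff.rfl)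
  refine ⟨g, x, y, z, hrun.mono ?_, fun x h₁ h₂ => ?_⟩
  · simp only [Test.size]
    refine Nat.add_le_add_right (Nat.mul_le_mul_right _ ?_) _
    omega
  · obtain ⟨t, ht, rfl⟩ := exists_posOf true h₁ h₂
    rw [← colOf_eq ht]
    exact hg t ht

end Monitor

/-! ### The program -/

/-- The pointers of the program: the column of the current event, the first columns of the three
blocks, the three pointers of the sweeps, and the columns after and before the window. -/
inductive Ptr
  | head
  | blk₁
  | blk₂
  | blk₃
  | cur
  | wit
  | obs
  | after
  | before

section Program

variable {P : Type u} {rows ptrs : ℕ} (pt : Ptr ↪ Fin ptrs) (idx : MTL P → Fin rows)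

/-- The command that evaluates a formula on the window, from the rows of its direct subformulas.
The rows of atomic formulas are filled when the events arrive. -/
def Cmd.eval (χ : MTL P) : Cmd P rows ptrs :=
  match χ with
  | .tru => .skip
  | .atom _ => .skip
  | .conj φ₁ φ₂ => .pointwise (pt .blk₁) (pt .after) (pt .cur) (pt .wit) (pt .obs) (idx χ)
      (.both (.cell (idx φ₁) (pt .cur)) (.cell (idx φ₂) (pt .cur)))
  | .neg φ => .pointwise (pt .blk₁) (pt .after) (pt .cur) (pt .wit) (pt .obs) (idx χ)
      (.no (.cell (idx φ) (pt .cur)))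
  | .untl I φ₁ φ₂ => .temporal true (pt .blk₁) (pt .after) (pt .cur) (pt .wit) (pt .obs) (idx χ)
      (idx φ₁) (idx φ₂) I 0 0
  | .snce I φ₁ φ₂ => .temporal false (pt .head) (pt .before) (pt .cur) (pt .wit) (pt .obs) (idx χ)
      (idx φ₁) (idx φ₂) I 0 0
  | .guntl I c _ _ φ₁ φ₂ => .temporal true (pt .blk₁) (pt .after) (pt .cur) (pt .wit) (pt .obs)
      (idx χ) (idx φ₁) (idx φ₂) I c (I.lo - c)
  | .gsnce I c _ _ φ₁ φ₂ => .temporal false (pt .head) (pt .before) (pt .cur) (pt .wit) (pt .obs)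
      (idx χ) (idx φ₁) (idx φ₂) I c (I.lo - c)

theorem Cmd.size_eval (χ : MTL P) : (Cmd.eval pt idx χ).size ≤ 48 := by
  cases χ <;> simp [eval, Cmd.size, size_pointwise, size_temporal, Test.size]

/-- Fill the row of an atomic formula in the column of the current event. -/
def Cmd.arrive : MTL P → Cmd P rows ptrs
  | .tru => .write (idx .tru) (pt .head) true
  | .atom p => .cond (.current p) (.write (idx (.atom p)) (pt .head) true)
      (.write (idx (.atom p)) (pt .head) false)
  | _ => .skip

theorem Cmd.size_arrive (χ : MTL P) : (Cmd.arrive pt idx χ).size ≤ 4 := by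
  cases χ <;> simp [arrive, Cmd.size, Test.size]

/-- Execute the commands `f χ` for the members of a list, in this order. -/
def Cmd.forEach (f : MTL P → Cmd P rows ptrs) : List (MTL P) → Cmd P rows ptrs
  | [] => .skip
  | χ :: l => .seq (f χ) (.forEach f l)

theorem Cmd.size_forEach (f : MTL P → Cmd P rows ptrs) {B : ℕ} (hf : ∀ χ, (f χ).size ≤ B)
    (l : List (MTL P)) : (Cmd.forEach f l).size ≤ (B + 1) * l.length + 1 := by
  induction l with
  | nil => simp [forEach, Cmd.size]
  | cons χ l ih =>
    have := hf χ
    simp only [forEach, Cmd.size, List.length_cons, mul_add]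
    omega

/-- Emit the letters of the middle block. -/
def Cmd.emitBlock : Cmd P rows ptrs :=
  .seq (.copy (pt .cur) (pt .blk₂)) (.loop (.no (.same (pt .cur) (pt .blk₃)))
    (.seq (.emit (pt .cur)) (.next (pt .cur))))

/-- Evaluate all formulas on the window, which consists of three blocks and the current event; emit
the letters of the middle block; drop the first block. -/
def Cmd.batch (l : List (MTL P)) : Cmd P rows ptrs :=
  .seq (.copy (pt .after) (pt .head)) (.seq (.next (pt .after))
    (.seq (.copy (pt .before) (pt .blk₁)) (.seq (.prev (pt .before))
      (.seq (.forEach (.eval pt idx) l) (.seq (.emitBlock pt)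
        (.seq (.copy (pt .blk₁) (pt .blk₂)) (.seq (.copy (pt .blk₂) (pt .blk₃))
          (.copy (pt .blk₃) (pt .head)))))))))

/-- The body of the program: the current event is stored; if it comes more than `H` after the start
of the last block, the window is evaluated and a new block starts. -/
def Cmd.main (H : ℚ) (l : List (MTL P)) : Cmd P rows ptrs :=
  .seq (.store (pt .head)) (.seq (.forEach (.arrive pt idx) l)
    (.seq (.cond (.no (.timeLe (pt .head) (pt .blk₃) H)) (.batch pt idx l) .skip)
      (.next (pt .head))))

theorem Cmd.size_main (H : ℚ) (l : List (MTL P)) :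
    (Cmd.main pt idx H l).size ≤ 54 * l.length + 40 := by
  have h₁ := Cmd.size_forEach _ (Cmd.size_eval pt idx) l
  have h₂ := Cmd.size_forEach _ (Cmd.size_arrive pt idx) l
  simp only [main, batch, emitBlock, Cmd.size, Test.size]
  omega

end Program

namespace MTL

variable {P : Type u}

theorem depth_lt_of_mem_subformulas {φ χ : MTL P} (h : χ ∈ φ.subformulas) (hne : χ ≠ φ) :
    χ.depth < φ.depth := by
  cases φ with
  | tru | atom => simp only [subformulas, Finset.mem_singleton] at h; exact absurd h hne
  | neg φ =>
    simp only [subformulas, Finset.mem_insert, hne, false_or] at h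
    exact Nat.lt_succ_of_le (depth_le_of_mem_subformulas h)
  | conj | untl | snce | guntl | gsnce =>
    simp only [subformulas, Finset.mem_insert, Finset.mem_union, hne, false_or] at h
    simp only [depth]
    rcases h with h | h
    · have := depth_le_of_mem_subformulas h; omega
    · have := depth_le_of_mem_subformulas h; omega

end MTL

namespace Monitor

variable {P : Type u} {m : ℕ} {M : Monitor P m} {a : Set P} {τ : ℚ} (pt : Ptr ↪ Fin M.ptrs)
  (idx : MTL P → Fin M.rows) (ρ : TimedWord P) (b n : ℕ)

/-- The row of `χ` is correct at the positions of the window `[b, n]` that are far enough from its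
ends. -/
def RowOk (s : Mem M.cols M.rows M.ptrs) (χ : MTL P) : Prop :=
  ∀ x, b ≤ x → x ≤ n → ρ.Margin b n χ.horizon x →
    (s.table (idx χ) (Fin.ofNat M.cols x) = true ↔ MTL.Sat ρ x χ)

/-- The window `[b, n]` is stored, and the pointers to its ends are in place. -/
structure Ready (s : Mem M.cols M.rows M.ptrs) : Prop where
  le : b ≤ n
  lt_cols : n + 1 - b < M.cols
  time : ∀ x, b ≤ x → x ≤ n → s.time (Fin.ofNat M.cols x) = ρ.time x
  head : s.ptr (pt .head) = Fin.ofNat M.cols n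
  blk₁ : s.ptr (pt .blk₁) = Fin.ofNat M.cols b
  after : s.ptr (pt .after) = Fin.ofNat M.cols n + 1
  before : s.ptr (pt .before) = Fin.ofNat M.cols b - 1

/-- The memories agree except for the pointers that are used in the sweeps and for row `r`. -/
structure SameExcept (r : Fin M.rows) (s s' : Mem M.cols M.rows M.ptrs) : Prop where
  time : s'.time = s.time
  ptr : ∀ p, p ≠ .cur → p ≠ .wit → p ≠ .obs → s'.ptr (pt p) = s.ptr (pt p)
  table : ∀ r', r' ≠ r → s'.table r' = s.table r'

variable {pt idx ρ b n} {s s' : Mem M.cols M.rows M.ptrs}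

theorem SameExcept.refl (r : Fin M.rows) : SameExcept pt r s s :=
  ⟨rfl, fun _ _ _ _ => rfl, fun _ _ => rfl⟩

theorem SameExcept.upd {r : Fin M.rows} {g : Fin M.cols → Bool} {x y z : Fin M.cols} :
    SameExcept pt r s (s.upd (pt .cur) (pt .wit) (pt .obs) r g x y z) :=
  ⟨rfl, fun p h₁ h₂ h₃ => by simp [Mem.upd, h₁, h₂, h₃],
    fun r' h => by simp [Mem.upd, h]⟩

theorem Ready.of_sameExcept (h : Ready pt ρ b n s) {r : Fin M.rows} (h' : SameExcept pt r s s') :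
    Ready pt ρ b n s' where
  le := h.le
  lt_cols := h.lt_cols
  time := by rw [h'.time]; exact h.time
  head := by rw [h'.ptr _ (by simp) (by simp) (by simp), h.head]
  blk₁ := by rw [h'.ptr _ (by simp) (by simp) (by simp), h.blk₁]
  after := by rw [h'.ptr _ (by simp) (by simp) (by simp), h.after]
  before := by rw [h'.ptr _ (by simp) (by simp) (by simp), h.before]

theorem Ready.ends (h : Ready pt ρ b n s) :
    (s.ptr (pt .blk₁) = colOf M.cols true b n 0 ∧
      s.ptr (pt .after) = colOf M.cols true b n (n + 1 - b)) ∧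
    (s.ptr (pt .head) = colOf M.cols false b n 0 ∧
      s.ptr (pt .before) = colOf M.cols false b n (n + 1 - b)) := by
  obtain ⟨e, rfl⟩ := Nat.exists_eq_add_of_le h.le
  refine ⟨⟨by rw [h.blk₁]; rfl, ?_⟩, ?_, ?_⟩
  · rw [h.after, ← finOfNat_succ, colOf, if_pos rfl]
    congr 1; omega
  · rw [h.head]
    simp [colOf]
  · rw [h.before, colOf, if_neg (by simp), show b + e + 1 - b = e + 1 by omega, finOfNat_add,
      finOfNat_succ]
    abel

/-- The sweep of a temporal operator makes its row correct, if the rows of the arguments are. -/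
theorem runs_temporal_rowOk (hs : Ready pt ρ b n s) {fwd : Bool} {st en : Ptr}
    (hst : st = if fwd = true then .blk₁ else .head)
    (hen : en = if fwd = true then .after else .before)
    {χ φ₁ φ₂ : MTL P} {I : TInterval} {c d : ℚ} (hc : 0 ≤ c) (hd : 0 ≤ d)
    (h₁ : idx φ₁ ≠ idx χ) (h₂ : idx φ₂ ≠ idx χ)
    (hor : χ.horizon = I.hiQ + max φ₁.horizon φ₂.horizon) :
    ∃ s', M.Runs a τ (.temporal fwd (pt st) (pt en) (pt .cur) (pt .wit) (pt .obs) (idx χ)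
        (idx φ₁) (idx φ₂) I c d) s (96 * (n + 1 - b) + 5) [] s' ∧ SameExcept pt (idx χ) s s' ∧
      (RowOk idx ρ b n s φ₁ → RowOk idx ρ b n s φ₂ →
        (∀ x, MTL.Sat ρ x χ ↔ OpHolds (ρ.dist fwd) I c d (fun _ => True)
          (fun k => MTL.Sat ρ k φ₁) (fun k => MTL.Sat ρ k φ₂) x) → RowOk idx ρ b n s' χ) := by
  have hends : s.ptr (pt st) = colOf M.cols fwd b n 0 ∧
      s.ptr (pt en) = colOf M.cols fwd b n (n + 1 - b) := by
    subst hst hen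
    cases fwd
    · exact hs.ends.2
    · exact hs.ends.1
  have hne : (st ≠ .cur ∧ st ≠ .wit) ∧ en ≠ .cur ∧ en ≠ .wit ∧ en ≠ .obs := by
    subst hst hen
    cases fwd <;> simp
  obtain ⟨g, x, y, z, hrun, hg⟩ := runs_temporal (a := a) (τ := τ) (st := pt st) (en := pt en)
    (A := pt .cur) (F := pt .wit) (R := pt .obs) ρ hs.lt_cols (by simp) (by simp) (by simp)
    (by simpa using hne.2.1.symm) (by simpa using hne.2.2.1.symm) (by simpa using hne.2.2.2.symm)
    (by simpa using hne.1.1.symm) (by simpa using hne.1.2.symm) hends.1 hends.2 hs.time h₁ h₂ I c d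
  refine ⟨_, hrun, SameExcept.upd, fun ok₁ ok₂ hsat x hb hn hm => ?_⟩
  rw [hor] at hm
  rw [hsat, show (s.upd (pt .cur) (pt .wit) (pt .obs) (idx χ) g _ y z).table (idx χ) = g from
    Function.update_self .., hg x hb hn]
  exact TimedWord.opHolds_window_iff hc hd
    (le_max_of_le_left φ₁.horizon_nonneg)
    (fun x hb hn hm => ok₁ x hb hn (hm.mono (le_max_left _ _)))
    (fun x hb hn hm => ok₂ x hb hn (hm.mono (le_max_right _ _))) hb hn hm

theorem runs_pointwise_rowOk (hs : Ready pt ρ b n s) {χ : MTL P} {t : Test P M.rows M.ptrs}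
    {val : ℕ → Prop} (hsz : t.size ≤ 3)
    (hval : ∀ g x y z, b ≤ x → x ≤ n → (t.Holds a
      (s.upd (pt .cur) (pt .wit) (pt .obs) (idx χ) g (Fin.ofNat M.cols x) y z) ↔ val x)) :
    ∃ s', M.Runs a τ (.pointwise (pt .blk₁) (pt .after) (pt .cur) (pt .wit) (pt .obs) (idx χ) t) s
        (96 * (n + 1 - b) + 5) [] s' ∧ SameExcept pt (idx χ) s s' ∧
      ((∀ x, b ≤ x → x ≤ n → ρ.Margin b n χ.horizon x → (val x ↔ MTL.Sat ρ x χ)) →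
        RowOk idx ρ b n s' χ) := by
  obtain ⟨g, x, y, z, hrun, hg⟩ := runs_pointwise (M := M) (a := a) (τ := τ) (r := idx χ)
    (A := pt .cur) (F := pt .wit) (R := pt .obs) hs.lt_cols
    (by simp) (by simp) (by simp) (by simp) (by simp) (by simp) (by simp) (by simp)
    hs.ends.1.1 hs.ends.1.2 hval
  refine ⟨_, hrun.mono ?_, SameExcept.upd, fun h x hb hn hm => ?_⟩
  · have := Nat.mul_le_mul_right (3 * (n + 1 - b)) (show t.size + 14 ≤ 17 by omega)
    omega
  · rw [← h x hb hn hm, ← hg x hb hn]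
    simp [Mem.upd]

/-- The command for `χ` makes the row of `χ` correct, if the rows of the proper subformulas are;
for an atomic formula it does nothing. -/
theorem runs_eval (hs : Ready pt ρ b n s) (χ : MTL P)
    (hidx : ∀ χ' ∈ χ.subformulas, idx χ' = idx χ → χ' = χ) :
    ∃ s', M.Runs a τ (.eval pt idx χ) s (96 * (n + 1 - b) + 5) [] s' ∧
      SameExcept pt (idx χ) s s' ∧
      ((χ.depth = 0 → RowOk idx ρ b n s χ) → χ.Bounded →
        (∀ χ' ∈ χ.subformulas, χ' ≠ χ → χ'.Bounded → RowOk idx ρ b n s χ') →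
          RowOk idx ρ b n s' χ) := by
  have hne : ∀ χ' ∈ χ.subformulas, χ'.depth < χ.depth → idx χ' ≠ idx χ := by
    intro χ' h hd he
    rw [hidx χ' h he] at hd
    exact lt_irrefl _ hd
  have hok : (∀ χ' ∈ χ.subformulas, χ' ≠ χ → χ'.Bounded → RowOk idx ρ b n s χ') →
      ∀ χ' ∈ χ.subformulas, χ'.depth < χ.depth → χ'.Bounded → RowOk idx ρ b n s χ' := by
    intro h χ' h' hd hb
    exact h χ' h' (by rintro rfl; exact lt_irrefl _ hd) hb
  cases χ with
  | tru | atom =>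
    exact ⟨s, (Exec.skip s).runs.mono (by omega), SameExcept.refl _, fun h _ _ => h rfl⟩
  | neg φ =>
    have m₁ : φ ∈ (MTL.neg φ).subformulas := by simp [MTL.subformulas, MTL.self_mem_subformulas]
    have d₁ : φ.depth < (MTL.neg φ).depth := Nat.lt_succ_self _
    have n₁ := hne φ m₁ d₁
    obtain ⟨s', hrun, hsame, h⟩ := runs_pointwise_rowOk (a := a) (τ := τ) (idx := idx) hs
      (χ := .neg φ) (t := .no (.cell (idx φ) (pt .cur)))
      (val := fun x => ¬ s.table (idx φ) (Fin.ofNat M.cols x) = true) (by simp [Test.size])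
      (fun g x y z _ _ => by simp [Test.Holds, Mem.upd, n₁])
    refine ⟨s', hrun, hsame, fun _ hB hsub => h fun x hb hn hm => ?_⟩
    exact not_congr (hok hsub φ m₁ d₁ hB x hb hn hm)
  | conj φ₁ φ₂ =>
    have m₁ : φ₁ ∈ (MTL.conj φ₁ φ₂).subformulas := by
      simp [MTL.subformulas, MTL.self_mem_subformulas]
    have m₂ : φ₂ ∈ (MTL.conj φ₁ φ₂).subformulas := by
      simp [MTL.subformulas, MTL.self_mem_subformulas]
    have d₁ : φ₁.depth < (MTL.conj φ₁ φ₂).depth := Nat.lt_succ_of_le (le_max_left _ _)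
    have d₂ : φ₂.depth < (MTL.conj φ₁ φ₂).depth := Nat.lt_succ_of_le (le_max_right _ _)
    have n₁ := hne φ₁ m₁ d₁
    have n₂ := hne φ₂ m₂ d₂
    obtain ⟨s', hrun, hsame, h⟩ := runs_pointwise_rowOk (a := a) (τ := τ) (idx := idx) hs
      (χ := .conj φ₁ φ₂) (t := .both (.cell (idx φ₁) (pt .cur)) (.cell (idx φ₂) (pt .cur)))
      (val := fun x => s.table (idx φ₁) (Fin.ofNat M.cols x) = true ∧
        s.table (idx φ₂) (Fin.ofNat M.cols x) = true) (by simp [Test.size])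
      (fun g x y z _ _ => by simp [Test.Holds, Mem.upd, n₁, n₂])
    refine ⟨s', hrun, hsame, fun _ hB hsub => h fun x hb hn hm => ?_⟩
    exact and_congr (hok hsub φ₁ m₁ d₁ hB.1 x hb hn (hm.mono (le_max_left _ _)))
      (hok hsub φ₂ m₂ d₂ hB.2 x hb hn (hm.mono (le_max_right _ _)))
  | untl I φ₁ φ₂ =>
    have m₁ : φ₁ ∈ (MTL.untl I φ₁ φ₂).subformulas := by
      simp [MTL.subformulas, MTL.self_mem_subformulas]
    have m₂ : φ₂ ∈ (MTL.untl I φ₁ φ₂).subformulas := by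
      simp [MTL.subformulas, MTL.self_mem_subformulas]
    have d₁ : φ₁.depth < (MTL.untl I φ₁ φ₂).depth := Nat.lt_succ_of_le (le_max_left _ _)
    have d₂ : φ₂.depth < (MTL.untl I φ₁ φ₂).depth := Nat.lt_succ_of_le (le_max_right _ _)
    obtain ⟨s', hrun, hsame, h⟩ := runs_temporal_rowOk (a := a) (τ := τ) hs (fwd := true)
      (I := I) rfl rfl le_rfl le_rfl (hne φ₁ m₁ d₁) (hne φ₂ m₂ d₂) rfl
    exact ⟨s', hrun, hsame, fun _ hB hsub => h (hok hsub φ₁ m₁ d₁ hB.2.1)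
      (hok hsub φ₂ m₂ d₂ hB.2.2) fun x => MTL.sat_untl_iff ρ x hB.1 φ₁ φ₂⟩
  | snce I φ₁ φ₂ =>
    have m₁ : φ₁ ∈ (MTL.snce I φ₁ φ₂).subformulas := by
      simp [MTL.subformulas, MTL.self_mem_subformulas]
    have m₂ : φ₂ ∈ (MTL.snce I φ₁ φ₂).subformulas := by
      simp [MTL.subformulas, MTL.self_mem_subformulas]
    have d₁ : φ₁.depth < (MTL.snce I φ₁ φ₂).depth := Nat.lt_succ_of_le (le_max_left _ _)
    have d₂ : φ₂.depth < (MTL.snce I φ₁ φ₂).depth := Nat.lt_succ_of_le (le_max_right _ _)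
    obtain ⟨s', hrun, hsame, h⟩ := runs_temporal_rowOk (a := a) (τ := τ) hs (fwd := false)
      (I := I) rfl rfl le_rfl le_rfl (hne φ₁ m₁ d₁) (hne φ₂ m₂ d₂) rfl
    exact ⟨s', hrun, hsame, fun _ hB hsub => h (hok hsub φ₁ m₁ d₁ hB.2.1)
      (hok hsub φ₂ m₂ d₂ hB.2.2) fun x => MTL.sat_snce_iff ρ x hB.1 φ₁ φ₂⟩
  | guntl I c hc hcI φ₁ φ₂ =>
    have m₁ : φ₁ ∈ (MTL.guntl I c hc hcI φ₁ φ₂).subformulas := by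
      simp [MTL.subformulas, MTL.self_mem_subformulas]
    have m₂ : φ₂ ∈ (MTL.guntl I c hc hcI φ₁ φ₂).subformulas := by
      simp [MTL.subformulas, MTL.self_mem_subformulas]
    have d₁ : φ₁.depth < (MTL.guntl I c hc hcI φ₁ φ₂).depth := Nat.lt_succ_of_le (le_max_left _ _)
    have d₂ : φ₂.depth < (MTL.guntl I c hc hcI φ₁ φ₂).depth := Nat.lt_succ_of_le (le_max_right _ _)
    obtain ⟨s', hrun, hsame, h⟩ := runs_temporal_rowOk (a := a) (τ := τ) hs (fwd := true)
      (I := I) rfl rfl hc (sub_nonneg.2 hcI) (hne φ₁ m₁ d₁) (hne φ₂ m₂ d₂) rfl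
    exact ⟨s', hrun, hsame, fun _ hB hsub => h (hok hsub φ₁ m₁ d₁ hB.2.1)
      (hok hsub φ₂ m₂ d₂ hB.2.2) fun x => MTL.sat_guntl_iff ρ x hB.1 φ₁ φ₂ hc hcI⟩
  | gsnce I c hc hcI φ₁ φ₂ =>
    have m₁ : φ₁ ∈ (MTL.gsnce I c hc hcI φ₁ φ₂).subformulas := by
      simp [MTL.subformulas, MTL.self_mem_subformulas]
    have m₂ : φ₂ ∈ (MTL.gsnce I c hc hcI φ₁ φ₂).subformulas := by
      simp [MTL.subformulas, MTL.self_mem_subformulas]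
    have d₁ : φ₁.depth < (MTL.gsnce I c hc hcI φ₁ φ₂).depth := Nat.lt_succ_of_le (le_max_left _ _)
    have d₂ : φ₂.depth < (MTL.gsnce I c hc hcI φ₁ φ₂).depth := Nat.lt_succ_of_le (le_max_right _ _)
    obtain ⟨s', hrun, hsame, h⟩ := runs_temporal_rowOk (a := a) (τ := τ) hs (fwd := false)
      (I := I) rfl rfl hc (sub_nonneg.2 hcI) (hne φ₁ m₁ d₁) (hne φ₂ m₂ d₂) rfl
    exact ⟨s', hrun, hsame, fun _ hB hsub => h (hok hsub φ₁ m₁ d₁ hB.2.1)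
      (hok hsub φ₂ m₂ d₂ hB.2.2) fun x => MTL.sat_gsnce_iff ρ x hB.1 φ₁ φ₂ hc hcI⟩

/-- If the formulas are listed by increasing depth, then all their rows become correct. -/
theorem runs_forEach_eval {S : Set (MTL P)} (hidx : Set.InjOn idx S)
    (hS : ∀ χ ∈ S, ∀ χ' ∈ χ.subformulas, χ' ∈ S) {D : Set (MTL P)} (hDS : D ⊆ S)
    (l : List (MTL P)) (hlS : ∀ χ ∈ l, χ ∈ S) (hl : l.Pairwise fun χ χ' => χ.depth ≤ χ'.depth)
    (hsub : ∀ χ ∈ l, ∀ χ' ∈ χ.subformulas, χ' ∈ D ∨ χ' ∈ l) (hleaf : ∀ χ ∈ l, χ.depth = 0 → χ ∈ D)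
    (hs : Ready pt ρ b n s) (hD : ∀ χ ∈ D, χ.Bounded → RowOk idx ρ b n s χ) :
    ∃ s', M.Runs a τ (.forEach (.eval pt idx) l) s ((96 * (n + 1 - b) + 5) * l.length + 1) [] s' ∧
      s'.time = s.time ∧
      (∀ p, p ≠ .cur → p ≠ .wit → p ≠ .obs → s'.ptr (pt p) = s.ptr (pt p)) ∧
      (∀ r, (∀ χ ∈ l, idx χ ≠ r) → s'.table r = s.table r) ∧
      ∀ χ, χ ∈ D ∨ χ ∈ l → χ.Bounded → RowOk idx ρ b n s' χ := by
  induction l generalizing s D with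
  | nil =>
    exact ⟨s, (Exec.skip s).runs.mono (by simp), rfl, fun _ _ _ _ => rfl, fun _ _ => rfl,
      fun χ h => hD χ (by simpa using h)⟩
  | cons χ l ih =>
    have hχS : χ ∈ S := hlS χ (by simp)
    obtain ⟨s₁, hrun₁, hsame, hok⟩ := runs_eval (a := a) (τ := τ) (idx := idx) hs χ
      fun χ' h he => hidx (hS χ hχS χ' h) hχS he
    have hproper : ∀ χ' ∈ χ.subformulas, χ' ≠ χ → χ' ∈ D := by
      intro χ' h hne
      rcases hsub χ (by simp) χ' h with h' | h'
      · exact h'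
      · have h' : χ' ∈ l := by simpa [hne] using h'
        have := (List.pairwise_cons.1 hl).1 χ' h'
        have := MTL.depth_lt_of_mem_subformulas h hne
        omega
    have hD₁ : ∀ χ' ∈ insert χ D, χ'.Bounded → RowOk idx ρ b n s₁ χ' := by
      intro χ' h hB
      by_cases he : χ' = χ
      · subst he
        exact hok (fun h0 => hD _ (hleaf _ (by simp) h0) hB) hB fun χ'' h'' hne =>
          hD χ'' (hproper χ'' h'' hne)
      · have hmem : χ' ∈ D := by simpa [he] using h
        have hrow := hsame.table (idx χ') fun h => he (hidx (hDS hmem) hχS h)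
        intro x hb hn hm
        rw [hrow]
        exact hD χ' hmem hB x hb hn hm
    obtain ⟨s₂, hrun₂, ht, hp, htab, hok₂⟩ := ih (D := insert χ D)
      (Set.insert_subset hχS hDS) (fun χ' h => hlS χ' (by simp [h])) (List.pairwise_cons.1 hl).2
      (fun χ' h χ'' h'' => by
        rcases hsub χ' (by simp [h]) χ'' h'' with h | h
        · exact Or.inl (Or.inr h)
        · rcases List.mem_cons.1 h with h | h
          · exact Or.inl (Or.inl h)
          · exact Or.inr h)
      (fun χ' h h0 => Or.inr (hleaf χ' (by simp [h]) h0)) (hs.of_sameExcept hsame) hD₁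
    refine ⟨s₂, (hrun₁.seq hrun₂).mono ?_, ht.trans hsame.time, fun p h₁ h₂ h₃ =>
      (hp p h₁ h₂ h₃).trans (hsame.ptr p h₁ h₂ h₃), fun r hr => ?_, fun χ' h => hok₂ χ' ?_⟩
    · rw [List.length_cons, mul_add]; omega
    · rw [htab r fun χ' h => hr χ' (by simp [h]), hsame.table r (hr χ (by simp)).symm]
    · rcases h with h | h
      · exact Or.inl (Or.inr h)
      · rcases List.mem_cons.1 h with h | h
        · exact Or.inl (Or.inl h)
        · exact Or.inr h

end Monitor

namespace Monitor

variable {P : Type u} {m : ℕ} {M : Monitor P m} {a : Set P} {τ : ℚ} {pt : Ptr ↪ Fin M.ptrs}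
  {idx : MTL P → Fin M.rows} {ρ : TimedWord P} {b n : ℕ} {s s' : Mem M.cols M.rows M.ptrs}

theorem runs_forEach_arrive {S : Set (MTL P)} (hidx : Set.InjOn idx S) {D : Set (MTL P)}
    (hDS : D ⊆ S) (l : List (MTL P)) (hlS : ∀ χ ∈ l, χ ∈ S)
    (hD : ∀ χ ∈ D, χ.depth = 0 →
      (s.table (idx χ) (s.ptr (pt .head)) = true ↔ MTL.Sat ρ n χ)) :
    ∃ s', M.Runs (ρ.label n) τ (.forEach (.arrive pt idx) l) s (2 * l.length + 1) [] s' ∧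
      s'.time = s.time ∧ s'.ptr = s.ptr ∧
      (∀ r q, q ≠ s.ptr (pt .head) → s'.table r q = s.table r q) ∧
      ∀ χ, χ ∈ D ∨ χ ∈ l → χ.depth = 0 →
        (s'.table (idx χ) (s.ptr (pt .head)) = true ↔ MTL.Sat ρ n χ) := by
  induction l generalizing s D with
  | nil =>
    exact ⟨s, (Exec.skip s).runs, rfl, rfl, fun _ _ _ => rfl, fun χ h => hD χ (by simpa using h)⟩
  | cons χ l ih =>
    have hχS : χ ∈ S := hlS χ (by simp)
    obtain ⟨s₁, hrun₁, ht₁, hp₁, htab₁, hrow₁, hok₁⟩ : ∃ s₁,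
        M.Runs (ρ.label n) τ (.arrive pt idx χ) s 2 [] s₁ ∧ s₁.time = s.time ∧ s₁.ptr = s.ptr ∧
        (∀ r q, q ≠ s.ptr (pt .head) → s₁.table r q = s.table r q) ∧
        (∀ r, r ≠ idx χ → s₁.table r = s.table r) ∧
        (χ.depth = 0 → (s₁.table (idx χ) (s.ptr (pt .head)) = true ↔ MTL.Sat ρ n χ)) := by
      have hw : ∀ β, ∃ s₁, M.Runs (ρ.label n) τ (.write (idx χ) (pt .head) β) s 1 [] s₁ ∧
          s₁.time = s.time ∧ s₁.ptr = s.ptr ∧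
          (∀ r q, q ≠ s.ptr (pt .head) → s₁.table r q = s.table r q) ∧
          (∀ r, r ≠ idx χ → s₁.table r = s.table r) ∧
          s₁.table (idx χ) (s.ptr (pt .head)) = β := by
        intro β
        refine ⟨_, (Exec.write s (idx χ) (pt .head) β).runs, rfl, rfl, fun r q hq => ?_,
          fun r hr => by simp [hr], by simp⟩
        by_cases hr : r = idx χ
        · subst hr; simp [hq]
        · simp [hr]
      cases χ with
      | tru =>
        obtain ⟨s₁, h, ht, hp, htab, hrow, hv⟩ := hw true
        exact ⟨s₁, h.mono (by omega), ht, hp, htab, hrow, fun _ => by simp [hv, MTL.Sat]⟩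
      | atom p =>
        by_cases hpa : p ∈ ρ.label n
        · obtain ⟨s₁, h, ht, hp, htab, hrow, hv⟩ := hw true
          exact ⟨s₁, Runs.condTrue (b := .current p) hpa h, ht, hp, htab, hrow,
            fun _ => by simp [hv, MTL.Sat, hpa]⟩
        · obtain ⟨s₁, h, ht, hp, htab, hrow, hv⟩ := hw false
          exact ⟨s₁, Runs.condFalse (b := .current p) hpa h, ht, hp, htab, hrow,
            fun _ => by simp [hv, MTL.Sat, hpa]⟩
      | _ => exact ⟨s, (Exec.skip s).runs.mono (by omega), rfl, rfl, fun _ _ _ => rfl,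
          fun _ _ => rfl, fun h => by simp [MTL.depth] at h⟩
    obtain ⟨s₂, hrun₂, ht₂, hp₂, htab₂, hok₂⟩ := ih (s := s₁) (D := insert χ D)
      (Set.insert_subset hχS hDS) (fun χ' h => hlS χ' (by simp [h])) (by
        intro χ' h h0
        rw [hp₁]
        by_cases he : χ' = χ
        · subst he; exact hok₁ h0
        · have hmem : χ' ∈ D := by simpa [he] using h
          rw [hrow₁ _ fun h => he (hidx (hDS hmem) hχS h)]
          exact hD χ' hmem h0)
    rw [hp₁] at htab₂ hok₂
    refine ⟨s₂, (hrun₁.seq hrun₂).mono ?_, ht₂.trans ht₁, hp₂.trans hp₁, fun r q hq =>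
      (htab₂ r q hq).trans (htab₁ r q hq), fun χ' h => hok₂ χ' ?_⟩
    · rw [List.length_cons]; omega
    · rcases h with h | h
      · exact Or.inl (Or.inr h)
      · rcases List.mem_cons.1 h with h | h
        · exact Or.inl (Or.inl h)
        · exact Or.inr h

/-- The letter that is read from the column of position `x`. -/
def letter (s : Mem M.cols M.rows M.ptrs) (x : ℕ) : Fin m → Bool :=
  fun i => s.table (M.row i) (Fin.ofNat M.cols x)

theorem runs_emitBlock {p q : ℕ} (hpq : p ≤ q) (hlt : q < p + M.cols)
    (hp : s.ptr (pt .blk₂) = Fin.ofNat M.cols p) (hq : s.ptr (pt .blk₃) = Fin.ofNat M.cols q) :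
    M.Runs a τ (.emitBlock pt) s (4 * (q - p) + 3) ((List.range' p (q - p)).map (letter s))
      { s with ptr := Function.update s.ptr (pt .cur) (Fin.ofNat M.cols q) } := by
  have hloop : ∀ d p, p + d = q → d < M.cols →
      M.Runs a τ (.loop (.no (.same (pt .cur) (pt .blk₃))) (.seq (.emit (pt .cur)) (.next (pt .cur))))
        { s with ptr := Function.update s.ptr (pt .cur) (Fin.ofNat M.cols p) } (4 * d + 2)
        ((List.range' p d).map (letter s))
        { s with ptr := Function.update s.ptr (pt .cur) (Fin.ofNat M.cols q) } := by
    intro d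
    induction d with
    | zero =>
      intro p hpq _
      obtain rfl : p = q := by omega
      refine (Exec.loopFalse ?_).runs
      simp [Test.Holds, hq]
    | succ d ih =>
      intro p hpq hd
      have h₁ := (Exec.emit (M := M) (a := a) (τ := τ)
        { s with ptr := Function.update s.ptr (pt .cur) (Fin.ofNat M.cols p) } (pt .cur)).runs
      have h₂ := (Exec.next (M := M) (a := a) (τ := τ)
        { s with ptr := Function.update s.ptr (pt .cur) (Fin.ofNat M.cols p) } (pt .cur)).runs
      simp only [Function.update_self, Function.update_idem, ← finOfNat_succ] at h₁ h₂
      refine (Runs.loopTrue ?_ (h₁.seq h₂) (ih (p + 1) (by omega) (by omega))).mono ?_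
      · have : Fin.ofNat M.cols p ≠ Fin.ofNat M.cols q := fun h => by
          have := eq_of_finOfNat_eq h (by omega) (by omega)
          omega
        simp only [Test.Holds, Function.update_self]
        rw [Function.update_of_ne (by simp), hq]
        exact this
      · simp only [Test.size]; omega
  have h := (Exec.copy (M := M) (a := a) (τ := τ) s (pt .cur) (pt .blk₂)).runs
  rw [hp] at h
  exact (h.seq (hloop (q - p) p (by omega) (by omega))).mono (by omega)

/-- Specification of the evaluation of a window. -/
theorem runs_batch {S : Set (MTL P)} (hidx : Set.InjOn idx S)
    (hS : ∀ χ ∈ S, ∀ χ' ∈ χ.subformulas, χ' ∈ S) (l : List (MTL P)) (hl : ∀ χ, χ ∈ l ↔ χ ∈ S)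
    (hsort : l.Pairwise fun χ χ' => χ.depth ≤ χ'.depth) {p₁ p₂ p₃ : ℕ} (h₁₂ : p₁ ≤ p₂)
    (h₂₃ : p₂ ≤ p₃) (h₃ : p₃ ≤ n) (hcols : n + 1 - p₁ < M.cols)
    (htime : ∀ x, p₁ ≤ x → x ≤ n → s.time (Fin.ofNat M.cols x) = ρ.time x)
    (hhead : s.ptr (pt .head) = Fin.ofNat M.cols n) (hb₁ : s.ptr (pt .blk₁) = Fin.ofNat M.cols p₁)
    (hb₂ : s.ptr (pt .blk₂) = Fin.ofNat M.cols p₂) (hb₃ : s.ptr (pt .blk₃) = Fin.ofNat M.cols p₃)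
    (hleaf : ∀ χ ∈ S, χ.depth = 0 → ∀ x, p₁ ≤ x → x ≤ n →
      (s.table (idx χ) (Fin.ofNat M.cols x) = true ↔ MTL.Sat ρ x χ)) :
    ∃ s₁ s', M.Runs a τ (.batch pt idx l) s
        ((96 * (n + 1 - p₁) + 5) * l.length + 4 * (p₃ - p₂) + 11)
        ((List.range' p₂ (p₃ - p₂)).map (letter s₁)) s' ∧
      (∀ χ ∈ S, χ.Bounded → RowOk idx ρ p₁ n s₁ χ) ∧
      s'.table = s₁.table ∧ s'.time = s.time ∧ s'.ptr (pt .head) = Fin.ofNat M.cols n ∧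
      s'.ptr (pt .blk₁) = Fin.ofNat M.cols p₂ ∧ s'.ptr (pt .blk₂) = Fin.ofNat M.cols p₃ ∧
      s'.ptr (pt .blk₃) = Fin.ofNat M.cols n := by
  have h₁ := (Exec.copy (M := M) (a := a) (τ := τ) s (pt .after) (pt .head)).runs
  have h₂ := (Exec.next (M := M) (a := a) (τ := τ)
    { s with ptr := Function.update s.ptr (pt .after) (s.ptr (pt .head)) } (pt .after)).runs
  simp only [Function.update_self, Function.update_idem] at h₂
  obtain ⟨s₂, hs₂⟩ : ∃ s₂, s₂ = ({ s with
    ptr := Function.update s.ptr (pt .after) (s.ptr (pt .head) + 1) } :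
      Mem M.cols M.rows M.ptrs) := ⟨_, rfl⟩
  rw [← hs₂] at h₂
  have h₃ := (Exec.copy (M := M) (a := a) (τ := τ) s₂ (pt .before) (pt .blk₁)).runs
  have h₄ := (Exec.prev (M := M) (a := a) (τ := τ)
    { s₂ with ptr := Function.update s₂.ptr (pt .before) (s₂.ptr (pt .blk₁)) } (pt .before)).runs
  simp only [Function.update_self, Function.update_idem] at h₄
  obtain ⟨s₃, hs₃⟩ : ∃ s₃, s₃ = ({ s₂ with
    ptr := Function.update s₂.ptr (pt .before) (s₂.ptr (pt .blk₁) - 1) } :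
      Mem M.cols M.rows M.ptrs) := ⟨_, rfl⟩
  rw [← hs₃] at h₄
  have ht₃ : s₃.time = s.time := by rw [hs₃, hs₂]
  have htab₃ : s₃.table = s.table := by rw [hs₃, hs₂]
  have hp₃ : ∀ p, p ≠ .after → p ≠ .before → s₃.ptr (pt p) = s.ptr (pt p) := by
    intro p h h'
    simp [hs₃, hs₂, h, h']
  have hready : Ready pt ρ p₁ n s₃ :=
    { le := by omega
      lt_cols := hcols
      time := by rw [ht₃]; exact htime
      head := by rw [hp₃ _ (by simp) (by simp), hhead]
      blk₁ := by rw [hp₃ _ (by simp) (by simp), hb₁]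
      after := by simp [hs₃, hs₂, hhead]
      before := by simp [hs₃, hs₂, hb₁] }
  obtain ⟨s₁, hrun, ht, hp, -, hok⟩ := runs_forEach_eval (a := a) (τ := τ) hidx hS
    (D := {χ | χ ∈ S ∧ χ.depth = 0}) (fun χ h => h.1) l (fun χ h => (hl χ).1 h) hsort
    (fun χ h χ' h' => Or.inr ((hl χ').2 (hS χ ((hl χ).1 h) χ' h')))
    (fun χ h h0 => ⟨(hl χ).1 h, h0⟩) hready (by
      rintro χ ⟨hχ, h0⟩ - x hb hn -
      rw [htab₃]
      exact hleaf χ hχ h0 x hb hn)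
  have hptr : ∀ p, p ≠ .cur → p ≠ .wit → p ≠ .obs → p ≠ .after → p ≠ .before →
      s₁.ptr (pt p) = s.ptr (pt p) := fun p h₁ h₂ h₃ h₄ h₅ =>
    (hp p h₁ h₂ h₃).trans (hp₃ p h₄ h₅)
  have hq₁ := (hptr .blk₁ (by simp) (by simp) (by simp) (by simp) (by simp)).trans hb₁
  have hq₂ := (hptr .blk₂ (by simp) (by simp) (by simp) (by simp) (by simp)).trans hb₂
  have hq₃ := (hptr .blk₃ (by simp) (by simp) (by simp) (by simp) (by simp)).trans hb₃
  have hq₄ := (hptr .head (by simp) (by simp) (by simp) (by simp) (by simp)).trans hhead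
  have hemit := runs_emitBlock (a := a) (τ := τ) (s := s₁) h₂₃ (by omega) hq₂ hq₃
  obtain ⟨s₄, hs₄⟩ : ∃ s₄, s₄ = ({ s₁ with
    ptr := Function.update s₁.ptr (pt .cur) (Fin.ofNat M.cols p₃) } :
      Mem M.cols M.rows M.ptrs) := ⟨_, rfl⟩
  rw [← hs₄] at hemit
  have h₅ := (Exec.copy (M := M) (a := a) (τ := τ) s₄ (pt .blk₁) (pt .blk₂)).runs
  obtain ⟨s₅, hs₅⟩ : ∃ s₅, s₅ = ({ s₄ with
    ptr := Function.update s₄.ptr (pt .blk₁) (s₄.ptr (pt .blk₂)) } :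
      Mem M.cols M.rows M.ptrs) := ⟨_, rfl⟩
  rw [← hs₅] at h₅
  have h₆ := (Exec.copy (M := M) (a := a) (τ := τ) s₅ (pt .blk₂) (pt .blk₃)).runs
  obtain ⟨s₆, hs₆⟩ : ∃ s₆, s₆ = ({ s₅ with
    ptr := Function.update s₅.ptr (pt .blk₂) (s₅.ptr (pt .blk₃)) } :
      Mem M.cols M.rows M.ptrs) := ⟨_, rfl⟩
  rw [← hs₆] at h₆
  have h₇ := (Exec.copy (M := M) (a := a) (τ := τ) s₆ (pt .blk₃) (pt .head)).runs
  have hall := h₁.seq (h₂.seq (h₃.seq (h₄.seq (hrun.seq (hemit.seq (h₅.seq (h₆.seq h₇)))))))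
  simp only [List.nil_append, List.append_nil] at hall
  refine ⟨s₁, _, hall.mono (by omega), fun χ hχ hB => hok χ (Or.inr ((hl χ).2 hχ)) hB,
    ?_, ?_, ?_, ?_, ?_, ?_⟩
  · rw [hs₆, hs₅, hs₄]
  · rw [← ht₃, ← ht, hs₆, hs₅, hs₄]
  · simp [hs₆, hs₅, hs₄, hq₄]
  · simp [hs₆, hs₅, hs₄, hq₂]
  · simp [hs₆, hs₅, hs₄, hq₃]
  · simp [hs₆, hs₅, hs₄, hq₄]

/-! ### Blocks of events, and the run on a trace -/

/-- The first positions of the three blocks after the first `n` events.  A new block starts with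
every event that comes more than `H` after the start of the last block. -/
def blocks (ρ : TimedWord P) (H : ℚ) : ℕ → ℕ × ℕ × ℕ
  | 0 => (0, 0, 0)
  | n + 1 => if H < ρ.time n - ρ.time (blocks ρ H n).2.2 then
      ((blocks ρ H n).2.1, (blocks ρ H n).2.2, n) else blocks ρ H n

/-- The facts about the blocks on which correctness and the space bound rest. -/
structure BlocksOk (ρ : TimedWord P) (H : ℚ) (B n : ℕ) (p : ℕ × ℕ × ℕ) : Prop where
  le₁₂ : p.1 ≤ p.2.1
  le₂₃ : p.2.1 ≤ p.2.2
  le₃ : p.2.2 ≤ n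
  gap₁₂ : p.1 = 0 ∨ ρ.time p.1 + H ≤ ρ.time p.2.1
  gap₂₃ : p.2.1 = 0 ∨ ρ.time p.2.1 + H ≤ ρ.time p.2.2
  size₁₂ : p.2.1 ≤ p.1 + B
  size₂₃ : p.2.2 ≤ p.2.1 + B
  size₃ : n ≤ p.2.2 + B

/-- The bound on the sizes of the blocks comes from the variability of the trace. -/
theorem blocksOk {k l : ℕ} (hρ : ρ.HasVariability k) {H : ℚ} (hH : H ≤ l / 2) (n : ℕ) :
    BlocksOk ρ H (k * l + 1) n (blocks ρ H n) := by
  induction n with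
  | zero => constructor <;> simp [blocks]
  | succ n ih =>
    rw [blocks]
    split_ifs with h
    · exact ⟨ih.le₂₃, ih.le₃, Nat.le_succ n, ih.gap₂₃, Or.inr (by simp only; linarith), ih.size₂₃,
        ih.size₃, by simp only; omega⟩
    · have := hρ.sub_le (p := (blocks ρ H n).2.2) (q := n) (l := l) (by linarith [not_lt.1 h])
      exact ⟨ih.le₁₂, ih.le₂₃, ih.le₃.trans (Nat.le_succ n), ih.gap₁₂, ih.gap₂₃, ih.size₁₂,
        ih.size₂₃, by omega⟩

theorem blocks_le (ρ : TimedWord P) (H : ℚ) (n : ℕ) :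
    (blocks ρ H n).1 ≤ n ∧ (blocks ρ H n).2.1 ≤ n ∧ (blocks ρ H n).2.2 ≤ n := by
  induction n with
  | zero => simp [blocks]
  | succ n ih =>
    rw [blocks]
    split_ifs with h
    · exact ⟨ih.2.1.trans (Nat.le_succ n), ih.2.2.trans (Nat.le_succ n), Nat.le_succ n⟩
    · exact ⟨ih.1.trans (Nat.le_succ n), ih.2.1.trans (Nat.le_succ n), ih.2.2.trans (Nat.le_succ n)⟩

/-- A new block starts again and again, since the timestamps are unbounded. -/
theorem exists_new_block (ρ : TimedWord P) (H : ℚ) (n : ℕ) :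
    ∃ n' ≥ n, H < ρ.time n' - ρ.time (blocks ρ H n').2.2 := by
  by_contra! hcon
  have hconst : ∀ d, blocks ρ H (n + d) = blocks ρ H n := by
    intro d
    induction d with
    | zero => rfl
    | succ d ih =>
      rw [← add_assoc, blocks, if_neg (not_lt.2 (hcon _ (Nat.le_add_right n d))), ih]
  obtain ⟨N, hN⟩ := ρ.unbounded (ρ.time (blocks ρ H n).2.2 + H)
  have h := hcon (n + N) (Nat.le_add_right n N)
  rw [hconst] at h
  have := ρ.strictMono.monotone (Nat.le_add_left N n)
  linarith

theorem exists_lt_blocks (ρ : TimedWord P) (H : ℚ) (j : ℕ) : ∃ n, j < (blocks ρ H n).2.1 := by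
  obtain ⟨n₁, h₁, ht₁⟩ := exists_new_block ρ H (j + 1)
  obtain ⟨n₂, h₂, ht₂⟩ := exists_new_block ρ H (n₁ + 1)
  have hmono : ∀ d, n₁ ≤ (blocks ρ H (n₁ + 1 + d)).2.2 := by
    intro d
    induction d with
    | zero => rw [Nat.add_zero, blocks, if_pos ht₁]
    | succ d ih =>
      rw [← add_assoc, blocks]
      split_ifs
      · exact ih.trans (blocks_le ρ H _).2.2
      · exact ih
  obtain ⟨d, rfl⟩ := Nat.exists_eq_add_of_le h₂
  refine ⟨n₁ + 1 + d + 1, ?_⟩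
  rw [blocks, if_pos ht₂]
  have := hmono d
  simp only
  omega

/-- The invariant of the run, before event `n`: the three blocks are stored, with the rows of the
atomic formulas. -/
structure Inv (pt : Ptr ↪ Fin M.ptrs) (idx : MTL P → Fin M.rows) (ρ : TimedWord P)
    (S : Set (MTL P)) (n : ℕ) (p : ℕ × ℕ × ℕ) (s : Mem M.cols M.rows M.ptrs) : Prop where
  head : s.ptr (pt .head) = Fin.ofNat M.cols n
  blk₁ : s.ptr (pt .blk₁) = Fin.ofNat M.cols p.1
  blk₂ : s.ptr (pt .blk₂) = Fin.ofNat M.cols p.2.1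
  blk₃ : s.ptr (pt .blk₃) = Fin.ofNat M.cols p.2.2
  time : ∀ x, p.1 ≤ x → x < n → s.time (Fin.ofNat M.cols x) = ρ.time x
  leaf : ∀ χ ∈ S, χ.depth = 0 → ∀ x, p.1 ≤ x → x < n →
    (s.table (idx χ) (Fin.ofNat M.cols x) = true ↔ MTL.Sat ρ x χ)

theorem inv_init {S : Set (MTL P)} {H : ℚ} :
    Inv pt idx ρ S 0 (blocks ρ H 0) (Mem.init M.cols M.rows M.ptrs) := by
  constructor
  · rfl
  · rfl
  · rfl
  · rfl
  · intro x _ h; omega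
  · intro χ _ _ x _ h; omega

theorem _root_.MTL.bounded_horizon_of_depth_eq_zero {χ : MTL P} (h : χ.depth = 0) :
    χ.Bounded ∧ χ.horizon = 0 := by
  cases χ with
  | tru | atom => exact ⟨trivial, rfl⟩
  | _ => simp [MTL.depth] at h

/-- The sum of the three block starts.  It measures the work that has been done on windows. -/
def work (p : ℕ × ℕ × ℕ) : ℕ := p.1 + p.2.1 + p.2.2

/-- One event.  The work grows by the length of the window if the window is evaluated, and is
unchanged otherwise; so the time is charged to the growth of the work and to the event. -/
theorem exec_main {S : Set (MTL P)} (hidx : Set.InjOn idx S)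
    (hS : ∀ χ ∈ S, ∀ χ' ∈ χ.subformulas, χ' ∈ S) (l : List (MTL P)) (hl : ∀ χ, χ ∈ l ↔ χ ∈ S)
    (hsort : l.Pairwise fun χ χ' => χ.depth ≤ χ'.depth) (hlen : 0 < l.length) {H : ℚ} {B : ℕ}
    (hB : BlocksOk ρ H B n (blocks ρ H n)) (hcols : 3 * B + 1 < M.cols)
    (hs : Inv pt idx ρ S n (blocks ρ H n) s) :
    ∃ t o s', M.Exec (ρ.label n) (ρ.time n) (.main pt idx H l) s t o s' ∧
      Inv pt idx ρ S (n + 1) (blocks ρ H (n + 1)) s' ∧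
      t + 125 * l.length * work (blocks ρ H n) ≤
        125 * l.length * (work (blocks ρ H (n + 1)) + 1) ∧
      List.Forall₂ (fun α x => ∀ i, ∀ χ ∈ S, χ.Bounded → χ.horizon ≤ H → M.row i = idx χ →
          (α i = true ↔ MTL.Sat ρ x χ)) o
        (List.range' (blocks ρ H n).2.1 ((blocks ρ H (n + 1)).2.1 - (blocks ρ H n).2.1)) := by
  rw [blocks]
  generalize blocks ρ H n = p at hB hs ⊢
  obtain ⟨p₁, p₂, p₃⟩ := p
  obtain ⟨h₁₂, h₂₃, h₃, hg₁, hg₂, hz₁, hz₂, hz₃⟩ := hB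
  obtain ⟨hh, hb₁, hb₂, hb₃, ht, hlf⟩ := hs
  dsimp only at h₁₂ h₂₃ h₃ hg₁ hg₂ hz₁ hz₂ hz₃ hh hb₁ hb₂ hb₃ ht hlf ⊢
  have hcol : ∀ x, p₁ ≤ x → x < n → Fin.ofNat M.cols x ≠ Fin.ofNat M.cols n := by
    intro x hx hxn h
    have := eq_of_finOfNat_eq h (by omega) (by omega)
    omega
  -- the event is stored
  have r₁ := (Exec.store (M := M) (a := ρ.label n) (τ := ρ.time n) s (pt .head)).runs
  rw [hh] at r₁
  obtain ⟨s₁, hs₁⟩ : ∃ s₁, s₁ = ({ s with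
    time := Function.update s.time (Fin.ofNat M.cols n) (ρ.time n) } :
      Mem M.cols M.rows M.ptrs) := ⟨_, rfl⟩
  rw [← hs₁] at r₁
  have hh₁ : s₁.ptr (pt .head) = Fin.ofNat M.cols n := by rw [hs₁]; exact hh
  obtain ⟨s₂, r₂, ht₂, hp₂, htab₂, hok₂⟩ := runs_forEach_arrive (n := n) (ρ := ρ) (s := s₁) (pt := pt)
    (τ := ρ.time n) hidx (D := ∅) (Set.empty_subset S) l (fun χ h => (hl χ).1 h)
    (fun χ h => absurd h (Set.notMem_empty χ))
  rw [hh₁] at htab₂ hok₂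
  have hptr₂ : s₂.ptr = s.ptr := by rw [hp₂, hs₁]
  have htime₂ : ∀ x, p₁ ≤ x → x ≤ n → s₂.time (Fin.ofNat M.cols x) = ρ.time x := by
    intro x hx hxn
    rw [ht₂, hs₁]
    rcases hxn.eq_or_lt with rfl | hlt
    · simp
    · simp only
      rw [Function.update_of_ne (hcol x hx hlt)]
      exact ht x hx hlt
  have hleaf₂ : ∀ χ ∈ S, χ.depth = 0 → ∀ x, p₁ ≤ x → x ≤ n →
      (s₂.table (idx χ) (Fin.ofNat M.cols x) = true ↔ MTL.Sat ρ x χ) := by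
    intro χ hχ h0 x hx hxn
    rcases hxn.eq_or_lt with rfl | hlt
    · exact hok₂ χ (Or.inr ((hl χ).2 hχ)) h0
    · rw [htab₂ _ _ (hcol x hx hlt), hs₁]
      exact hlf χ hχ h0 x hx hlt
  have htest : (Test.no (.timeLe (pt .head) (pt .blk₃) H)).Holds (ρ.label n) s₂ ↔
      H < ρ.time n - ρ.time p₃ := by
    simp only [Test.Holds, hptr₂, hh, hb₃, not_le]
    rw [htime₂ n (by omega) le_rfl, htime₂ p₃ (by omega) h₃]
  have hN : ∀ y, l.length * y ≥ y := fun y => Nat.le_mul_of_pos_left y hlen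
  by_cases htrig : H < ρ.time n - ρ.time p₃
  · -- the window is evaluated
    obtain ⟨s₃, s₄, r₃, hrow, htab₄, ht₄, hh₄, hc₁, hc₂, hc₃⟩ := runs_batch (a := ρ.label n)
      (τ := ρ.time n) (s := s₂) (pt := pt) hidx hS l hl hsort h₁₂ h₂₃ h₃ (by omega) htime₂
      (by rw [hptr₂, hh]) (by rw [hptr₂, hb₁]) (by rw [hptr₂, hb₂]) (by rw [hptr₂, hb₃]) hleaf₂
    have r₄ := (Exec.next (M := M) (a := ρ.label n) (τ := ρ.time n) s₄ (pt .head)).runs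
    rw [hh₄, ← finOfNat_succ] at r₄
    obtain ⟨t, htT, hexec⟩ := r₁.seq (r₂.seq ((Runs.condTrue (c₂ := .skip) (htest.2 htrig) r₃).seq r₄))
    simp only [List.nil_append, List.append_nil] at hexec
    rw [if_pos htrig]
    refine ⟨t, _, _, hexec, ?_, ?_, ?_⟩
    · refine ⟨by simp, by simpa using hc₁, by simpa using hc₂, by simpa using hc₃, ?_, ?_⟩
      · intro x hx hxn
        simp only at hx ⊢
        rw [ht₄]
        exact htime₂ x (by omega) (by omega)
      · intro χ hχ h0 x hx hxn
        simp only at hx ⊢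
        obtain ⟨hbd, hor⟩ := MTL.bounded_horizon_of_depth_eq_zero h0
        rw [htab₄]
        -- an atomic formula has horizon `0`, so its row is correct on the whole window
        refine hrow χ hχ hbd x (by omega) (by omega) ⟨Or.inr ?_, ?_⟩
        · rw [hor, add_zero]; exact ρ.strictMono.monotone (by omega)
        · rw [hor, add_zero]; exact ρ.strictMono.monotone (by omega)
    · obtain ⟨d, rfl⟩ : ∃ d, n = p₁ + d := Nat.exists_eq_add_of_le (by omega)
      have e : 125 * l.length * (work (p₂, p₃, p₁ + d) + 1) =
          125 * l.length * work (p₁, p₂, p₃) + 125 * (l.length * (d + 1)) := by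
        simp only [work]; ring
      rw [e]
      have e₂ : p₁ + d + 1 - p₁ = d + 1 := by omega
      have e₃ : (96 * (d + 1) + 5) * l.length = 96 * (l.length * (d + 1)) + 5 * l.length := by ring
      have e₄ := hN (d + 1)
      have e₅ : l.length * (d + 1) = l.length * d + l.length := by ring
      rw [e₂, e₃] at htT
      simp only [Test.size] at htT
      omega
    · rw [List.forall₂_map_left_iff]
      simp only
      rw [List.forall₂_same]
      intro x hx i χ hχ hbd hor hrowi
      rw [List.mem_range'_1] at hx
      simp only [letter, hrowi]
      have hpx := ρ.strictMono.monotone hx.1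
      refine hrow χ hχ hbd x (by omega) (by omega) ⟨hg₁.imp id fun h => by linarith, ?_⟩
      have := ρ.strictMono.monotone (show x ≤ p₃ by omega)
      linarith
  · -- the last block goes on
    have r₄ := (Exec.next (M := M) (a := ρ.label n) (τ := ρ.time n) s₂ (pt .head)).runs
    rw [hptr₂, hh, ← finOfNat_succ] at r₄
    obtain ⟨t, htT, hexec⟩ := r₁.seq (r₂.seq ((Runs.condFalse (c₁ := .batch pt idx l)
      (fun h => htrig (htest.1 h)) (Exec.skip s₂).runs).seq r₄))
    simp only [List.nil_append] at hexec
    rw [if_neg htrig]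
    refine ⟨t, _, _, hexec, ?_, ?_, ?_⟩
    · refine ⟨by simp, by simpa using hb₁, by simpa using hb₂, by simpa using hb₃, ?_, ?_⟩
      · intro x hx hxn
        exact htime₂ x hx (by omega)
      · intro χ hχ h0 x hx hxn
        exact hleaf₂ χ hχ h0 x hx (by omega)
    · simp only [Test.size] at htT
      rw [mul_add]
      omega
    · simp

/-- The run of the program on a trace.  Since no block start exceeds `n`, the work done on the first
`n` events is at most `3 * n`. -/
theorem exists_run {S : Set (MTL P)} (hidx : Set.InjOn idx S)
    (hS : ∀ χ ∈ S, ∀ χ' ∈ χ.subformulas, χ' ∈ S) (l : List (MTL P)) (hl : ∀ χ, χ ∈ l ↔ χ ∈ S)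
    (hsort : l.Pairwise fun χ χ' => χ.depth ≤ χ'.depth) (hlen : 0 < l.length) {H : ℚ} {B : ℕ}
    (hB : ∀ n, BlocksOk ρ H B n (blocks ρ H n)) (hcols : 3 * B + 1 < M.cols)
    (hbody : M.body = .main pt idx H l) :
    ∃ r : M.Run ρ, (∀ n, r.totalCost n ≤ 500 * l.length * n) ∧
      ∀ n, List.Forall₂ (fun α x => ∀ i, ∀ χ ∈ S, χ.Bounded → χ.horizon ≤ H → M.row i = idx χ →
          (α i = true ↔ MTL.Sat ρ x χ)) (r.word n) (List.range (blocks ρ H n).2.1) := by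
  choose! t o f hexec hinv hcost hout using fun n (s : Mem M.cols M.rows M.ptrs)
    (hs : Inv pt idx ρ S n (blocks ρ H n) s) => exec_main hidx hS l hl hsort hlen (hB n) hcols hs
  let mem : ℕ → Mem M.cols M.rows M.ptrs := fun n => Nat.rec (Mem.init M.cols M.rows M.ptrs) f n
  have hmem : ∀ n, Inv pt idx ρ S n (blocks ρ H n) (mem n) := by
    intro n
    induction n with
    | zero => exact inv_init
    | succ n ih => exact hinv n _ ih
  let r : M.Run ρ :=
    { mem := mem
      cost := fun n => t n (mem n)
      out := fun n => o n (mem n)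
      mem_zero := rfl
      step := fun n => by rw [hbody]; exact hexec n _ (hmem n) }
  refine ⟨r, fun n => ?_, fun n => ?_⟩
  · have h : r.totalCost n ≤ 125 * l.length * (work (blocks ρ H n) + n) := by
      induction n with
      | zero => simp [Run.totalCost]
      | succ n ih =>
        have h₁ : r.totalCost (n + 1) = r.totalCost n + t n (mem n) := Finset.sum_range_succ ..
        have h₂ := hcost n _ (hmem n)
        rw [h₁]
        rw [mul_add] at ih h₂ ⊢
        rw [mul_add _ n 1]
        omega
    refine h.trans ?_
    obtain ⟨b₁, b₂, b₃⟩ := blocks_le ρ H n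
    calc 125 * l.length * (work (blocks ρ H n) + n) ≤ 125 * l.length * (4 * n) :=
          Nat.mul_le_mul_left _ (by simp only [work]; omega)
      _ = 500 * l.length * n := by ring
  · induction n with
    | zero => simp [Run.word, blocks]
    | succ n ih =>
      have h₁ : r.word (n + 1) = r.word n ++ o n (mem n) := by
        simp [Run.word, List.range_succ, r]
      have hle : (blocks ρ H n).2.1 ≤ (blocks ρ H (n + 1)).2.1 := by
        rw [blocks]
        split_ifs
        · exact (hB n).le₂₃
        · exact le_rfl
      have h₂ : List.range (blocks ρ H (n + 1)).2.1 = List.range (blocks ρ H n).2.1 ++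
          List.range' (blocks ρ H n).2.1 ((blocks ρ H (n + 1)).2.1 - (blocks ρ H n).2.1) := by
        rw [List.range_eq_range', List.range_eq_range']
        have := List.range'_append_1 (s := 0) (m := (blocks ρ H n).2.1)
          (n := (blocks ρ H (n + 1)).2.1 - (blocks ρ H n).2.1)
        rw [Nat.zero_add, Nat.add_sub_cancel' hle] at this
        exact this.symm
      rw [h₁, h₂]
      exact List.rel_append ih (hout n _ (hmem n))

end Monitor

/-! ### Resources of the program -/

/-- A numbering of the pointers. -/
def Ptr.toFin : Ptr ↪ Fin 9 where
  toFun
    | .head => 0 | .blk₁ => 1 | .blk₂ => 2 | .blk₃ => 3 | .cur => 4 | .wit => 5 | .obs => 6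
    | .after => 7 | .before => 8
  inj' x y h := by cases x <;> cases y <;> first | rfl | simp at h

theorem MTL.exists_list_sorted {P : Type u} (φ : MTL P) :
    ∃ l : List (MTL P), (∀ χ, χ ∈ l ↔ χ ∈ φ.subformulas) ∧ l.length = φ.size ∧
      l.Pairwise fun χ χ' => χ.depth ≤ χ'.depth := by
  refine ⟨φ.subformulas.toList.mergeSort fun χ χ' => decide (χ.depth ≤ χ'.depth), fun χ => ?_, ?_, ?_⟩
  · rw [List.mem_mergeSort, Finset.mem_toList]
  · rw [List.length_mergeSort, Finset.length_toList, size]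
  · have := List.pairwise_mergeSort (le := fun χ χ' : MTL P => decide (χ.depth ≤ χ'.depth))
      (fun a b c => by simpa using le_trans) (fun a b => by simpa using le_total a.depth b.depth)
      φ.subformulas.toList
    simpa using this

theorem MTL.exists_index {P : Type u} (φ : MTL P) :
    ∃ idx : MTL P → Fin φ.size, Set.InjOn idx {χ | χ ∈ φ.subformulas} := by
  classical
  let e : φ.subformulas ≃ Fin φ.size := φ.subformulas.equivFin
  refine ⟨fun χ => if h : χ ∈ φ.subformulas then e ⟨χ, h⟩ else ⟨0, φ.size_pos⟩, ?_⟩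
  intro χ hχ χ' hχ' h
  have hχ : χ ∈ φ.subformulas := hχ
  have hχ' : χ' ∈ φ.subformulas := hχ'
  simpa [hχ, hχ'] using h

/-- One program serves all traces of variability `k`. -/
theorem exists_monitor {P : Type u} {m : ℕ} (Φ : LTL (Fin m)) (ψ : Fin m → MTL P)
    (hψ : ∀ i, (ψ i).Bounded) {k : ℕ} (hk : 1 ≤ k) :
    ∃ M : Monitor P m,
      (M.arraySize : ℚ) ≤ 500 * (k * ((Φ.subst ψ).cSum + 1) * (Φ.subst ψ).size) ∧
      M.ptrs ≤ 500 * (Φ.subst ψ).size ∧ M.body.size ≤ 500 * (Φ.subst ψ).size ∧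
      ∀ ρ : TimedWord P, ρ.HasVariability k → ∃ r : M.Run ρ,
        (∀ n, r.totalCost n ≤ 500 * (Φ.subst ψ).size * n) ∧
        (∀ n, LTL.Records ρ ψ Φ.atoms (r.word n)) ∧ ∀ j, ∃ n, j < (r.word n).length := by
  set φ := Φ.subst ψ with hφ
  obtain ⟨l, hl, hlen, hsort⟩ := φ.exists_list_sorted
  obtain ⟨idx, hidx⟩ := φ.exists_index
  have hN := φ.size_pos
  have hH := φ.cSum_nonneg
  set h := ⌈2 * φ.cSum⌉₊ with hh
  have hceil : 2 * φ.cSum ≤ h := Nat.le_ceil _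
  have hceil' : (h : ℚ) < 2 * φ.cSum + 1 := Nat.ceil_lt_add_one (by linarith)
  -- three blocks of at most `k * h + 1` events, the current event, and the column after the window
  let M : Monitor P m :=
    { cols := 3 * (k * h + 1) + 2
      rows := φ.size
      ptrs := 9
      body := .main Ptr.toFin idx φ.cSum l
      row := fun i => idx (ψ i) }
  refine ⟨M, ?_, ?_, ?_, fun ρ hρ => ?_⟩
  · have hk' : (1 : ℚ) ≤ k := by exact_mod_cast hk
    have hN' : (1 : ℚ) ≤ φ.size := by exact_mod_cast hN
    have h₁ : (M.arraySize : ℚ) = (φ.size + 1) * (3 * (k * h + 1) + 2) := by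
      simp only [Monitor.arraySize, M]; push_cast; ring
    rw [h₁]
    have h₂ : (k : ℚ) * h ≤ k * (2 * φ.cSum + 1) := mul_le_mul_of_nonneg_left hceil'.le (by linarith)
    have h₃ : 0 ≤ (k : ℚ) * φ.cSum := mul_nonneg (by linarith) hH
    calc ((φ.size : ℚ) + 1) * (3 * (k * h + 1) + 2)
        ≤ (2 * φ.size) * (8 * (k * (φ.cSum + 1))) :=
          mul_le_mul (by linarith) (by nlinarith) (by positivity) (by linarith)
      _ ≤ 500 * (k * (φ.cSum + 1) * φ.size) := by
          have : 0 ≤ (k : ℚ) * (φ.cSum + 1) * φ.size := by positivity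
          linarith
  · show 9 ≤ _
    omega
  · refine (Cmd.size_main _ _ _ _).trans ?_
    rw [hlen]
    omega
  · obtain ⟨r, hcost, hword⟩ := Monitor.exists_run (M := M) (pt := Ptr.toFin) (idx := idx) (ρ := ρ)
      (S := {χ | χ ∈ φ.subformulas}) hidx (fun χ hχ χ' h => MTL.subformulas_trans hχ h) l hl hsort
      (by omega) (H := φ.cSum) (B := k * h + 1) (fun n => Monitor.blocksOk hρ (by linarith) n)
      (by show _ < 3 * (k * h + 1) + 2; omega) rfl
    refine ⟨r, fun n => by rw [← hlen]; exact hcost n, fun n j α hα q hq => ?_, fun j => ?_⟩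
    · have hj := List.getElem?_eq_some_iff.1 hα
      have hmem := LTL.subformulas_subst ψ hq
      have := (List.forall₂_iff_get.1 (hword n)).2 j hj.1 (by
        rw [← (hword n).length_eq]; exact hj.1) q (ψ q) hmem (hψ q)
        ((ψ q).horizon_le_cSum.trans (MTL.cSum_mono hmem)) rfl
      simpa [hj.2] using this
    · obtain ⟨n, hn⟩ := Monitor.exists_lt_blocks ρ φ.cSum j
      refine ⟨n, ?_⟩
      rw [(hword n).length_eq, List.length_range]
      exact hn

theorem Monitor.Run.reaches_iff {P : Type u} {m : ℕ} {M : Monitor P m} {ρ : TimedWord P}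
    (r : M.Run ρ) {σ : Type} (D : DFA (Fin m → Bool) σ) :
    r.Reaches D ↔ ∃ n w, w <+: r.word n ∧ w ∈ D.accepts := Iff.rfl

theorem mainTheorem5 :
    ∃ C : ℕ, ∀ (m : ℕ) (Φ : LTL (Fin m)),
      ∃ (s₁ s₂ : ℕ) (Dgood : DFA (Fin m → Bool) (Fin s₁)) (Dbad : DFA (Fin m → Bool) (Fin s₂)),
        s₁ ≤ 2 ^ 2 ^ (C * Φ.size) ∧ s₂ ≤ 2 ^ 2 ^ (C * Φ.size) ∧
        (∀ w, w ∈ Dgood.accepts ↔ LTL.InformativeGood w Φ) ∧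
        (∀ w, w ∈ Dbad.accepts ↔ LTL.InformativeBad w Φ) ∧
        ∀ (P : Type u) (ψ : Fin m → MTL P), (∀ i, (ψ i).Bounded) → ∀ k : ℕ, 1 ≤ k →
          ∃ M : Monitor P m,
            (M.arraySize : ℚ) ≤ C * (k * ((Φ.subst ψ).cSum + 1) * (Φ.subst ψ).size) ∧
            M.ptrs ≤ C * (Φ.subst ψ).size ∧
            M.body.size ≤ C * (Φ.subst ψ).size ∧
            ∀ ρ : TimedWord P, ρ.HasVariability k →
              ∃ r : M.Run ρ,
                (∀ n, r.totalCost n ≤ C * (Φ.subst ψ).size * n) ∧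
                (∀ n j a, (r.word n)[j]? = some a →
                  ∀ i ∈ Φ.atoms, (a i = true ↔ MTL.Sat ρ j (ψ i))) ∧
                (∀ j, ∃ n, j < (r.word n).length) ∧
                (r.Reaches Dgood ↔ ∃ n, MTL.InformativeGood ρ n (Φ.subst ψ)) ∧
                (r.Reaches Dbad ↔ ∃ n, MTL.InformativeBad ρ n (Φ.subst ψ)) := by
  refine ⟨500, fun m Φ => ?_⟩
  obtain ⟨s₁, Dgood, hs₁, hgood⟩ := Φ.exists_goodDFA
  obtain ⟨s₂, Dbad, hs₂, hbad⟩ := Φ.exists_badDFA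
  refine ⟨s₁, s₂, Dgood, Dbad, hs₁.trans ?_, hs₂.trans ?_, hgood, hbad, fun P ψ hψ k hk => ?_⟩
  · exact Nat.pow_le_pow_right two_pos (Nat.pow_le_pow_right two_pos
      (Nat.mul_le_mul_right _ (by norm_num)))
  · exact Nat.pow_le_pow_right two_pos (Nat.pow_le_pow_right two_pos
      (Nat.mul_le_mul_right _ (by norm_num)))
  · obtain ⟨M, h₁, h₂, h₃, hM⟩ := exists_monitor Φ ψ hψ hk
    refine ⟨M, by exact_mod_cast h₁, h₂, h₃, fun ρ hρ => ?_⟩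
    obtain ⟨r, hcost, hrec, hlen⟩ := hM ρ hρ
    refine ⟨r, hcost, hrec, hlen, ?_, ?_⟩
    · rw [r.reaches_iff, ← LTL.exists_informativeGood_iff hψ hrec hlen]
      simp only [hgood]
    · rw [r.reaches_iff, ← LTL.exists_informativeBad_iff hψ hrec hlen]
      simp only [hbad]
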